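/- Let $n\ge 1$ and let $\vec q=(q_1,\dots,q_n)$ with $1<q_j<\infty$ for every $j$. For measurable $f:\mathbb R^n\to\mathbb C$ put $$\|f\|_{\vec q}=\left(\int_{\mathbb R}\cdots\left(\int_{\mathbb R}\left(\int_{\mathbb R}|f(x_1,\dots,x_n)|^{q_1}\,dx_1\right)^{q_2/q_1}dx_2\right)^{q_3/q_2}\cdots dx_n\right)^{1/q_n},$$ and let $L^{\vec q}(\mathbb R^n)$ be the space of (classes of almost everywhere equal) measurable functions with $\|f\|_{\vec q}<\infty$. Let $T$ be a singular integral (Calderón–Zygmund) operator with kernel $k$, that is, $T$ is a bounded linear operator on $L^2(\mathbb R^n)$ and $k:\mathbb R^n\times\mathbb R^n\to\mathbb C$ satisfies: (1) there is $C>0$ such that $|k(x,y)|\le C|x-y|^{-n}$ for all $x\ne y$; (2) there are $\varepsilon>0$ and $C>0$ such that $$|k(x,y)-k(z,y)|+|k(y,x)-k(y,z)|\le C\frac{|x-z|^{\varepsilon}}{|x-y|^{n+\varepsilon}}\quad\text{whenever } x\ne y,\ |x-y|\ge 2|x-z|;$$ (3) for every bounded measurable function $f$ with compact support, $Tf(x)=\int_{\mathbb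 R^n}k(x,y)f(y)\,dy$ for almost every $x\notin\operatorname{supp}f$. Then $T$ is bounded on $L^{\vec q}(\mathbb R^n)$: there is a unique linear operator $S:L^{\vec q}(\mathbb R^n)\to L^{\vec q}(\mathbb R^n)$ that is bounded, i.e. $$\|Sf\|_{\vec q}\le C\|f\|_{\vec q}\qquad\text{for all } f\in L^{\vec q}(\mathbb R^n)$$ with a constant $C$ independent of $f$, and that agrees with $T$ on $L^2(\mathbb R^n)\cap L^{\vec q}(\mathbb R^n)$. In particular $\|Tf\|_{\vec q}\le C\|f\|_{\vec q}$ for all $f\in L^2(\mathbb R^n)\cap L^{\vec q}(\mathbb R^n)$. -/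

import Mathlib

open MeasureTheory
open scoped ENNReal NNReal

noncomputable section

/-- The iterated (mixed) Lebesgue norm of a function `F` of `n` real variables with values in
`[0, ∞]`: first the `L^{p 0}` norm in the variable `x 0` is taken, then the `L^{p 1}` norm in the
variable `x 1`, and so on. -/
def iteratedNorm : (n : ℕ) → (Fin n → ℝ≥0∞) → ((Fin n → ℝ) → ℝ≥0∞) → ℝ≥0∞
  | 0, _, F => F Fin.elim0
  | n + 1, p, F =>
      iteratedNorm n (fun j => p j.succ)
        (fun y => eLpNorm (fun t : ℝ => F (Fin.cons t y)) (p 0) volume)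

/-- The mixed Lebesgue norm `‖f‖_{(p_1, …, p_n)}` of a function `f : ℝⁿ → ℂ`. -/
def mixedNorm {n : ℕ} (p : Fin n → ℝ≥0∞) (f : EuclideanSpace ℝ (Fin n) → ℂ) : ℝ≥0∞ :=
  iteratedNorm n p (fun x => ‖f (WithLp.toLp 2 x)‖ₑ)

theorem iteratedNorm_zero : ∀ (n : ℕ) (p : Fin n → ℝ≥0∞),
    iteratedNorm n p (fun _ => 0) = 0
  | 0, _ => rfl
  | n + 1, p => by
      have h : eLpNorm (fun _ : ℝ => (0 : ℝ≥0∞)) (p 0) volume = 0 := eLpNorm_zero'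
      simp only [iteratedNorm, h]
      exact iteratedNorm_zero n _

theorem measurable_eLpNorm_slice {n : ℕ} (p : ℝ≥0∞) {F : (Fin (n + 1) → ℝ) → ℝ≥0∞}
    (hF : Measurable F) :
    Measurable (fun y : Fin n → ℝ => eLpNorm (fun t : ℝ => F (Fin.cons t y)) p volume) := by
  have hc : Measurable (fun z : (Fin n → ℝ) × ℝ => F (Fin.cons z.2 z.1)) := by
    refine hF.comp (measurable_pi_iff.2 fun j => ?_)
    refine Fin.cases ?_ (fun i => ?_) j
    · simpa using measurable_snd
    · simpa [Function.comp_def] using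
        (measurable_pi_apply (X := fun _ : Fin n => ℝ) i).comp
          (measurable_fst (α := Fin n → ℝ) (β := ℝ))
  rcases eq_or_ne p 0 with rfl | h0
  · simp
  rcases eq_or_ne p ∞ with rfl | htop
  · simp only [eLpNorm_exponent_top, eLpNormEssSup, enorm_eq_self]
    refine measurable_of_Iic fun a => ?_
    have hs : MeasurableSet {z : (Fin n → ℝ) × ℝ | a < F (Fin.cons z.2 z.1)} :=
      measurableSet_lt measurable_const hc
    have hm := measurable_measure_prodMk_left (ν := (volume : Measure ℝ)) hs
    convert hm (measurableSet_singleton 0) using 1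
    ext y
    simp only [Set.mem_preimage, Set.mem_Iic, Set.mem_singleton_iff]
    constructor
    · intro h
      have h1 := ae_le_essSup (μ := (volume : Measure ℝ)) (f := fun t : ℝ => F (Fin.cons t y))
      have h2 : ∀ᵐ t : ℝ, ¬ a < F (Fin.cons t y) := by
        filter_upwards [h1] with t ht
        exact not_lt.2 (ht.trans h)
      simpa [ae_iff] using h2
    · intro h
      refine essSup_le_of_ae_le a ?_
      have h2 : ∀ᵐ t : ℝ, ¬ a < F (Fin.cons t y) := by simpa [ae_iff] using h
      filter_upwards [h2] with t ht
      exact not_lt.1 ht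
  · simp only [eLpNorm_eq_lintegral_rpow_enorm_toReal h0 htop, enorm_eq_self]
    exact (Measurable.lintegral_prod_right' (f := fun z : (Fin n → ℝ) × ℝ =>
      F (Fin.cons z.2 z.1) ^ p.toReal) (hc.pow_const _)).pow_const _

theorem ae_slice {n : ℕ} {P : (Fin (n + 1) → ℝ) → Prop} (h : ∀ᵐ x, P x) :
    ∀ᵐ y : Fin n → ℝ, ∀ᵐ t : ℝ, P (Fin.cons t y) := by
  have h1 := (volume_preserving_piFinSuccAbove (fun _ : Fin (n + 1) => ℝ) 0).symm
  have h2 := h1.quasiMeasurePreserving.ae h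
  have h3 := (Measure.measurePreserving_swap (μ := (volume : Measure (Fin n → ℝ)))
    (ν := (volume : Measure ℝ))).quasiMeasurePreserving.ae h2
  have h4 := Measure.ae_ae_of_ae_prod h3
  filter_upwards [h4] with y hy
  filter_upwards [hy] with t ht
  simpa [MeasurableEquiv.piFinSuccAbove, Fin.insertNthEquiv] using ht

theorem exists_iteratedNorm_le : ∀ (n : ℕ) (p : Fin n → ℝ≥0∞) (c : ℝ≥0), ∃ C : ℝ≥0,
    ∀ F G H : (Fin n → ℝ) → ℝ≥0∞, Measurable G → Measurable H →
      (∀ᵐ x, F x ≤ c * (G x + H x)) →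
      iteratedNorm n p F ≤ C * (iteratedNorm n p G + iteratedNorm n p H)
  | 0, p, c => ⟨c, fun F G H _ _ h => by
      obtain ⟨x, hx⟩ := h.exists
      rw [Subsingleton.elim x Fin.elim0] at hx
      exact hx⟩
  | n + 1, p, c => by
      have hK : ENNReal.LpAddConst (p 0) ≠ ∞ := (ENNReal.LpAddConst_lt_top (p 0)).ne
      obtain ⟨C, hC⟩ := exists_iteratedNorm_le n (fun j => p j.succ)
        (c * (ENNReal.LpAddConst (p 0)).toNNReal)
      refine ⟨C, fun F G H hG hH h => ?_⟩
      refine hC _ _ _ (measurable_eLpNorm_slice (p 0) hG) (measurable_eLpNorm_slice (p 0) hH) ?_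
      filter_upwards [ae_slice h] with y hy
      have hmeas : ∀ {K : (Fin (n + 1) → ℝ) → ℝ≥0∞}, Measurable K →
          AEStronglyMeasurable (fun t : ℝ => K (Fin.cons t y)) volume := by
        intro K hK
        refine (hK.comp (measurable_pi_iff.2 fun j => ?_)).aestronglyMeasurable
        refine Fin.cases ?_ (fun i => ?_) j
        · simpa using measurable_id'
        · simp
      have h1 := eLpNorm_le_mul_eLpNorm_of_ae_le_mul'
        (f := fun t : ℝ => F (Fin.cons t y))
        (g := (fun t : ℝ => G (Fin.cons t y)) + fun t : ℝ => H (Fin.cons t y))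
        (c := c) (by simpa using hy) (p 0)
      have h2 := eLpNorm_add_le' (hmeas hG) (hmeas hH) (p 0)
      refine h1.trans ?_
      rw [ENNReal.coe_mul, ENNReal.coe_toNNReal hK, mul_assoc]
      gcongr

theorem exists_mixedNorm_le {n : ℕ} (p : Fin n → ℝ≥0∞) (c : ℝ≥0) : ∃ C : ℝ≥0,
    ∀ f g h : EuclideanSpace ℝ (Fin n) → ℂ, Measurable g → Measurable h →
      (∀ᵐ x, ‖f x‖ₑ ≤ c * (‖g x‖ₑ + ‖h x‖ₑ)) →
      mixedNorm p f ≤ C * (mixedNorm p g + mixedNorm p h) := by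
  obtain ⟨C, hC⟩ := exists_iteratedNorm_le n p c
  refine ⟨C, fun f g h hg hh H => ?_⟩
  have hv := PiLp.volume_preserving_toLp (Fin n)
  exact hC _ _ _ (hg.comp hv.measurable).enorm (hh.comp hv.measurable).enorm
    (hv.quasiMeasurePreserving.ae H)

/-- The mixed Lebesgue space `L^{(p_1, …, p_n)}(ℝⁿ)` of (classes of almost everywhere equal)
measurable functions with finite mixed norm, as a linear subspace of `L^0(ℝⁿ)`. -/
def MixedLebesgue {n : ℕ} (p : Fin n → ℝ≥0∞) :
    Submodule ℂ (EuclideanSpace ℝ (Fin n) →ₘ[volume] ℂ) where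
  carrier := {f | mixedNorm p f < ∞}
  zero_mem' := by
    obtain ⟨C, hC⟩ := exists_mixedNorm_le p 1
    have h0 : mixedNorm p (fun _ => 0) = 0 := by
      simpa [mixedNorm] using iteratedNorm_zero n p
    have h := hC (0 : EuclideanSpace ℝ (Fin n) →ₘ[volume] ℂ) (fun _ => 0) (fun _ => 0)
      measurable_const measurable_const (by
        filter_upwards [AEEqFun.coeFn_zero (α := EuclideanSpace ℝ (Fin n)) (β := ℂ)
          (μ := volume)] with x hx
        simp [hx])
    rw [h0] at h
    exact lt_of_le_of_lt h (by simp)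
  add_mem' := by
    intro f g hf hg
    obtain ⟨C, hC⟩ := exists_mixedNorm_le p 1
    have h := hC (f + g : EuclideanSpace ℝ (Fin n) →ₘ[volume] ℂ) f g
      f.measurable g.measurable (by
        filter_upwards [AEEqFun.coeFn_add f g] with x hx
        rw [hx]
        simpa using enorm_add_le (f x) (g x))
    exact lt_of_le_of_lt h (ENNReal.mul_lt_top ENNReal.coe_lt_top (ENNReal.add_lt_top.2 ⟨hf, hg⟩))
  smul_mem' := by
    intro c f hf
    obtain ⟨C, hC⟩ := exists_mixedNorm_le p ‖c‖₊
    have h := hC (c • f : EuclideanSpace ℝ (Fin n) →ₘ[volume] ℂ) f f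
      f.measurable f.measurable (by
        filter_upwards [AEEqFun.coeFn_smul c f] with x hx
        rw [hx, Pi.smul_apply, enorm_smul]
        exact mul_le_mul_right (le_add_right le_rfl) _)
    exact lt_of_le_of_lt h (ENNReal.mul_lt_top ENNReal.coe_lt_top (ENNReal.add_lt_top.2 ⟨hf, hf⟩))

/-- `T` is a singular integral (Calderón–Zygmund) operator on `ℝⁿ` with kernel `k`: a bounded
linear operator on `L²(ℝⁿ)` whose kernel satisfies the standard size and regularity estimates off
the diagonal, and which is given by integration against the kernel off the support of bounded
functions with compact support. -/
structure IsSingularIntegralOperator {n : ℕ}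
    (k : EuclideanSpace ℝ (Fin n) → EuclideanSpace ℝ (Fin n) → ℂ)
    (T : Lp ℂ 2 (volume : Measure (EuclideanSpace ℝ (Fin n))) →L[ℂ]
      Lp ℂ 2 (volume : Measure (EuclideanSpace ℝ (Fin n)))) : Prop where
  size : ∃ C > (0 : ℝ), ∀ x y, x ≠ y → ‖k x y‖ ≤ C / ‖x - y‖ ^ n
  regularity : ∃ ε > (0 : ℝ), ∃ C > (0 : ℝ), ∀ x y z, x ≠ y → 2 * ‖x - z‖ ≤ ‖x - y‖ →
    ‖k x y - k z y‖ + ‖k y x - k y z‖ ≤ C * ‖x - z‖ ^ ε / ‖x - y‖ ^ ((n : ℝ) + ε)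
  representation : ∀ (f : EuclideanSpace ℝ (Fin n) → ℂ)
    (g : Lp ℂ 2 (volume : Measure (EuclideanSpace ℝ (Fin n)))),
    MemLp f ∞ volume → HasCompactSupport f → g =ᵐ[volume] f →
      ∀ᵐ x, x ∉ tsupport f → T g x = ∫ y, k x y * f y

end

/-! The theorem is proved by moving from `L²` to arbitrary mixed exponents, changing the exponents
of a whole block of outer variables at a time. Split the coordinates as `(u, v)`, with `u` the first
`j` of them, and regard a function on `ℝⁿ` as a function of `v` with values in a mixed Lebesgue
space in `u`. If the exponents of `u` form a vector `a` and those of `v` are all equal to `p`, the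
mixed norm is the `L^p` norm in `v` of this vector-valued function. Calderón–Zygmund theory in `v`
alone then replaces `p` by any other exponent in `(1, ∞)`.

The vector-valued Hörmander condition comes from the scalar one. For `b` with mean zero in `v`, the
kernel may be replaced by its difference at `(u', v')` and `(u', c)`, which is bounded by a function
of `x - (u', c)`. In `u` this is a convolution, so Minkowski's inequality and translation invariance
bound the `a`-norm (`iteratedNorm_conv_le`), and what remains is the integral of `‖z‖ ^ (-(n + ε))`
over the exterior of a ball (`IsCZ.lintegral_fiberNorm_le_of_mean_zero`). A Calderón–Zygmund
decomposition in `v` gives the weak-type bound `IsCZ.weak_type`. A Marcinkiewicz argument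
(`lintegral_rpow_le_of_weak`) lowers the exponent, and duality (`CZBounded.dual`) raises it, because
adjoints of these operators have regular kernels too.

Starting from all exponents equal to `2`, `CZBounded.of_exponents` adjusts the blocks `v` of
decreasing length: each step fixes one more leading exponent and resets all the later ones. The
mixed Lebesgue space is complete and contains the functions that are also in `L²` as a dense
subspace, so the estimate yields a unique bounded extension (`existsUnique_extension`).

Mixed norms are handled through duality throughout: Hölder's inequality and its converse
(`iteratedNorm.le_of_forall_lintegral_le`) exhibit the norm as a supremum of integrals. -/

open MeasureTheory
open scoped ENNReal NNReal

noncomputable section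

/-! ### Conjugate exponents and Tonelli's theorem in one coordinate. -/

/-- Componentwise conjugate exponents in `(1, ∞)`. -/
def ConjExps {n : ℕ} (p q : Fin n → ℝ≥0∞) : Prop :=
  ∀ j, (p j).toReal.HolderConjugate (q j).toReal

namespace ConjExps

variable {n : ℕ} {p q : Fin n → ℝ≥0∞}

theorem symm (h : ConjExps p q) : ConjExps q p := fun j => (h j).symm

theorem ne_zero (h : ConjExps p q) (j : Fin n) : p j ≠ 0 := fun h0 => by
  have := (h j).pos
  simp [h0] at this

theorem ne_top (h : ConjExps p q) (j : Fin n) : p j ≠ ∞ := fun h0 => by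
  have := (h j).pos
  simp [h0] at this

theorem tail {p q : Fin (n + 1) → ℝ≥0∞} (h : ConjExps p q) :
    ConjExps (fun j => p j.succ) (fun j => q j.succ) := fun j => h j.succ

theorem exists_conj (hp : ∀ j, 1 < p j ∧ p j < ∞) :
    ∃ q : Fin n → ℝ≥0∞, ConjExps p q := by
  refine ⟨fun j => ENNReal.ofReal ((p j).toReal.conjExponent), fun j => ?_⟩
  have h1 : 1 < (p j).toReal := by
    rw [← ENNReal.toReal_one]
    exact (ENNReal.toReal_lt_toReal ENNReal.one_ne_top (hp j).2.ne).2 (hp j).1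
  have := Real.HolderConjugate.conjExponent h1
  rwa [ENNReal.toReal_ofReal this.symm.nonneg]

theorem one_lt (h : ConjExps p q) (j : Fin n) : 1 < p j := by
  have := (h j).lt
  rw [← ENNReal.toReal_one] at this
  exact (ENNReal.toReal_lt_toReal ENNReal.one_ne_top (h.ne_top j)).1 this

end ConjExps

theorem measurable_finCons {n : ℕ} :
    Measurable (fun z : ℝ × (Fin n → ℝ) => (Fin.cons z.1 z.2 : Fin (n + 1) → ℝ)) := by
  refine measurable_pi_iff.2 fun j => ?_
  refine Fin.cases ?_ (fun i => ?_) j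
  · simpa using measurable_fst
  · simpa [Function.comp_def] using
      (measurable_pi_apply (X := fun _ : Fin n => ℝ) i).comp
        (measurable_snd (α := ℝ) (β := Fin n → ℝ))

theorem measurable_finCons_left {n : ℕ} (y : Fin n → ℝ) :
    Measurable (fun t : ℝ => (Fin.cons t y : Fin (n + 1) → ℝ)) :=
  measurable_finCons.comp (measurable_id.prodMk measurable_const)

theorem measurePreserving_finCons (n : ℕ) :
    MeasurePreserving (fun z : ℝ × (Fin n → ℝ) => (Fin.cons z.1 z.2 : Fin (n + 1) → ℝ)) := by
  have h1 := (volume_preserving_piFinSuccAbove (fun _ : Fin (n + 1) => ℝ) 0).symm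
  convert h1 using 1
  ext z j
  simp [MeasurableEquiv.piFinSuccAbove, Fin.insertNthEquiv]

theorem lintegral_finCons {n : ℕ} {F : (Fin (n + 1) → ℝ) → ℝ≥0∞} (hF : Measurable F) :
    ∫⁻ x, F x = ∫⁻ y : Fin n → ℝ, ∫⁻ t : ℝ, F (Fin.cons t y) := by
  rw [← (measurePreserving_finCons n).lintegral_comp hF]
  exact lintegral_prod_symm' _ (hF.comp measurable_finCons)

/-- Converse of `ae_slice`. Measurability matters here, since the measure of the exceptional set is
computed by Tonelli. -/
theorem ae_of_ae_slice {n : ℕ} {P : (Fin (n + 1) → ℝ) → Prop} (hP : MeasurableSet {x | P x})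
    (h : ∀ᵐ y : Fin n → ℝ, ∀ᵐ t : ℝ, P (Fin.cons t y)) : ∀ᵐ x, P x := by
  have h0 : ∫⁻ x, {x | P x}ᶜ.indicator (fun _ => (1 : ℝ≥0∞)) x = 0 := by
    rw [lintegral_finCons (measurable_const.indicator hP.compl)]
    refine (lintegral_congr_ae ?_).trans lintegral_zero
    filter_upwards [h] with y hy
    refine (lintegral_congr_ae ?_).trans lintegral_zero
    filter_upwards [hy] with t ht
    simp [ht]
  rw [lintegral_indicator_const hP.compl, one_mul] at h0
  exact h0

theorem eLpNorm_ennreal_eq {α : Type*} [MeasurableSpace α] {μ : Measure α} {p : ℝ≥0∞}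
    (h0 : p ≠ 0) (htop : p ≠ ∞) (F : α → ℝ≥0∞) :
    eLpNorm F p μ = (∫⁻ t, F t ^ p.toReal ∂μ) ^ (1 / p.toReal) := by
  simp [eLpNorm_eq_lintegral_rpow_enorm_toReal h0 htop]

/-! ### Hölder's inequality for mixed norms and its converse. -/

namespace iteratedNorm

variable {n : ℕ}

theorem succ (p : Fin (n + 1) → ℝ≥0∞) (F : (Fin (n + 1) → ℝ) → ℝ≥0∞) :
    iteratedNorm (n + 1) p F = iteratedNorm n (fun j => p j.succ)
      (fun y => eLpNorm (fun t : ℝ => F (Fin.cons t y)) (p 0) volume) := rfl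

theorem mono_ae : ∀ {n : ℕ} {p : Fin n → ℝ≥0∞} {F G : (Fin n → ℝ) → ℝ≥0∞},
    (∀ᵐ x, F x ≤ G x) → iteratedNorm n p F ≤ iteratedNorm n p G
  | 0, p, F, G, h => by
      -- The space `Fin 0 → ℝ` is one point of positive mass, so an a.e. statement holds at that
      -- point.
      obtain ⟨x, hx⟩ := h.exists
      rw [Subsingleton.elim x Fin.elim0] at hx
      exact hx
  | n + 1, p, F, G, h => by
      rw [succ, succ]
      refine mono_ae ?_
      filter_upwards [ae_slice h] with y hy
      exact eLpNorm_mono_enorm_ae (by simpa using hy)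

theorem mono {p : Fin n → ℝ≥0∞} {F G : (Fin n → ℝ) → ℝ≥0∞} (h : ∀ x, F x ≤ G x) :
    iteratedNorm n p F ≤ iteratedNorm n p G := mono_ae (Filter.Eventually.of_forall h)

theorem congr_ae {p : Fin n → ℝ≥0∞} {F G : (Fin n → ℝ) → ℝ≥0∞} (h : ∀ᵐ x, F x = G x) :
    iteratedNorm n p F = iteratedNorm n p G :=
  le_antisymm (mono_ae (h.mono fun _ hx => hx.le)) (mono_ae (h.mono fun _ hx => hx.ge))

theorem const_mul_le : ∀ {n : ℕ} (p : Fin n → ℝ≥0∞) (c : ℝ≥0) (F : (Fin n → ℝ) → ℝ≥0∞),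
    iteratedNorm n p (fun x => c * F x) ≤ c * iteratedNorm n p F
  | 0, p, c, F => le_rfl
  | n + 1, p, c, F => by
      rw [succ, succ]
      refine le_trans (mono fun y => ?_) (const_mul_le (fun j => p j.succ) c _)
      exact eLpNorm_le_mul_eLpNorm_of_ae_le_mul' (c := c)
        (Filter.Eventually.of_forall fun t => by simp) (p 0)

theorem const_mul_le' (p : Fin n → ℝ≥0∞) {c : ℝ≥0∞} (hc : c ≠ ∞) (F : (Fin n → ℝ) → ℝ≥0∞) :
    iteratedNorm n p (fun x => c * F x) ≤ c * iteratedNorm n p F := by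
  lift c to ℝ≥0 using hc
  exact const_mul_le p c F

/-- Hölder in the innermost variable leaves the integral of a product of slice norms, to which the
induction applies. -/
theorem holder : ∀ {n : ℕ} {p q : Fin n → ℝ≥0∞} (_ : ConjExps p q)
    {F G : (Fin n → ℝ) → ℝ≥0∞} (_ : Measurable F) (_ : Measurable G),
    ∫⁻ x, F x * G x ≤ iteratedNorm n p F * iteratedNorm n q G
  | 0, p, q, _, F, G, _, _ => by
      have : (volume : Measure (Fin 0 → ℝ)) = Measure.dirac Fin.elim0 := Measure.volume_pi_eq_dirac _
      rw [this, lintegral_dirac]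
      rfl
  | n + 1, p, q, h, F, G, hF, hG => by
      rw [lintegral_finCons (F := fun x => F x * G x) (hF.mul hG)]
      refine le_trans (lintegral_mono fun y => ?_)
        (holder h.tail (measurable_eLpNorm_slice (p 0) hF) (measurable_eLpNorm_slice (q 0) hG))
      rw [eLpNorm_ennreal_eq (h.ne_zero 0) (h.ne_top 0),
        eLpNorm_ennreal_eq (h.symm.ne_zero 0) (h.symm.ne_top 0)]
      exact ENNReal.lintegral_mul_le_Lp_mul_Lq volume (h 0)
        (hF.comp (measurable_finCons_left y)).aemeasurable
        (hG.comp (measurable_finCons_left y)).aemeasurable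

/-- The normalised extremal function in Hölder's inequality. -/
theorem eLpNorm_extremal {α : Type*} [MeasurableSpace α] {μ : Measure α} {p q : ℝ≥0∞}
    (h : p.toReal.HolderConjugate q.toReal) {H : α → ℝ≥0∞} (hH : Measurable H)
    (hfin : eLpNorm H p μ ≠ ∞) :
    eLpNorm (fun t => H t ^ (p.toReal - 1) / eLpNorm H p μ ^ (p.toReal - 1)) q μ ≤ 1 ∧
    eLpNorm H p μ ≤
      ∫⁻ t, H t * (H t ^ (p.toReal - 1) / eLpNorm H p μ ^ (p.toReal - 1)) ∂μ := by
  have hp0 : p ≠ 0 := fun h0 => by simpa [h0] using h.pos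
  have hptop : p ≠ ∞ := fun h0 => by simpa [h0] using h.pos
  have hq0 : q ≠ 0 := fun h0 => by simpa [h0] using h.symm.pos
  have hqtop : q ≠ ∞ := fun h0 => by simpa [h0] using h.symm.pos
  have hp1 : 0 < p.toReal - 1 := h.sub_one_pos
  have hpp : 0 < p.toReal := h.pos
  set N := eLpNorm H p μ with hN
  have hNp : ∫⁻ t, H t ^ p.toReal ∂μ = N ^ p.toReal := by
    rw [hN, eLpNorm_ennreal_eq hp0 hptop, ← ENNReal.rpow_mul, one_div,
      inv_mul_cancel₀ hpp.ne', ENNReal.rpow_one]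
  -- For `N = 0` the numerator vanishes a.e., so the quotient is `0` despite the zero denominator.
  rcases eq_or_ne N 0 with hz | hz
  · constructor
    · have h0 : ∀ᵐ t ∂μ, H t = 0 := (eLpNorm_eq_zero_iff hH.aestronglyMeasurable hp0).1 hz
      have : eLpNorm (fun t => H t ^ (p.toReal - 1) / N ^ (p.toReal - 1)) q μ
          = eLpNorm (fun _ : α => (0 : ℝ≥0∞)) q μ := by
        refine eLpNorm_congr_ae ?_
        filter_upwards [h0] with t ht
        simp [ht, hp1]
      rw [this]
      simp
    · rw [hz]
      exact zero_le
  · have hc0 : N ^ (p.toReal - 1) ≠ 0 := by simp [hz, hp1.not_gt, hfin]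
    have hct : N ^ (p.toReal - 1) ≠ ∞ := ENNReal.rpow_ne_top_of_nonneg hp1.le hfin
    constructor
    · rw [eLpNorm_ennreal_eq hq0 hqtop]
      -- Conjugacy in the form `(p - 1) q = p` makes the `q`-th power equal to `H ^ p / N ^ p`, of
      -- integral one.
      have : ∀ t, (H t ^ (p.toReal - 1) / N ^ (p.toReal - 1)) ^ q.toReal
          = H t ^ p.toReal * (N ^ p.toReal)⁻¹ := fun t => by
        rw [ENNReal.div_rpow_of_nonneg _ _ h.symm.nonneg, ← ENNReal.rpow_mul, ← ENNReal.rpow_mul,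
          h.sub_one_mul_conj, div_eq_mul_inv]
      simp_rw [this]
      rw [lintegral_mul_const _ (hH.pow_const _), hNp, ENNReal.mul_inv_cancel]
      · simp
      · simp [hz, hfin]
      · exact ENNReal.rpow_ne_top_of_nonneg hpp.le hfin
    · have : ∀ t, H t * (H t ^ (p.toReal - 1) / N ^ (p.toReal - 1))
          = H t ^ p.toReal * (N ^ (p.toReal - 1))⁻¹ := fun t => by
        rw [div_eq_mul_inv, ← mul_assoc]
        congr 1
        conv_lhs => rw [← ENNReal.rpow_one (H t), ← ENNReal.rpow_mul, one_mul]
        rw [← ENNReal.rpow_add_of_nonneg _ _ zero_le_one hp1.le]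
        congr 1
        ring
      simp_rw [this]
      rw [lintegral_mul_const _ (hH.pow_const _), hNp, ← ENNReal.rpow_neg,
        ← ENNReal.rpow_add _ _ hz hfin]
      simp

/-- Truncation of a function of the first variable, in values and in support. -/
def truncFirst (N : ℕ) (F : (Fin (n + 1) → ℝ) → ℝ≥0∞) (x : Fin (n + 1) → ℝ) : ℝ≥0∞ :=
  min (F x) ((Set.Icc (-(N : ℝ)) N).indicator (fun _ => (N : ℝ≥0∞)) (x 0))

theorem measurable_truncFirst (N : ℕ) {F : (Fin (n + 1) → ℝ) → ℝ≥0∞} (hF : Measurable F) :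
    Measurable (truncFirst N F) :=
  hF.min ((measurable_const.indicator measurableSet_Icc).comp (measurable_pi_apply 0))

theorem monotone_truncFirst (F : (Fin (n + 1) → ℝ) → ℝ≥0∞) :
    Monotone (fun N => truncFirst N F) := fun N M h x => by
  have hNM : (N : ℝ) ≤ M := by exact_mod_cast h
  refine min_le_min le_rfl ?_
  refine (Set.indicator_le_indicator_of_subset (Set.Icc_subset_Icc (neg_le_neg hNM) hNM)
    (fun _ => zero_le) (x 0)).trans ?_
  exact Set.indicator_le_indicator (by exact_mod_cast h)

theorem iSup_truncFirst (F : (Fin (n + 1) → ℝ) → ℝ≥0∞) (x) :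
    ⨆ N, truncFirst N F x = F x := by
  refine le_antisymm (iSup_le fun N => min_le_left _ _) ?_
  refine le_of_forall_lt fun a ha => ?_
  obtain ⟨N, hN⟩ := ENNReal.exists_nat_gt ha.ne_top
  obtain ⟨M, hM⟩ := exists_nat_ge |x 0|
  refine lt_of_lt_of_le ?_ (le_iSup _ (max N M))
  refine lt_min ha ?_
  have : x 0 ∈ Set.Icc (-((max N M : ℕ) : ℝ)) ((max N M : ℕ) : ℝ) := by
    rw [Set.mem_Icc, ← abs_le]
    exact hM.trans (by exact_mod_cast le_max_right _ _)
  rw [Set.indicator_of_mem this]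
  exact hN.trans_le (by exact_mod_cast le_max_left _ _)

/-- Supplies the finiteness of every slice norm demanded by `eLpNorm_extremal`; monotone convergence
removes the truncation afterwards. -/
theorem eLpNorm_truncFirst_ne_top (N : ℕ) (F : (Fin (n + 1) → ℝ) → ℝ≥0∞) (y : Fin n → ℝ)
    (p : ℝ≥0∞) : eLpNorm (fun t : ℝ => truncFirst N F (Fin.cons t y)) p volume ≠ ∞ := by
  refine ne_top_of_le_ne_top ?_ (eLpNorm_mono_enorm (g := (Set.Icc (-(N : ℝ)) N).indicator
    (fun _ => (N : ℝ≥0∞))) fun t => by simp [truncFirst])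
  refine ((eLpNorm_indicator_const_le _ _).trans_lt ?_).ne
  refine ENNReal.mul_lt_top (by simp) (ENNReal.rpow_lt_top_of_nonneg (by positivity) ?_)
  simp

theorem eLpNorm_iSup {α : Type*} [MeasurableSpace α] {μ : Measure α} {p : ℝ≥0∞}
    (h0 : p ≠ 0) (htop : p ≠ ∞) {F : ℕ → α → ℝ≥0∞} (hF : ∀ k, Measurable (F k))
    (hmono : Monotone F) :
    eLpNorm (fun t => ⨆ k, F k t) p μ = ⨆ k, eLpNorm (F k) p μ := by
  have hp : 0 < p.toReal := ENNReal.toReal_pos h0 htop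
  simp_rw [eLpNorm_ennreal_eq h0 htop]
  have h1 : ∀ t, (⨆ k, F k t) ^ p.toReal = ⨆ k, F k t ^ p.toReal := fun t =>
    (ENNReal.orderIsoRpow p.toReal hp).map_iSup _
  simp_rw [h1]
  rw [lintegral_iSup (fun k => (hF k).pow_const _)
    (fun i j hij t => ENNReal.rpow_le_rpow (hmono hij t) hp.le)]
  exact (ENNReal.orderIsoRpow (1 / p.toReal) (by positivity)).map_iSup _

/-- The converse of Hölder's inequality for mixed norms. -/
theorem le_of_forall_lintegral_le : ∀ {n : ℕ} {p q : Fin n → ℝ≥0∞} (_ : ConjExps p q)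
    {H : (Fin n → ℝ) → ℝ≥0∞} (_ : Measurable H) {A : ℝ≥0∞}
    (_ : ∀ Φ, Measurable Φ → iteratedNorm n q Φ ≤ 1 → ∫⁻ x, H x * Φ x ≤ A),
    iteratedNorm n p H ≤ A
  | 0, p, q, _, H, _, A, h => by
      have := h (fun _ => 1) measurable_const le_rfl
      have h1 : (volume : Measure (Fin 0 → ℝ)) = Measure.dirac Fin.elim0 := Measure.volume_pi_eq_dirac _
      rw [h1, lintegral_dirac, mul_one] at this
      exact this
  | n + 1, p, q, hpq, H, hH, A, h => by
      rw [succ]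
      refine le_of_forall_lintegral_le hpq.tail (measurable_eLpNorm_slice (p 0) hH)
        fun Φ hΦ hΦ1 => ?_
      have hsup : ∀ y, eLpNorm (fun t : ℝ => H (Fin.cons t y)) (p 0) volume * Φ y
          = ⨆ N, eLpNorm (fun t : ℝ => truncFirst N H (Fin.cons t y)) (p 0) volume * Φ y := by
        intro y
        rw [← ENNReal.iSup_mul, ← eLpNorm_iSup (F := fun N t => truncFirst N H (Fin.cons t y))
          (hpq.ne_zero 0) (hpq.ne_top 0)
          (fun N => (measurable_truncFirst N hH).comp (measurable_finCons_left y))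
          (fun i j hij t => monotone_truncFirst H hij _)]
        simp_rw [iSup_truncFirst]
      simp_rw [hsup]
      rw [lintegral_iSup (f := fun N y =>
          eLpNorm (fun t : ℝ => truncFirst N H (Fin.cons t y)) (p 0) volume * Φ y)
        (fun N => (measurable_eLpNorm_slice (p 0) (measurable_truncFirst N hH)).mul hΦ)
        (fun i j hij y => mul_le_mul_left (eLpNorm_mono_enorm fun t => by
          simpa using monotone_truncFirst H hij _) _)]
      refine iSup_le fun N => ?_
      set K := truncFirst N H with hK
      have hKm : Measurable K := measurable_truncFirst N hH
      set a : (Fin n → ℝ) → ℝ≥0∞ :=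
        fun y => eLpNorm (fun t : ℝ => K (Fin.cons t y)) (p 0) volume with ha
      have ham : Measurable a := measurable_eLpNorm_slice (p 0) hKm
      have htm : Measurable (fun x : Fin (n + 1) → ℝ => (fun j => x (Fin.succ j))) :=
        measurable_pi_iff.2 fun j => measurable_pi_apply _
      -- The dual function for `H`: on each slice the Hölder extremal of the truncation `K`,
      -- weighted by the outer dual function `Φ`. Its inner norm is at most `Φ`.
      set Ψ : (Fin (n + 1) → ℝ) → ℝ≥0∞ := fun x =>
        (K x ^ ((p 0).toReal - 1) / a (fun j => x j.succ) ^ ((p 0).toReal - 1))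
          * Φ (fun j => x j.succ) with hΨ
      have hext := fun y => eLpNorm_extremal (hpq 0) (hKm.comp (measurable_finCons_left y))
        (μ := volume) (eLpNorm_truncFirst_ne_top N H y (p 0))
      have hΨm : Measurable Ψ :=
        ((hKm.pow_const _).div ((ham.comp htm).pow_const _)).mul (hΦ.comp htm)
      have hΨ1 : iteratedNorm (n + 1) q Ψ ≤ 1 := by
        rw [succ]
        refine le_trans (mono fun y => ?_) hΦ1
        simp only [hΨ, Fin.cons_succ]
        have hm : Measurable fun t : ℝ =>
            K (Fin.cons t y) ^ ((p 0).toReal - 1) / a y ^ ((p 0).toReal - 1) :=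
          ((hKm.comp (measurable_finCons_left y)).pow_const _).div_const _
        have h1 := (hext y).1
        rw [eLpNorm_ennreal_eq (hpq.symm.ne_zero 0) (hpq.symm.ne_top 0)] at h1 ⊢
        have hq0 := (hpq 0).symm.pos
        simp_rw [ENNReal.mul_rpow_of_nonneg _ _ hq0.le]
        rw [lintegral_mul_const _ (hm.pow_const _), ENNReal.mul_rpow_of_nonneg _ _ (by positivity),
          ← ENNReal.rpow_mul, mul_one_div_cancel hq0.ne', ENNReal.rpow_one]
        calc _ ≤ 1 * Φ y := mul_le_mul_left h1 _
          _ = Φ y := one_mul _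
      refine le_trans ?_ (h Ψ hΨm hΨ1)
      rw [lintegral_finCons (F := fun x => H x * Ψ x) (hH.mul hΨm)]
      refine lintegral_mono fun y => ?_
      have hm : Measurable fun t : ℝ => K (Fin.cons t y) *
            (K (Fin.cons t y) ^ ((p 0).toReal - 1) / a y ^ ((p 0).toReal - 1)) :=
          (hKm.comp (measurable_finCons_left y)).mul
            (((hKm.comp (measurable_finCons_left y)).pow_const _).div_const _)
      calc a y * Φ y ≤ (∫⁻ t, K (Fin.cons t y) *
            (K (Fin.cons t y) ^ ((p 0).toReal - 1) / a y ^ ((p 0).toReal - 1))) * Φ y :=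
            mul_le_mul_left (hext y).2 _
        _ = ∫⁻ t, K (Fin.cons t y) * (K (Fin.cons t y) ^ ((p 0).toReal - 1) /
              a y ^ ((p 0).toReal - 1)) * Φ y := (lintegral_mul_const _ hm).symm
        _ ≤ _ := lintegral_mono fun t => by
          simp only [hΨ, Fin.cons_succ, mul_assoc]
          exact mul_le_mul_left (min_le_left _ _) _

end iteratedNorm

/-! ### Minkowski, Fatou, dominated convergence and translation invariance for mixed norms. -/

namespace iteratedNorm

variable {n : ℕ} {p q : Fin n → ℝ≥0∞}

/-- Minkowski's integral inequality for mixed norms. -/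
theorem lintegral_le {Y : Type*} [MeasurableSpace Y] {μ : Measure Y} [SFinite μ]
    (h : ConjExps p q) {G : (Fin n → ℝ) → Y → ℝ≥0∞} (hG : Measurable (Function.uncurry G)) :
    iteratedNorm n p (fun x => ∫⁻ y, G x y ∂μ) ≤ ∫⁻ y, iteratedNorm n p (fun x => G x y) ∂μ := by
  -- Against a fixed dual function `Φ` the two integrals commute by Tonelli, and Hölder applies for
  -- each `y`.
  refine le_of_forall_lintegral_le h hG.lintegral_prod_right' fun Φ hΦ hΦ1 => ?_
  have hm : Measurable (Function.uncurry fun x y => G x y * Φ x) :=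
    hG.mul (hΦ.comp measurable_fst)
  calc ∫⁻ x, (∫⁻ y, G x y ∂μ) * Φ x = ∫⁻ x, ∫⁻ y, G x y * Φ x ∂μ :=
        lintegral_congr fun x => (lintegral_mul_const _ (hG.comp measurable_prodMk_left)).symm
    _ = ∫⁻ y, (∫⁻ x, G x y * Φ x) ∂μ := lintegral_lintegral_swap hm.aemeasurable
    _ ≤ ∫⁻ y, iteratedNorm n p (fun x => G x y) ∂μ := lintegral_mono fun y =>
        (holder h (hG.comp measurable_prodMk_right) hΦ).trans
          ((mul_le_mul_right hΦ1 _).trans (mul_one _).le)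

/-- Duality reduces the triangle inequality to additivity of the integral and Hölder; `sum_le` and
`add_le` follow the same pattern. The constant is one, unlike in `exists_iteratedNorm_le`. -/
theorem tsum_le (h : ConjExps p q) {ι : Type*} [Countable ι] {G : ι → (Fin n → ℝ) → ℝ≥0∞}
    (hG : ∀ i, Measurable (G i)) :
    iteratedNorm n p (fun x => ∑' i, G i x) ≤ ∑' i, iteratedNorm n p (G i) := by
  refine le_of_forall_lintegral_le h (Measurable.tsum hG) fun Φ hΦ hΦ1 => ?_
  simp_rw [← ENNReal.tsum_mul_right]
  rw [lintegral_tsum (f := fun i x => G i x * Φ x) fun i => ((hG i).mul hΦ).aemeasurable]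
  exact ENNReal.tsum_le_tsum fun i => (holder h (hG i) hΦ).trans
    ((mul_le_mul_right hΦ1 _).trans (mul_one _).le)

theorem sum_le (h : ConjExps p q) {ι : Type*} (s : Finset ι) {G : ι → (Fin n → ℝ) → ℝ≥0∞}
    (hG : ∀ i, Measurable (G i)) :
    iteratedNorm n p (fun x => ∑ i ∈ s, G i x) ≤ ∑ i ∈ s, iteratedNorm n p (G i) := by
  refine le_of_forall_lintegral_le h (Finset.measurable_fun_sum s fun i _ => hG i)
    fun Φ hΦ hΦ1 => ?_
  simp_rw [Finset.sum_mul]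
  rw [lintegral_finsetSum s (f := fun i x => G i x * Φ x) fun i _ => (hG i).mul hΦ]
  exact Finset.sum_le_sum fun i _ => (holder h (hG i) hΦ).trans
    ((mul_le_mul_right hΦ1 _).trans (mul_one _).le)

theorem add_le (h : ConjExps p q) {F G : (Fin n → ℝ) → ℝ≥0∞} (hF : Measurable F)
    (hG : Measurable G) :
    iteratedNorm n p (fun x => F x + G x) ≤ iteratedNorm n p F + iteratedNorm n p G := by
  refine le_of_forall_lintegral_le h (hF.add hG) fun Φ hΦ hΦ1 => ?_
  have h1 : ∀ x, (F x + G x) * Φ x = F x * Φ x + G x * Φ x := fun x => add_mul _ _ _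
  refine (lintegral_congr h1).trans_le ?_
  rw [lintegral_add_left (f := fun x => F x * Φ x) (hF.mul hΦ)]
  exact add_le_add
    ((holder h hF hΦ).trans ((mul_le_mul_right hΦ1 _).trans (mul_one _).le))
    ((holder h hG hΦ).trans ((mul_le_mul_right hΦ1 _).trans (mul_one _).le))

/-- Fatou's lemma for mixed norms. -/
theorem liminf_le (h : ConjExps p q) {F : ℕ → (Fin n → ℝ) → ℝ≥0∞} (hF : ∀ k, Measurable (F k)) :
    iteratedNorm n p (fun x => Filter.liminf (fun k => F k x) Filter.atTop) ≤
      Filter.liminf (fun k => iteratedNorm n p (F k)) Filter.atTop := by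
  refine le_of_forall_lintegral_le h (Measurable.liminf hF) fun Φ hΦ hΦ1 => ?_
  calc ∫⁻ x, Filter.liminf (fun k => F k x) Filter.atTop * Φ x
      ≤ ∫⁻ x, Filter.liminf (fun k => F k x * Φ x) Filter.atTop := lintegral_mono fun x => by
        simp_rw [Filter.liminf_eq_iSup_iInf_of_nat, ENNReal.iSup_mul]
        exact iSup_mono fun i => le_iInf fun j => le_iInf fun hj =>
          mul_le_mul_left (iInf₂_le j hj) _
    _ ≤ Filter.liminf (fun k => ∫⁻ x, F k x * Φ x) Filter.atTop :=
        lintegral_liminf_le fun k => (hF k).mul hΦ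
    _ ≤ _ := Filter.liminf_le_liminf (Filter.Eventually.of_forall fun k =>
        (holder h (hF k) hΦ).trans ((mul_le_mul_right hΦ1 _).trans (mul_one _).le))

theorem le_liminf_of_tendsto (h : ConjExps p q) {F : ℕ → (Fin n → ℝ) → ℝ≥0∞}
    {G : (Fin n → ℝ) → ℝ≥0∞} (hF : ∀ k, Measurable (F k))
    (hG : ∀ᵐ x, Filter.Tendsto (fun k => F k x) Filter.atTop (nhds (G x))) :
    iteratedNorm n p G ≤ Filter.liminf (fun k => iteratedNorm n p (F k)) Filter.atTop := by
  refine le_trans (le_of_eq (congr_ae ?_)) (liminf_le h hF)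
  filter_upwards [hG] with x hx
  exact hx.liminf_eq.symm

theorem ae_eq_zero : ∀ {n : ℕ} {p q : Fin n → ℝ≥0∞} (_ : ConjExps p q)
    {F : (Fin n → ℝ) → ℝ≥0∞} (_ : Measurable F) (_ : iteratedNorm n p F = 0),
    ∀ᵐ x, F x = 0
  | 0, p, q, _, F, _, h0 => Filter.Eventually.of_forall fun x => by
      rw [Subsingleton.elim x Fin.elim0]
      exact h0
  | n + 1, p, q, h, F, hF, h0 => by
      have h1 := ae_eq_zero h.tail (measurable_eLpNorm_slice (p 0) hF) h0
      refine ae_of_ae_slice (hF (measurableSet_singleton 0)) ?_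
      filter_upwards [h1] with y hy
      exact (eLpNorm_eq_zero_iff
        (hF.comp (measurable_finCons_left y)).aestronglyMeasurable (h.ne_zero 0)).1 hy

theorem ae_lt_top : ∀ {n : ℕ} {p q : Fin n → ℝ≥0∞} (_ : ConjExps p q)
    {F : (Fin n → ℝ) → ℝ≥0∞} (_ : Measurable F) (_ : iteratedNorm n p F < ∞),
    ∀ᵐ x, F x < ∞
  | 0, p, q, _, F, _, h0 => Filter.Eventually.of_forall fun x => by
      rw [Subsingleton.elim x Fin.elim0]
      exact h0
  | n + 1, p, q, h, F, hF, h0 => by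
      have h1 := ae_lt_top h.tail (measurable_eLpNorm_slice (p 0) hF) h0
      refine ae_of_ae_slice (measurableSet_lt hF measurable_const) ?_
      filter_upwards [h1] with y hy
      rw [eLpNorm_ennreal_eq (h.ne_zero 0) (h.ne_top 0)] at hy
      have hp := (h 0).pos
      have h2 : ∫⁻ t : ℝ, F (Fin.cons t y) ^ (p 0).toReal ≠ ∞ := by
        intro h3
        rw [h3, ENNReal.top_rpow_of_pos (by positivity)] at hy
        exact hy.ne rfl
      filter_upwards [MeasureTheory.ae_lt_top
        ((hF.comp (measurable_finCons_left y)).pow_const _) h2] with t ht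
      exact (ENNReal.rpow_lt_top_iff_of_pos hp).1 ht

/-- Dominated convergence (to zero) for mixed norms. -/
theorem tendsto_zero : ∀ {n : ℕ} {p q : Fin n → ℝ≥0∞} (_ : ConjExps p q)
    {F : ℕ → (Fin n → ℝ) → ℝ≥0∞} {G : (Fin n → ℝ) → ℝ≥0∞} (_ : ∀ k, Measurable (F k))
    (_ : Measurable G) (_ : iteratedNorm n p G < ∞)
    (_ : ∀ k, ∀ᵐ x, F k x ≤ G x)
    (_ : ∀ᵐ x, Filter.Tendsto (fun k => F k x) Filter.atTop (nhds 0)),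
    Filter.Tendsto (fun k => iteratedNorm n p (F k)) Filter.atTop (nhds 0)
  | 0, p, q, _, F, G, _, _, _, _, h => by
      obtain ⟨x, hx⟩ := h.exists
      rw [Subsingleton.elim x Fin.elim0] at hx
      exact hx
  | n + 1, p, q, h, F, G, hF, hG, hfin, hle, hlim => by
      refine tendsto_zero h.tail (fun k => measurable_eLpNorm_slice (p 0) (hF k))
        (measurable_eLpNorm_slice (p 0) hG) hfin (fun k => ?_) ?_
      · filter_upwards [ae_slice (hle k)] with y hy
        exact eLpNorm_mono_enorm_ae (by simpa using hy)
      -- Almost every slice of `G` has finite norm, so ordinary dominated convergence applies on it.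
      -- The slice norms of `G` then serve as the majorant in the remaining variables.
      · filter_upwards [ae_slice hlim, ae_slice (ae_all_iff.2 hle),
          ae_lt_top h.tail (measurable_eLpNorm_slice (p 0) hG) hfin] with y hy hley hfiny
        have hp := (h 0).pos
        simp_rw [eLpNorm_ennreal_eq (h.ne_zero 0) (h.ne_top 0)] at hfiny ⊢
        have h2 : ∫⁻ t : ℝ, G (Fin.cons t y) ^ (p 0).toReal ≠ ∞ := by
          intro h3
          rw [h3, ENNReal.top_rpow_of_pos (by positivity)] at hfiny
          exact hfiny.ne rfl
        have h3 := tendsto_lintegral_of_dominated_convergence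
          (F := fun k t => F k (Fin.cons t y) ^ (p 0).toReal) (f := fun _ => 0)
          (fun t : ℝ => G (Fin.cons t y) ^ (p 0).toReal)
          (fun k => ((hF k).comp (measurable_finCons_left y)).pow_const _)
          (fun k => by
            filter_upwards [hley] with t ht
            exact ENNReal.rpow_le_rpow (ht k) hp.le) h2
          (by
            filter_upwards [hy] with t ht
            have := (ENNReal.continuous_rpow_const (y := (p 0).toReal)).continuousAt.tendsto.comp ht
            simpa [Function.comp_def, hp] using this)
        have h4 := (ENNReal.continuous_rpow_const
          (y := 1 / (p 0).toReal)).continuousAt.tendsto.comp h3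
        simpa [Function.comp_def, hp] using h4

theorem comp_sub_right : ∀ {n : ℕ} (p : Fin n → ℝ≥0∞) {F : (Fin n → ℝ) → ℝ≥0∞}
    (_ : Measurable F) (h : Fin n → ℝ),
    iteratedNorm n p (fun x => F (x - h)) = iteratedNorm n p F
  | 0, p, F, _, h => congrArg F (Subsingleton.elim _ _)
  | n + 1, p, F, hF, h => by
      rw [succ, succ, ← comp_sub_right (fun j => p j.succ) (measurable_eLpNorm_slice (p 0) hF)
        (fun j => h j.succ)]
      refine congrArg _ (funext fun y => ?_)
      have h1 : ∀ t : ℝ, (Fin.cons t y - h : Fin (n + 1) → ℝ)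
          = Fin.cons (t - h 0) (y - fun j => h j.succ) := fun t => by
        ext j
        refine Fin.cases ?_ (fun i => ?_) j <;> simp
      simp_rw [h1]
      have h2 := eLpNorm_comp_measurePreserving (p := p 0)
        (hF.comp (measurable_finCons_left (y - fun j => h j.succ))).aestronglyMeasurable
        (measurePreserving_sub_right volume (h 0))
      exact h2

/-- Bounded functions with bounded support have finite mixed norms. -/
theorem lt_top_of_bounded : ∀ {n : ℕ} (p : Fin n → ℝ≥0∞) {F : (Fin n → ℝ) → ℝ≥0∞} {M : ℝ≥0}
    {R : ℝ} (_ : ∀ x, F x ≤ M) (_ : ∀ x, F x ≠ 0 → ∀ i, |x i| ≤ R), iteratedNorm n p F < ∞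
  | 0, p, F, M, R, hM, _ => (hM _).trans_lt ENNReal.coe_lt_top
  | n + 1, p, F, M, R, hM, hR => by
      have hb : ∀ y, eLpNorm (fun t : ℝ => F (Fin.cons t y)) (p 0) volume ≤
          M * volume (Set.Icc (-R) R) ^ (1 / (p 0).toReal) := fun y => by
        refine (eLpNorm_mono_enorm (g := (Set.Icc (-R) R).indicator
          (fun _ => (M : ℝ≥0∞))) fun t => ?_).trans ((eLpNorm_indicator_const_le _ _).trans ?_)
        · by_cases h0 : F (Fin.cons t y) = 0
          · simp [h0]
          · have := hR _ h0 0
            rw [Fin.cons_zero, abs_le, ← Set.mem_Icc] at this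
            simpa [this] using hM _
        · simp
      have hfin : (M : ℝ≥0∞) * volume (Set.Icc (-R) R) ^ (1 / (p 0).toReal) ≠ ∞ :=
        (ENNReal.mul_lt_top (by simp) (ENNReal.rpow_lt_top_of_nonneg (by positivity)
          (by simp))).ne
      rw [succ]
      refine lt_top_of_bounded _ (M := ((M : ℝ≥0∞) *
        volume (Set.Icc (-R) R) ^ (1 / (p 0).toReal)).toNNReal) (R := R)
        (fun y => by rw [ENNReal.coe_toNNReal hfin]; exact hb y) fun y hy i => ?_
      by_contra hi
      refine hy ?_
      have : ∀ t : ℝ, F (Fin.cons t y) = 0 := fun t => by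
        by_contra h0
        exact hi (by simpa using hR _ h0 i.succ)
      simp [this]

end iteratedNorm

/-! ### Splitting the coordinates into two blocks. -/

/-- Concatenation of a first block of `j` coordinates with a second block of `m` coordinates. -/
def glue {α : Type*} {j m : ℕ} (u : Fin j → α) (v : Fin m → α) : Fin (m + j) → α :=
  fun i => if h : (i : ℕ) < j then u ⟨i, h⟩ else v ⟨i - j, by omega⟩

section glue

variable {α : Type*} {j m : ℕ}

theorem glue_zero (u : Fin 0 → α) (v : Fin m → α) : glue u v = v := by
  ext i
  simp [glue]

/-- The index type is `Fin (m + j)` rather than `Fin (j + m)` so that `m + (j + 1)` is `m + j + 1`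
by definition and induction on `j` can peel off coordinate `0`. -/
theorem glue_succ (u : Fin (j + 1) → α) (v : Fin m → α) :
    glue (j := j + 1) (m := m) u v =
      (Fin.cons (u 0) (glue (fun i => u i.succ) v : Fin (m + j) → α) : Fin (m + j + 1) → α) := by
  ext i
  refine Fin.cases (n := m + j) ?_ (fun i => ?_) i
  · simp [glue]
  · simp only [glue, Fin.cons_succ, Fin.val_succ, Nat.add_lt_add_iff_right]
    split_ifs with h
    · rfl
    · congr 2
      omega

theorem exists_glue (x : Fin (m + j) → α) :
    ∃ (u : Fin j → α) (v : Fin m → α), x = glue u v := by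
  refine ⟨fun i => x ⟨i, by omega⟩, fun i => x ⟨i + j, by omega⟩, ?_⟩
  ext i
  simp only [glue]
  split_ifs with h
  · rfl
  · congr 1
    ext
    simp
    omega

theorem glue_eq_right (u : Fin j → α) (v : Fin m → α) (i : Fin m) :
    glue u v ⟨i + j, by omega⟩ = v i := by
  simp [glue]

theorem glue_eq_left (u : Fin j → α) (v : Fin m → α) (i : Fin j) :
    glue u v ⟨i, by omega⟩ = u i := by
  simp [glue]

theorem glue_sub (u u' : Fin j → ℝ) (v v' : Fin m → ℝ) :
    glue u v - glue u' v' = glue (u - u') (v - v') := by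
  ext i
  simp only [glue, Pi.sub_apply]
  split_ifs <;> rfl

theorem norm_le_norm_glue (u : Fin j → ℝ) (v : Fin m → ℝ) : ‖v‖ ≤ ‖glue u v‖ := by
  refine (pi_norm_le_iff_of_nonneg (norm_nonneg _)).2 fun i => ?_
  rw [← glue_eq_right u v i]
  exact norm_le_pi_norm _ _

theorem norm_le_norm_glue_left (u : Fin j → ℝ) (v : Fin m → ℝ) : ‖u‖ ≤ ‖glue u v‖ := by
  refine (pi_norm_le_iff_of_nonneg (norm_nonneg _)).2 fun i => ?_
  rw [← glue_eq_left u v i]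
  exact norm_le_pi_norm _ _

theorem norm_glue_zero_le (v : Fin m → ℝ) : ‖glue (0 : Fin j → ℝ) v‖ ≤ ‖v‖ := by
  refine (pi_norm_le_iff_of_nonneg (norm_nonneg _)).2 fun i => ?_
  simp only [glue]
  split_ifs
  · simp
  · exact norm_le_pi_norm _ _

theorem ConjExps.glue {a a' : Fin j → ℝ≥0∞} {b b' : Fin m → ℝ≥0∞} (ha : ConjExps a a')
    (hb : ConjExps b b') : ConjExps (glue a b) (glue a' b') := fun i => by
  simp only [_root_.glue]
  split_ifs
  · exact ha _
  · exact hb _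

theorem measurable_glue :
    Measurable (fun z : (Fin j → ℝ) × (Fin m → ℝ) => glue z.1 z.2) := by
  refine measurable_pi_iff.2 fun i => ?_
  simp only [glue]
  split_ifs
  · exact (measurable_pi_apply _).comp measurable_fst
  · exact (measurable_pi_apply _).comp measurable_snd

theorem measurePreserving_glue (m : ℕ) : ∀ j : ℕ,
    MeasurePreserving (fun z : (Fin j → ℝ) × (Fin m → ℝ) => glue z.1 z.2)
  | 0 => by
      have h : (fun z : (Fin 0 → ℝ) × (Fin m → ℝ) => glue z.1 z.2) = Prod.snd :=
        funext fun z => glue_zero _ _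
      rw [h]
      have h1 : IsProbabilityMeasure (volume : Measure (Fin 0 → ℝ)) := by
        rw [Measure.volume_pi_eq_dirac]
        infer_instance
      exact measurePreserving_snd
  | j + 1 => by
      have h1 : MeasurePreserving (fun z : Fin (j + 1) → ℝ => (z 0, fun i : Fin j => z i.succ)) := by
        have := volume_preserving_piFinSuccAbove (fun _ : Fin (j + 1) => ℝ) 0
        have h0 : (fun z : Fin (j + 1) → ℝ => (z 0, fun i : Fin j => z i.succ))
            = MeasurableEquiv.piFinSuccAbove (fun _ => ℝ) 0 := by
          ext z <;> simp [MeasurableEquiv.piFinSuccAbove, Fin.insertNthEquiv, Fin.tail]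
        rw [h0]
        exact this
      have h2 := (measurePreserving_prodAssoc (volume : Measure ℝ)
        (volume : Measure (Fin j → ℝ)) (volume : Measure (Fin m → ℝ))).comp
        (h1.prod (MeasurePreserving.id (volume : Measure (Fin m → ℝ))))
      have h3 := (measurePreserving_finCons (m + j)).comp
        (((MeasurePreserving.id (volume : Measure ℝ)).prod (measurePreserving_glue m j)).comp h2)
      have h4 : (fun z : (Fin (j + 1) → ℝ) × (Fin m → ℝ) => glue z.1 z.2) = fun z =>
          (Fin.cons (z.1 0) (glue (fun i => z.1 i.succ) z.2 : Fin (m + j) → ℝ) :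
            Fin (m + j + 1) → ℝ) := funext fun z => glue_succ _ _
      rw [h4]
      exact h3

theorem ae_glue {P : (Fin (m + j) → ℝ) → Prop} (h : ∀ᵐ x, P x) :
    ∀ᵐ v : Fin m → ℝ, ∀ᵐ u : Fin j → ℝ, P (glue u v) := by
  have h2 := (measurePreserving_glue m j).quasiMeasurePreserving.ae h
  have h3 := (Measure.measurePreserving_swap (μ := (volume : Measure (Fin m → ℝ)))
    (ν := (volume : Measure (Fin j → ℝ)))).quasiMeasurePreserving.ae h2
  exact Measure.ae_ae_of_ae_prod h3

theorem lintegral_glue {F : (Fin (m + j) → ℝ) → ℝ≥0∞} (hF : Measurable F) :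
    ∫⁻ x, F x = ∫⁻ v : Fin m → ℝ, ∫⁻ u : Fin j → ℝ, F (glue u v) := by
  rw [← (measurePreserving_glue m j).lintegral_comp hF]
  exact lintegral_prod_symm' _ (hF.comp measurable_glue)

theorem measurable_glue_left (v : Fin m → ℝ) : Measurable fun u : Fin j → ℝ => glue u v :=
  measurable_glue.comp (measurable_id.prodMk measurable_const)

end glue

namespace iteratedNorm

/-- This is the vector-valued point of view: a mixed norm is the `b`-norm in `v` of the `a`-norm in
`u`. -/
theorem glue_eq {m : ℕ} (b : Fin m → ℝ≥0∞) : ∀ {j : ℕ} (a : Fin j → ℝ≥0∞)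
    (F : (Fin (m + j) → ℝ) → ℝ≥0∞),
    iteratedNorm (m + j) (glue a b) F =
      iteratedNorm m b fun v => iteratedNorm j a fun u => F (glue u v)
  | 0, a, F => by
      simp only [glue_zero]
      rfl
  | j + 1, a, F => by
      rw [glue_succ]
      refine (glue_eq b (fun i => a i.succ) _).trans ?_
      simp only [succ, glue_succ, Fin.cons_zero, Fin.cons_succ]

theorem measurable_glue {m : ℕ} : ∀ {j : ℕ} (a : Fin j → ℝ≥0∞)
    {F : (Fin (m + j) → ℝ) → ℝ≥0∞} (_ : Measurable F),
    Measurable fun v : Fin m → ℝ => iteratedNorm j a fun u => F (glue u v)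
  | 0, a, F, hF => by
      simp only [glue_zero]
      exact hF
  | j + 1, a, F, hF => by
      have := measurable_glue (m := m) (fun i => a i.succ)
        (measurable_eLpNorm_slice (a 0) (n := m + j) hF)
      simpa only [succ, glue_succ, Fin.cons_zero, Fin.cons_succ] using this

/-- With equal exponents the inner power `1 / p` cancels the next power `p`, and Tonelli leaves the
ordinary `L^p` norm. -/
theorem const_eq {p : ℝ≥0∞} (h0 : p ≠ 0) (htop : p ≠ ∞) : ∀ {m : ℕ}
    {F : (Fin m → ℝ) → ℝ≥0∞} (_ : Measurable F),
    iteratedNorm m (fun _ => p) F = (∫⁻ x, F x ^ p.toReal) ^ (1 / p.toReal)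
  | 0, F, hF => by
      have h1 : (volume : Measure (Fin 0 → ℝ)) = Measure.dirac Fin.elim0 :=
        Measure.volume_pi_eq_dirac _
      rw [h1, lintegral_dirac, ← ENNReal.rpow_mul, mul_one_div_cancel
        (ENNReal.toReal_pos h0 htop).ne', ENNReal.rpow_one]
      rfl
  | m + 1, F, hF => by
      rw [succ, const_eq h0 htop (measurable_eLpNorm_slice p hF),
        lintegral_finCons (hF.pow_const _)]
      congr 2
      ext y
      rw [eLpNorm_ennreal_eq h0 htop, ← ENNReal.rpow_mul, one_div_mul_cancel
        (ENNReal.toReal_pos h0 htop).ne', ENNReal.rpow_one]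

end iteratedNorm

/-! ### Test functions and the class of operators. -/

/-- Bounded measurable functions with compact support. -/
structure IsTest {n : ℕ} (f : (Fin n → ℝ) → ℂ) : Prop where
  measurable : Measurable f
  bounded : ∃ M : ℝ≥0, ∀ x, ‖f x‖ ≤ M
  compact : HasCompactSupport f

/-- An operator on `L²(ℝⁿ)` with a kernel that is regular off the diagonal, in sup-norm
coordinates. -/
structure IsCZ {n : ℕ} (K : (Fin n → ℝ) → (Fin n → ℝ) → ℂ)
    (T : Lp ℂ 2 (volume : Measure (Fin n → ℝ)) →L[ℂ] Lp ℂ 2 (volume : Measure (Fin n → ℝ))) :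
    Prop where
  -- The separation constant `A` is left free because passing from the Euclidean norm to the sup
  -- norm enlarges the original `2`.
  regularity : ∃ ε > (0 : ℝ), ∃ C > (0 : ℝ), ∃ A ≥ (2 : ℝ), ∀ x y z, x ≠ y →
    A * ‖x - z‖ ≤ ‖x - y‖ →
    ‖K x y - K z y‖ + ‖K y x - K y z‖ ≤ C * ‖x - z‖ ^ ε / ‖x - y‖ ^ ((n : ℝ) + ε)
  representation : ∀ (f : (Fin n → ℝ) → ℂ) (g : Lp ℂ 2 (volume : Measure (Fin n → ℝ))),
    MemLp f ∞ volume → HasCompactSupport f → g =ᵐ[volume] f →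
      ∀ᵐ x, x ∉ tsupport f → T g x = ∫ y, K x y * f y

namespace IsTest

variable {n : ℕ} {f g : (Fin n → ℝ) → ℂ}

theorem memLp_top (hf : IsTest f) : MemLp f ∞ := by
  obtain ⟨M, hM⟩ := hf.bounded
  exact memLp_top_of_bound hf.measurable.aestronglyMeasurable M (Filter.Eventually.of_forall hM)

theorem memLp (hf : IsTest f) (p : ℝ≥0∞) : MemLp f p :=
  hf.memLp_top.mono_exponent_of_measure_support_ne_top
    (fun _ hx => image_eq_zero_of_notMem_tsupport hx) hf.compact.isCompact.measure_ne_top le_top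

theorem integrable (hf : IsTest f) : Integrable f := memLp_one_iff_integrable.1 (hf.memLp 1)

theorem of_le (hf : IsTest f) (hg : Measurable g) (c : ℝ≥0) (h : ∀ x, ‖g x‖ ≤ c * ‖f x‖) :
    IsTest g := by
  obtain ⟨M, hM⟩ := hf.bounded
  refine ⟨hg, ⟨c * M, fun x => (h x).trans (by push_cast; gcongr; exact hM x)⟩, ?_⟩
  refine hf.compact.mono fun x hx => ?_
  rw [Function.mem_support] at hx ⊢
  intro h0
  have := h x
  rw [h0, norm_zero, mul_zero] at this
  exact hx (norm_le_zero_iff.1 this)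

theorem of_bound (hg : Measurable g) (M : ℝ≥0) (hM : ∀ x, ‖g x‖ ≤ M) (R : ℝ)
    (hR : ∀ x, g x ≠ 0 → ‖x‖ ≤ R) : IsTest g :=
  ⟨hg, ⟨M, hM⟩, HasCompactSupport.of_support_subset_isCompact (isCompact_closedBall 0 R)
    fun x hx => by simpa using hR x hx⟩

theorem exists_radius (hf : IsTest f) : ∃ R : ℝ, 0 < R ∧ ∀ x, f x ≠ 0 → ‖x‖ ≤ R := by
  obtain ⟨R, hR0, hR⟩ := hf.compact.isCompact.isBounded.exists_pos_norm_le
  exact ⟨R, hR0, fun x hx => hR x (subset_tsupport f hx)⟩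

theorem add (hf : IsTest f) (hg : IsTest g) : IsTest (fun x => f x + g x) := by
  obtain ⟨M, hM⟩ := hf.bounded
  obtain ⟨N, hN⟩ := hg.bounded
  exact ⟨hf.measurable.add hg.measurable, ⟨M + N, fun x => (norm_add_le _ _).trans
    (by push_cast; exact add_le_add (hM x) (hN x))⟩, hf.compact.add hg.compact⟩

theorem sub (hf : IsTest f) (hg : IsTest g) : IsTest (fun x => f x - g x) := by
  have := hf.add (hg.of_le hg.measurable.neg 1 fun x => by simp)
  simpa [sub_eq_add_neg] using this

theorem zero : IsTest (fun _ : Fin n → ℝ => (0 : ℂ)) :=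
  of_bound measurable_const 0 (fun _ => by simp) 0 fun _ h => (h rfl).elim

theorem sum {ι : Type*} (s : Finset ι) {F : ι → (Fin n → ℝ) → ℂ} (hF : ∀ i ∈ s, IsTest (F i)) :
    IsTest (fun x => ∑ i ∈ s, F i x) := by
  classical
  induction s using Finset.induction_on with
  | empty => simpa using zero
  | insert i s hi ih =>
    simp_rw [Finset.sum_insert hi]
    exact (hF i (Finset.mem_insert_self i s)).add
      (ih fun k hk => hF k (Finset.mem_insert_of_mem hk))

/-- The class in `L²` of a test function. -/
def toLp (hf : IsTest f) : Lp ℂ 2 (volume : Measure (Fin n → ℝ)) := (hf.memLp 2).toLp f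

theorem coeFn_toLp (hf : IsTest f) : hf.toLp =ᵐ[volume] f := (hf.memLp 2).coeFn_toLp

theorem iteratedNorm_lt_top (hf : IsTest f) (p : Fin n → ℝ≥0∞) :
    iteratedNorm n p (fun x => ‖f x‖ₑ) < ∞ := by
  obtain ⟨M, hM⟩ := hf.bounded
  obtain ⟨R, -, hR⟩ := hf.exists_radius
  refine iteratedNorm.lt_top_of_bounded p (M := M) (R := R) (fun x => ?_) fun x hx i => ?_
  · exact enorm_le_coe.2 (hM x)
  · exact (norm_le_pi_norm x i).trans (hR x (by simpa using hx))

end IsTest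

/-- Boundedness on test functions of all operators with regular kernel, in a mixed norm. -/
def CZBounded {n : ℕ} (p : Fin n → ℝ≥0∞) : Prop :=
  -- Quantifying over all operators, with `C` depending on the operator, is what lets duality pass
  -- to the adjoint.
  ∀ K T, IsCZ (n := n) K T → ∃ C : ℝ≥0, ∀ (f : (Fin n → ℝ) → ℂ) (hf : IsTest f),
    iteratedNorm n p (fun x => ‖T hf.toLp x‖ₑ) ≤ C * iteratedNorm n p (fun x => ‖f x‖ₑ)

/-! ### Kernels off the diagonal and adjoints. -/

namespace IsCZ

variable {n : ℕ} {K : (Fin n → ℝ) → (Fin n → ℝ) → ℂ}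
  {T : Lp ℂ 2 (volume : Measure (Fin n → ℝ)) →L[ℂ] Lp ℂ 2 (volume : Measure (Fin n → ℝ))}

/-- Moving one variable at a time, each increment is controlled by regularity, uniformly near the
given point. Continuity supplies the measurability and the local boundedness of `K` needed for
Fubini. -/
theorem continuousOn (h : IsCZ K T) :
    ContinuousOn (fun z : (Fin n → ℝ) × (Fin n → ℝ) => K z.1 z.2) {z | z.1 ≠ z.2} := by
  obtain ⟨ε, hε, C, hC, A, hA, hreg⟩ := h.regularity
  rintro ⟨x₀, y₀⟩ hne
  have hne : x₀ ≠ y₀ := hne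
  refine ContinuousAt.continuousWithinAt ?_
  have hd : 0 < ‖x₀ - y₀‖ := norm_pos_iff.2 (sub_ne_zero.2 hne)
  refine tendsto_iff_norm_sub_tendsto_zero.2 ?_
  have hlim : Filter.Tendsto (fun z : (Fin n → ℝ) × (Fin n → ℝ) =>
      C * ‖x₀ - z.1‖ ^ ε / ‖x₀ - z.2‖ ^ ((n : ℝ) + ε)
        + C * ‖y₀ - z.2‖ ^ ε / ‖y₀ - x₀‖ ^ ((n : ℝ) + ε)) (nhds (x₀, y₀)) (nhds 0) := by
    have hc : ContinuousAt (fun z : (Fin n → ℝ) × (Fin n → ℝ) =>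
      C * ‖x₀ - z.1‖ ^ ε / ‖x₀ - z.2‖ ^ ((n : ℝ) + ε)
        + C * ‖y₀ - z.2‖ ^ ε / ‖y₀ - x₀‖ ^ ((n : ℝ) + ε)) (x₀, y₀) := by
      refine ContinuousAt.add (ContinuousAt.div ?_ ?_ ?_) (ContinuousAt.div_const ?_ _)
      · exact continuousAt_const.mul
          (ContinuousAt.rpow_const (by fun_prop) (Or.inr hε.le))
      · exact ContinuousAt.rpow_const (by fun_prop) (Or.inl hd.ne')
      · exact (Real.rpow_pos_of_pos hd _).ne'
      · exact continuousAt_const.mul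
          (ContinuousAt.rpow_const (by fun_prop) (Or.inr hε.le))
    have := hc.tendsto
    simpa [hε.ne'] using this
  refine squeeze_zero' (Filter.Eventually.of_forall fun _ => norm_nonneg _) ?_ hlim
  have h1 : ∀ᶠ z : (Fin n → ℝ) × (Fin n → ℝ) in nhds (x₀, y₀),
      A * ‖x₀ - z.1‖ < ‖x₀ - z.2‖ :=
    ContinuousAt.eventually_lt (by fun_prop) (by fun_prop) (by simpa using sub_ne_zero.2 hne)
  have h2 : ∀ᶠ z : (Fin n → ℝ) × (Fin n → ℝ) in nhds (x₀, y₀),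
      A * ‖y₀ - z.2‖ < ‖y₀ - x₀‖ :=
    ContinuousAt.eventually_lt (by fun_prop) (by fun_prop) (by simpa using sub_ne_zero.2 hne.symm)
  filter_upwards [h1, h2] with z hz1 hz2
  have hz : x₀ ≠ z.2 := by
    rintro h0
    rw [← h0, sub_self, norm_zero] at hz1
    have := mul_nonneg (zero_le_two.trans hA) (norm_nonneg (x₀ - z.1))
    linarith
  have e1 := hreg x₀ z.2 z.1 hz hz1.le
  have e2 := hreg y₀ x₀ z.2 hne.symm hz2.le
  calc ‖K z.1 z.2 - K x₀ y₀‖ = ‖(K z.1 z.2 - K x₀ z.2) + (K x₀ z.2 - K x₀ y₀)‖ := by congr 1; ring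
    _ ≤ ‖K z.1 z.2 - K x₀ z.2‖ + ‖K x₀ z.2 - K x₀ y₀‖ := norm_add_le _ _
    _ = ‖K x₀ z.2 - K z.1 z.2‖ + ‖K x₀ y₀ - K x₀ z.2‖ := by
        rw [norm_sub_rev (K z.1 z.2), norm_sub_rev (K x₀ z.2) (K x₀ y₀)]
    _ ≤ _ := add_le_add (le_trans (le_add_of_nonneg_right (norm_nonneg _)) e1)
        (le_trans (le_add_of_nonneg_left (norm_nonneg _)) e2)

/-- The kernel is integrable against a test function away from its support. -/
theorem integrableOn_prod (h : IsCZ K T) {f : (Fin n → ℝ) → ℂ} (hfm : MemLp f ∞)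
    (hf : HasCompactSupport f) {S : Set (Fin n → ℝ)} (hS : IsCompact S)
    (hd : Disjoint S (tsupport f)) :
    Integrable (fun z : (Fin n → ℝ) × (Fin n → ℝ) => K z.2 z.1 * f z.2)
      ((volume.restrict S).prod volume) := by
  have hc : ContinuousOn (fun z : (Fin n → ℝ) × (Fin n → ℝ) => K z.2 z.1)
      (S ×ˢ tsupport f) := by
    refine h.continuousOn.comp (f := Prod.swap) continuous_swap.continuousOn ?_
    rintro ⟨x, y⟩ ⟨hx, hy⟩ hxy
    have hxy : y = x := hxy
    exact (Set.disjoint_left.1 hd hx) (hxy ▸ hy)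
  have hcomp : IsCompact (S ×ˢ tsupport f) := hS.prod hf.isCompact
  obtain ⟨M, hM⟩ := hcomp.exists_bound_of_continuousOn hc
  have hmp := hcomp.measurableSet
  have hf1 : Integrable f := memLp_one_iff_integrable.1
    (hfm.mono_exponent_of_measure_support_ne_top
    (fun _ hx => image_eq_zero_of_notMem_tsupport hx) hf.isCompact.measure_ne_top le_top)
  have : IsFiniteMeasure ((volume : Measure (Fin n → ℝ)).restrict S) :=
    ⟨by simpa using hS.measure_lt_top⟩
  have hf2 : Integrable (fun z : (Fin n → ℝ) × (Fin n → ℝ) => f z.2)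
      ((volume.restrict S).prod volume) := hf1.comp_snd _
  have hK : AEStronglyMeasurable ((S ×ˢ tsupport f).indicator
      (fun z : (Fin n → ℝ) × (Fin n → ℝ) => K z.2 z.1)) ((volume.restrict S).prod volume) :=
    (aestronglyMeasurable_indicator_iff hmp).2 (hc.aestronglyMeasurable hmp)
  have hi := hf2.bdd_mul (c := max M 0) hK (Filter.Eventually.of_forall fun z => by
    by_cases hz : z ∈ S ×ˢ tsupport f
    · rw [Set.indicator_of_mem hz]
      exact (hM z hz).trans (le_max_left _ _)
    · rw [Set.indicator_of_notMem hz, norm_zero]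
      exact le_max_right _ _)
  refine hi.congr ?_
  have hmem : ∀ᵐ z : (Fin n → ℝ) × (Fin n → ℝ) ∂((volume.restrict S).prod volume), z.1 ∈ S :=
    Measure.quasiMeasurePreserving_fst.ae (ae_restrict_mem hS.measurableSet)
  filter_upwards [hmem] with z hz
  by_cases h2 : z.2 ∈ tsupport f
  · rw [Set.indicator_of_mem (Set.mk_mem_prod hz h2)]
  · rw [image_eq_zero_of_notMem_tsupport h2, mul_zero, mul_zero]

/-- The kernel is integrable in the second variable against a test function away from its
support. -/
theorem integrable_mul (h : IsCZ K T) {f : (Fin n → ℝ) → ℂ} (hf : IsTest f) {x : Fin n → ℝ}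
    (hx : x ∉ tsupport f) : Integrable (fun y => K x y * f y) := by
  have hc : ContinuousOn (fun y => K x y) (tsupport f) := by
    refine h.continuousOn.comp (f := fun y => (x, y)) (by fun_prop) ?_
    rintro y hy hxy
    have hxy : x = y := hxy
    exact hx (hxy ▸ hy)
  obtain ⟨M, hM⟩ := hf.compact.isCompact.exists_bound_of_continuousOn hc
  have hmp := hf.compact.isCompact.measurableSet
  have hK : AEStronglyMeasurable ((tsupport f).indicator (fun y => K x y)) volume :=
    (aestronglyMeasurable_indicator_iff hmp).2 (hc.aestronglyMeasurable hmp)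
  have hi := hf.integrable.bdd_mul (c := max M 0) hK (Filter.Eventually.of_forall fun z => by
    by_cases hz : z ∈ tsupport f
    · rw [Set.indicator_of_mem hz]
      exact (hM z hz).trans (le_max_left _ _)
    · rw [Set.indicator_of_notMem hz, norm_zero]
      exact le_max_right _ _)
  refine hi.congr (Filter.Eventually.of_forall fun y => ?_)
  by_cases h2 : y ∈ tsupport f
  · simp [h2]
  · simp [image_eq_zero_of_notMem_tsupport h2]

end IsCZ

namespace IsCZ

variable {n : ℕ} {K : (Fin n → ℝ) → (Fin n → ℝ) → ℂ}
  {T : Lp ℂ 2 (volume : Measure (Fin n → ℝ)) →L[ℂ] Lp ℂ 2 (volume : Measure (Fin n → ℝ))}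

/-- The left side is the pairing of the indicator of `S` with `T* g`, hence of `T 1_S` with `g`. On
the support of `f`, which misses `S`, the kernel represents `T 1_S`, and Fubini finishes. -/
theorem setIntegral_adjoint_eq (h : IsCZ K T) {f : (Fin n → ℝ) → ℂ}
    {g : Lp ℂ 2 (volume : Measure (Fin n → ℝ))} (hfm : MemLp f ∞) (hf : HasCompactSupport f)
    (hg : g =ᵐ[volume] f) {S : Set (Fin n → ℝ)} (hS : IsCompact S) (hd : Disjoint S (tsupport f)) :
    ∫ x in S, (ContinuousLinearMap.adjoint T g) x =
      ∫ x in S, ∫ y, (starRingEnd ℂ) (K y x) * f y := by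
  have hSm := hS.measurableSet
  have hSt := hS.measure_ne_top (μ := (volume : Measure (Fin n → ℝ)))
  set φ := indicatorConstLp 2 hSm hSt (1 : ℂ) with hφ
  have h1 : ∫ x in S, (ContinuousLinearMap.adjoint T g) x = inner ℂ (T φ) g := by
    rw [← ContinuousLinearMap.adjoint_inner_right, hφ,
      L2.inner_indicatorConstLp_eq_setIntegral_inner]
    simp
  have hsupp : tsupport (S.indicator (fun _ => (1 : ℂ))) ⊆ S :=
    closure_minimal (Set.support_indicator_subset) hS.isClosed
  have h2 := h.representation (S.indicator fun _ => (1 : ℂ)) φ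
    ((memLp_top_const (1 : ℂ)).indicator hSm)
    (HasCompactSupport.of_support_subset_isCompact hS Set.support_indicator_subset)
    indicatorConstLp_coeFn
  have h3 : inner ℂ (T φ) g = ∫ y, ∫ x in S, (starRingEnd ℂ) (K y x) * f y := by
    rw [L2.inner_def]
    refine integral_congr_ae ?_
    filter_upwards [h2, hg] with y hy hgy
    by_cases hyf : y ∈ tsupport f
    · have hyS : y ∉ S := fun hyS => Set.disjoint_left.1 hd hyS hyf
      have h4 : T φ y = ∫ x in S, K y x := by
        rw [hy fun hh => hyS (hsupp hh), ← integral_indicator hSm]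
        refine integral_congr_ae (Filter.Eventually.of_forall fun x => ?_)
        by_cases hx : x ∈ S <;> simp [hx]
      rw [h4, hgy, integral_mul_const, integral_conj]
      simp [mul_comm]
    · rw [hgy, image_eq_zero_of_notMem_tsupport hyf]
      simp
  rw [h1, h3]
  have hint : Integrable (fun z : (Fin n → ℝ) × (Fin n → ℝ) => (starRingEnd ℂ) (K z.2 z.1) * f z.2)
      ((volume.restrict S).prod volume) := by
    -- Integrability is known for `K` without conjugation, so it is applied to the conjugate of `f`
    -- and the product is conjugated afterwards.
    have hf' : MemLp (fun x => (starRingEnd ℂ) (f x)) ∞ := hfm.star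
    have hs : tsupport (fun x => (starRingEnd ℂ) (f x)) = tsupport f := by
      simp [tsupport, Function.support]
    have := h.integrableOn_prod hf' (by rwa [HasCompactSupport, hs]) hS (by rwa [hs])
    have h5 := (Complex.conjCLE.toContinuousLinearMap.integrable_comp this)
    refine h5.congr (Filter.Eventually.of_forall fun z => ?_)
    simp
  exact (integral_integral_swap hint).symm

/-- The adjoint of an operator with regular kernel has a regular kernel. -/
theorem adjoint (h : IsCZ K T) :
    IsCZ (fun x y => (starRingEnd ℂ) (K y x)) (ContinuousLinearMap.adjoint T) where
  regularity := by
    obtain ⟨ε, hε, C, hC, A, hA, hreg⟩ := h.regularity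
    refine ⟨ε, hε, C, hC, A, hA, fun x y z hxy hz => ?_⟩
    simp only [← map_sub, RCLike.norm_conj]
    rw [add_comm]
    exact hreg x y z hxy hz
  representation := by
    intro f g hfm hf hg
    set u : (Fin n → ℝ) → ℂ := fun x => ∫ y, (starRingEnd ℂ) (K y x) * f y with hu
    set w := ContinuousLinearMap.adjoint T g with hw
    -- A point off the support has a compact neighbourhood `S` that misses it. Equal integrals over
    -- the compact subsets of `S` force a.e. equality on `S`, and being null is a local property.
    refine measure_null_of_locally_null _ fun x hx => ?_
    simp only [Set.mem_compl_iff, Set.mem_ofPred_eq, Classical.not_imp] at hx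
    obtain ⟨S, hS, hxS, hSf⟩ := exists_compact_subset
      (isClosed_tsupport f).isOpen_compl (Set.mem_compl hx.1)
    have hd : Disjoint S (tsupport f) := Set.subset_compl_iff_disjoint_right.1 hSf
    have hwS : IntegrableOn w S volume :=
      (Lp.memLp w).locallyIntegrable one_le_two |>.integrableOn_isCompact hS
    have huS : IntegrableOn u S volume := by
      have hf' : MemLp (fun x => (starRingEnd ℂ) (f x)) ∞ := hfm.star
      have hs : tsupport (fun x => (starRingEnd ℂ) (f x)) = tsupport f := by
        simp [tsupport, Function.support]
      have := h.integrableOn_prod hf' (by rwa [HasCompactSupport, hs]) hS (by rwa [hs])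
      have h5 := (Complex.conjCLE.toContinuousLinearMap.integrable_comp this)
      refine h5.integral_prod_left.congr (Filter.Eventually.of_forall fun z => ?_)
      simp [hu]
    have h0 : (fun x => w x - u x) =ᵐ[volume.restrict S] 0 := by
      refine ae_eq_zero_of_forall_setIntegral_isCompact_eq_zero (hwS.sub huS) fun s hs => ?_
      rw [Measure.restrict_restrict hs.measurableSet]
      have hss : s ∩ S ⊆ S := Set.inter_subset_right
      rw [integral_sub (hwS.mono_set hss) (huS.mono_set hss), sub_eq_zero]
      exact h.setIntegral_adjoint_eq hfm hf hg (hs.inter hS) (hd.mono_left hss)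
    refine ⟨_, Filter.inter_mem self_mem_nhdsWithin
      (nhdsWithin_le_nhds (mem_interior_iff_mem_nhds.1 hxS)), ?_⟩
    have h6 := ae_iff.1 ((ae_restrict_iff' hS.measurableSet).1 h0)
    refine measure_mono_null ?_ h6
    rintro z ⟨hz1, hz2⟩
    simp only [Set.mem_compl_iff, Set.mem_ofPred_eq, Classical.not_imp] at hz1 ⊢
    exact ⟨hz2, fun h7 => hz1.2 (sub_eq_zero.1 h7)⟩

end IsCZ

/-! ### Duality for the mixed norm estimate. -/

/-- Truncation of a function, in values and in support. -/
def truncBall {n : ℕ} (N : ℕ) (Φ : (Fin n → ℝ) → ℝ≥0∞) (x : Fin n → ℝ) : ℝ≥0∞ :=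
  min (Φ x) ((Metric.closedBall 0 (N : ℝ)).indicator (fun _ => (N : ℝ≥0∞)) x)

section truncBall

variable {n : ℕ}

theorem measurable_truncBall (N : ℕ) {Φ : (Fin n → ℝ) → ℝ≥0∞} (hΦ : Measurable Φ) :
    Measurable (truncBall N Φ) :=
  hΦ.min (measurable_const.indicator Metric.isClosed_closedBall.measurableSet)

theorem monotone_truncBall (Φ : (Fin n → ℝ) → ℝ≥0∞) : Monotone (fun N => truncBall N Φ) :=
  fun N M h x => by
  refine min_le_min le_rfl ?_
  refine (Set.indicator_le_indicator_of_subset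
    (Metric.closedBall_subset_closedBall (Nat.cast_le.2 h)) (fun _ => zero_le) x).trans ?_
  exact Set.indicator_le_indicator (by exact_mod_cast h)

theorem iSup_truncBall (Φ : (Fin n → ℝ) → ℝ≥0∞) (x) : ⨆ N, truncBall N Φ x = Φ x := by
  refine le_antisymm (iSup_le fun N => min_le_left _ _) ?_
  refine le_of_forall_lt fun a ha => ?_
  obtain ⟨N, hN⟩ := ENNReal.exists_nat_gt ha.ne_top
  obtain ⟨M, hM⟩ := exists_nat_ge ‖x‖
  refine lt_of_lt_of_le ?_ (le_iSup _ (max N M))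
  refine lt_min ha ?_
  have : x ∈ Metric.closedBall (0 : Fin n → ℝ) ((max N M : ℕ) : ℝ) := by
    rw [mem_closedBall_zero_iff]
    exact hM.trans (by exact_mod_cast le_max_right _ _)
  rw [Set.indicator_of_mem this]
  exact hN.trans_le (by exact_mod_cast le_max_left _ _)

theorem truncBall_le_nat (N : ℕ) (Φ : (Fin n → ℝ) → ℝ≥0∞) (x) : truncBall N Φ x ≤ N :=
  (min_le_right _ _).trans (Set.indicator_le_self' (fun _ _ => zero_le) x)

theorem norm_le_of_truncBall_ne_zero {N : ℕ} {Φ : (Fin n → ℝ) → ℝ≥0∞} {x}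
    (h : truncBall N Φ x ≠ 0) : ‖x‖ ≤ N := by
  by_contra hx
  refine h ?_
  rw [← mem_closedBall_zero_iff] at hx
  simp [truncBall, hx]

end truncBall

/-- Boundedness in a mixed norm passes to the conjugate exponents. -/
theorem CZBounded.dual {n : ℕ} {p q : Fin n → ℝ≥0∞} (hpq : ConjExps p q) (hp : CZBounded p) :
    CZBounded q := by
  intro K T hT
  obtain ⟨C, hC⟩ := hp _ _ hT.adjoint
  refine ⟨C, fun f hf => ?_⟩
  set h := T hf.toLp with hh
  have hhm : Measurable h := (Lp.stronglyMeasurable h).measurable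
  refine iteratedNorm.le_of_forall_lintegral_le hpq.symm hhm.enorm fun Φ hΦ hΦ1 => ?_
  have hsup : ∀ x, ‖h x‖ₑ * Φ x = ⨆ N, ‖h x‖ₑ * truncBall N Φ x := fun x => by
    rw [← ENNReal.mul_iSup, iSup_truncBall]
  simp_rw [hsup]
  rw [lintegral_iSup (f := fun N x => ‖h x‖ₑ * truncBall N Φ x)
    (fun N => hhm.enorm.mul (measurable_truncBall N hΦ))
    (fun i j hij x => mul_le_mul_right (monotone_truncBall Φ hij x) _)]
  refine iSup_le fun N => ?_
  -- The phase of `h` makes the pairing of `φ` with `h` equal to the integral of `‖h‖` times the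
  -- truncated `Φ`, and truncation makes `φ` a test function. Where `h` vanishes, so does `φ`.
  set φ : (Fin n → ℝ) → ℂ := fun x => ((truncBall N Φ x).toReal : ℂ) * (h x / ‖h x‖) with hφ
  have hfin : ∀ x, truncBall N Φ x ≠ ∞ := fun x =>
    ne_top_of_le_ne_top (by simp) (truncBall_le_nat N Φ x)
  have hφm : Measurable φ :=
    (Complex.measurable_ofReal.comp (measurable_truncBall N hΦ).ennreal_toReal).mul
      (hhm.div (Complex.measurable_ofReal.comp hhm.norm))
  have hφle : ∀ x, ‖φ x‖ ≤ (truncBall N Φ x).toReal := fun x => by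
    rw [hφ, norm_mul, norm_div]
    simp only [Complex.norm_real, norm_norm, Real.norm_of_nonneg ENNReal.toReal_nonneg]
    exact mul_le_of_le_one_right ENNReal.toReal_nonneg (div_self_le_one _)
  have hφt : IsTest φ := by
    refine IsTest.of_bound hφm N (fun x => (hφle x).trans ?_) N fun x hx => ?_
    · have := ENNReal.toReal_mono (by simp) (truncBall_le_nat N Φ x)
      simpa using this
    · refine norm_le_of_truncBall_ne_zero (Φ := Φ) fun h0 => hx ?_
      simp [hφ, h0]
  have hφN : iteratedNorm n p (fun x => ‖φ x‖ₑ) ≤ 1 := by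
    refine (iteratedNorm.mono fun x => ?_).trans hΦ1
    refine le_trans ?_ (min_le_left _ _ : truncBall N Φ x ≤ Φ x)
    change ‖φ x‖ₑ ≤ truncBall N Φ x
    rw [← ENNReal.ofReal_toReal (hfin x), ← ofReal_norm]
    exact ENNReal.ofReal_le_ofReal (hφle x)
  have hpt : ∀ᵐ x, inner ℂ (hφt.toLp x) (h x)
      = ((‖h x‖ * (truncBall N Φ x).toReal : ℝ) : ℂ) := by
    filter_upwards [hφt.coeFn_toLp] with x hx
    rw [hx, hφ, RCLike.inner_apply]
    simp only [map_mul, map_div₀, Complex.conj_ofReal]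
    rcases eq_or_ne (h x) 0 with h0 | h0
    · simp [h0]
    · have h0' : (‖h x‖ : ℂ) ≠ 0 := by simpa using h0
      have h3 := Complex.mul_conj' (h x)
      push_cast
      field_simp
      linear_combination ((truncBall N Φ x).toReal : ℂ) * h3
  have h1 : ∫⁻ x, ‖h x‖ₑ * truncBall N Φ x
      = ENNReal.ofReal (∫ x, ‖h x‖ * (truncBall N Φ x).toReal) := by
    have hint : Integrable fun x => ((‖h x‖ * (truncBall N Φ x).toReal : ℝ) : ℂ) :=
      (L2.integrable_inner (𝕜 := ℂ) hφt.toLp h).congr hpt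
    rw [ofReal_integral_eq_lintegral_ofReal (by simpa using hint.re)
      (Filter.Eventually.of_forall fun x => mul_nonneg (norm_nonneg _) ENNReal.toReal_nonneg)]
    refine lintegral_congr fun x => ?_
    rw [ENNReal.ofReal_mul (norm_nonneg _), ofReal_norm, ENNReal.ofReal_toReal (hfin x)]
  have h2 : inner ℂ hφt.toLp h = ((∫ x, ‖h x‖ * (truncBall N Φ x).toReal : ℝ) : ℂ) := by
    rw [L2.inner_def, integral_congr_ae hpt]
    exact integral_ofReal
  rw [h1]
  calc ENNReal.ofReal (∫ x, ‖h x‖ * (truncBall N Φ x).toReal)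
      ≤ ‖inner ℂ hφt.toLp h‖ₑ := by
        rw [h2, ← ofReal_norm, Complex.norm_real]
        exact ENNReal.ofReal_le_ofReal (Real.le_norm_self _)
    -- The operator moves to `φ`, where the hypothesis on `p` controls the adjoint; Hölder separates
    -- off `f`.
    _ = ‖inner ℂ (ContinuousLinearMap.adjoint T hφt.toLp) hf.toLp‖ₑ := by
        rw [ContinuousLinearMap.adjoint_inner_left]
    _ ≤ ∫⁻ x, ‖(ContinuousLinearMap.adjoint T hφt.toLp) x‖ₑ * ‖f x‖ₑ := by
        rw [L2.inner_def]
        refine (enorm_integral_le_lintegral_enorm _).trans (lintegral_mono_ae ?_)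
        filter_upwards [hf.coeFn_toLp] with x hx
        rw [hx, RCLike.inner_apply, enorm_mul, mul_comm]
        simp
    _ ≤ _ := iteratedNorm.holder hpq (Lp.stronglyMeasurable _).measurable.enorm
        hf.measurable.enorm
    _ ≤ _ := by
        refine mul_le_mul_left ((hC φ hφt).trans ((mul_le_mul_right hφN _).trans (mul_one _).le)) _

/-! ### Approximation by step functions and test functions. -/

/-- Functions that are constant on the cubes of the grid of mesh `δ`. -/
def IsStep {n : ℕ} (δ : ℝ) (f : (Fin n → ℝ) → ℂ) : Prop :=
  ∀ x y, (∀ i, ⌊x i / δ⌋ = ⌊y i / δ⌋) → f x = f y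

section density

variable {n : ℕ}

/-- The centre of the cube of the grid of mesh `δ` with index `z`. -/
def gridCentre (δ : ℝ) (z : Fin n → ℤ) : Fin n → ℝ := fun i => (z i + 1 / 2) * δ

theorem mem_closedBall_gridCentre {δ : ℝ} (hδ : 0 < δ) (x : Fin n → ℝ) :
    x ∈ Metric.closedBall (gridCentre δ fun i => ⌊x i / δ⌋) (δ / 2) := by
  rw [mem_closedBall_iff_norm, pi_norm_le_iff_of_nonneg (by positivity)]
  intro i
  have h1 := Int.floor_le (x i / δ)
  have h2 := Int.lt_floor_add_one (x i / δ)
  rw [le_div_iff₀ hδ] at h1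
  rw [div_lt_iff₀ hδ] at h2
  simp only [gridCentre, Pi.sub_apply, Real.norm_eq_abs, abs_le]
  constructor <;> nlinarith

/-- The approximants are averages over grid cubes, which are sup-norm balls, so Lebesgue
differentiation gives a.e. convergence. For step functions the stopping-time argument ends at the
finest mesh, and no differentiation theorem for vector-valued functions is required. -/
theorem IsTest.exists_step_approx {f : (Fin n → ℝ) → ℂ} (hf : IsTest f) :
    ∃ g : ℕ → (Fin n → ℝ) → ℂ, (∀ k, IsTest (g k)) ∧ (∀ k, ∃ δ > 0, IsStep δ (g k)) ∧
      (∃ (M : ℝ≥0) (R : ℝ), (∀ k x, ‖g k x‖ ≤ M) ∧ ∀ k x, g k x ≠ 0 → ‖x‖ ≤ R) ∧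
      ∀ᵐ x, Filter.Tendsto (fun k => g k x) Filter.atTop (nhds (f x)) := by
  obtain ⟨M, hM⟩ := hf.bounded
  obtain ⟨R, -, hR⟩ := hf.exists_radius
  set δ : ℕ → ℝ := fun k => 1 / ((k : ℝ) + 1) with hδ
  have hδ0 : ∀ k, 0 < δ k := fun k => Nat.one_div_pos_of_nat
  have hδ1 : ∀ k, δ k ≤ 1 := fun k => by
    rw [hδ]
    exact div_le_one_of_le₀ (by simp) (by positivity)
  set idx : ℕ → (Fin n → ℝ) → (Fin n → ℤ) := fun k x i => ⌊x i / δ k⌋ with hidx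
  set g : ℕ → (Fin n → ℝ) → ℂ := fun k x =>
    ⨍ y in Metric.closedBall (gridCentre (δ k) (idx k x)) (δ k / 2), f y with hg
  have hgm : ∀ k, Measurable (g k) := fun k => by
    have h1 : Measurable (idx k) := measurable_pi_iff.2 fun i =>
      Int.measurable_floor.comp ((measurable_pi_apply i).div_const _)
    exact (measurable_of_countable fun z : Fin n → ℤ =>
      ⨍ y in Metric.closedBall (gridCentre (δ k) z) (δ k / 2), f y).comp h1
  have hgM : ∀ k x, ‖g k x‖ ≤ M := fun k x => by
    have hpos : 0 < volume (Metric.closedBall (gridCentre (δ k) (idx k x)) (δ k / 2)) :=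
      Metric.measure_closedBall_pos _ _ (half_pos (hδ0 k))
    have hfin : volume (Metric.closedBall (gridCentre (δ k) (idx k x)) (δ k / 2)) ≠ ∞ :=
      measure_closedBall_lt_top.ne
    have hr : 0 < volume.real (Metric.closedBall (gridCentre (δ k) (idx k x)) (δ k / 2)) :=
      ENNReal.toReal_pos hpos.ne' hfin
    simp only [hg]
    rw [setAverage_eq, norm_smul, norm_inv, Real.norm_of_nonneg hr.le]
    rw [inv_mul_le_iff₀ hr, mul_comm]
    exact norm_setIntegral_le_of_norm_le_const hfin.lt_top fun y _ => hM y
  have hgR : ∀ k x, g k x ≠ 0 → ‖x‖ ≤ R + 1 := fun k x hx => by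
    by_contra hcon
    refine hx ?_
    simp only [hg]
    rw [setAverage_eq, setIntegral_eq_zero_of_forall_eq_zero, smul_zero]
    intro y hy
    by_contra hy0
    have h1 := hR y hy0
    have h2 := mem_closedBall_gridCentre (hδ0 k) x
    have h3 : ‖x - y‖ ≤ δ k := by
      have := dist_triangle_right x y (gridCentre (δ k) (idx k x))
      rw [← dist_eq_norm]
      linarith [Metric.mem_closedBall.1 hy, Metric.mem_closedBall.1 h2]
    have h4 : ‖x‖ ≤ ‖x - y‖ + ‖y‖ := by simpa using norm_add_le (x - y) y
    linarith [hδ1 k]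
  refine ⟨g, fun k => IsTest.of_bound (hgm k) M (hgM k) (R + 1) (hgR k),
    fun k => ⟨δ k, hδ0 k, fun x y hxy => ?_⟩, ⟨M, R + 1, hgM, hgR⟩, ?_⟩
  · have : idx k x = idx k y := funext hxy
    simp only [hg, this]
  · filter_upwards [IsUnifLocDoublingMeasure.ae_tendsto_average volume
      hf.integrable.locallyIntegrable 1] with x hx
    -- The balls need not be centred at `x`; they only have to contain it, which is the dilation
    -- factor `1`.
    refine hx _ (fun k => δ k / 2) ?_ (Filter.Eventually.of_forall fun k => ?_)
    · refine tendsto_nhdsWithin_iff.2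
        ⟨?_, Filter.Eventually.of_forall fun k => half_pos (hδ0 k)⟩
      simpa [hδ] using (tendsto_one_div_add_atTop_nhds_zero_nat (𝕜 := ℝ)).div_const 2
    · rw [one_mul]
      exact mem_closedBall_gridCentre (hδ0 k) x

theorem ConjExps.two : ConjExps (fun _ : Fin n => 2) (fun _ => 2) := fun _ => by
  simpa using Real.HolderConjugate.two_two

theorem eLpNorm_two_eq {f : (Fin n → ℝ) → ℂ} (hf : Measurable f) :
    eLpNorm f 2 volume = iteratedNorm n (fun _ => 2) fun x => ‖f x‖ₑ := by
  rw [iteratedNorm.const_eq (by simp) (by simp) hf.enorm,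
    eLpNorm_eq_lintegral_rpow_enorm_toReal (by simp) (by simp)]

variable {p q : Fin n → ℝ≥0∞}

/-- A mixed norm estimate for an operator on `L²` passes to limits. -/
theorem iteratedNorm_le_of_tendsto (hpq : ConjExps p q)
    (T : Lp ℂ 2 (volume : Measure (Fin n → ℝ)) →L[ℂ] Lp ℂ 2 (volume : Measure (Fin n → ℝ)))
    {F : ℕ → Lp ℂ 2 (volume : Measure (Fin n → ℝ))} {f : Lp ℂ 2 (volume : Measure (Fin n → ℝ))}
    {C : ℝ≥0} (hF : Filter.Tendsto F Filter.atTop (nhds f))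
    (hFp : Filter.Tendsto (fun k => iteratedNorm n p fun x => ‖F k x - f x‖ₑ) Filter.atTop
      (nhds 0))
    (hC : ∀ k, iteratedNorm n p (fun x => ‖T (F k) x‖ₑ)
      ≤ C * iteratedNorm n p (fun x => ‖F k x‖ₑ)) :
    iteratedNorm n p (fun x => ‖T f x‖ₑ) ≤ C * iteratedNorm n p (fun x => ‖f x‖ₑ) := by
  have hmeas : ∀ g : Lp ℂ 2 (volume : Measure (Fin n → ℝ)), Measurable g := fun g =>
    (Lp.stronglyMeasurable g).measurable
  have h1 : Filter.Tendsto (fun k => T (F k)) Filter.atTop (nhds (T f)) :=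
    (T.continuous.tendsto f).comp hF
  -- Convergence in `L²` gives an a.e. convergent subsequence, which is enough for Fatou's lemma in
  -- the mixed norm.
  obtain ⟨ns, hns, hlim⟩ := (tendstoInMeasure_of_tendsto_Lp h1).exists_seq_tendsto_ae
  refine (iteratedNorm.le_liminf_of_tendsto hpq (F := fun k x => ‖T (F (ns k)) x‖ₑ)
    (fun k => (hmeas _).enorm) (by
      filter_upwards [hlim] with x hx
      exact (continuous_enorm.tendsto _).comp hx)).trans ?_
  have h2 : ∀ k, iteratedNorm n p (fun x => ‖T (F (ns k)) x‖ₑ) ≤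
      C * (iteratedNorm n p (fun x => ‖F (ns k) x - f x‖ₑ)
        + iteratedNorm n p (fun x => ‖f x‖ₑ)) := fun k => by
    refine (hC (ns k)).trans (mul_le_mul_right ?_ _)
    refine le_trans (iteratedNorm.mono fun x => ?_) (iteratedNorm.add_le hpq
      ((hmeas (F (ns k))).sub (hmeas f)).enorm (hmeas f).enorm)
    simpa using enorm_add_le (F (ns k) x - f x) (f x)
  refine (Filter.liminf_le_liminf (Filter.Eventually.of_forall h2)).trans ?_
  have h3 : Filter.Tendsto (fun k => C * (iteratedNorm n p (fun x => ‖F (ns k) x - f x‖ₑ)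
        + iteratedNorm n p (fun x => ‖f x‖ₑ))) Filter.atTop
      (nhds (C * (0 + iteratedNorm n p (fun x => ‖f x‖ₑ)))) :=
    ENNReal.Tendsto.const_mul ((hFp.comp hns.tendsto_atTop).add_const _)
      (Or.inr ENNReal.coe_ne_top)
  rw [h3.liminf_eq, zero_add]

theorem tendsto_Lp_two {F : ℕ → Lp ℂ 2 (volume : Measure (Fin n → ℝ))}
    {f : Lp ℂ 2 (volume : Measure (Fin n → ℝ))}
    (h : Filter.Tendsto (fun k => iteratedNorm n (fun _ => 2) fun x => ‖F k x - f x‖ₑ)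
      Filter.atTop (nhds 0)) : Filter.Tendsto F Filter.atTop (nhds f) := by
  rw [Lp.tendsto_Lp_iff_tendsto_eLpNorm']
  refine h.congr fun k => ?_
  exact (eLpNorm_two_eq ((Lp.stronglyMeasurable (F k)).measurable.sub
    (Lp.stronglyMeasurable f).measurable)).symm

/-- A mixed norm estimate on step functions extends to all test functions. -/
theorem iteratedNorm_le_of_step (hpq : ConjExps p q)
    (T : Lp ℂ 2 (volume : Measure (Fin n → ℝ)) →L[ℂ] Lp ℂ 2 (volume : Measure (Fin n → ℝ)))
    {C : ℝ≥0} (hC : ∀ (f : (Fin n → ℝ) → ℂ) (hf : IsTest f), (∃ δ > 0, IsStep δ f) →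
      iteratedNorm n p (fun x => ‖T hf.toLp x‖ₑ) ≤ C * iteratedNorm n p (fun x => ‖f x‖ₑ))
    {f : (Fin n → ℝ) → ℂ} (hf : IsTest f) :
    iteratedNorm n p (fun x => ‖T hf.toLp x‖ₑ) ≤ C * iteratedNorm n p (fun x => ‖f x‖ₑ) := by
  obtain ⟨g, hg, hstep, ⟨M, R, hM, hR⟩, hlim⟩ := hf.exists_step_approx
  obtain ⟨M', hM'⟩ := hf.bounded
  obtain ⟨R', -, hR'⟩ := hf.exists_radius
  -- A multiple of the indicator of a fixed ball dominates all differences, so convergence holds in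
  -- every mixed norm. It is used both for `p` and for `L²`.
  have hconv : ∀ {p q : Fin n → ℝ≥0∞}, ConjExps p q → Filter.Tendsto
      (fun k => iteratedNorm n p fun x => ‖(hg k).toLp x - hf.toLp x‖ₑ) Filter.atTop
      (nhds 0) := by
    intro p q hpq
    have hB : IsTest ((Metric.closedBall (0 : Fin n → ℝ) (max R R')).indicator
        fun _ => (((M + M' : ℝ≥0) : ℝ) : ℂ)) := by
      refine IsTest.of_bound (measurable_const.indicator
        Metric.isClosed_closedBall.measurableSet) (M + M') (fun x => ?_) (max R R') fun x hx => ?_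
      · refine (norm_indicator_le_norm_self _ _).trans ?_
        simp [-NNReal.coe_add]
      · simpa using Set.mem_of_indicator_ne_zero hx
    have h0 : ∀ k, iteratedNorm n p (fun x => ‖g k x - f x‖ₑ) =
        iteratedNorm n p fun x => ‖(hg k).toLp x - hf.toLp x‖ₑ := fun k =>
      iteratedNorm.congr_ae (by
        filter_upwards [(hg k).coeFn_toLp, hf.coeFn_toLp] with x h1 h2
        rw [h1, h2])
    simp_rw [← h0]
    refine iteratedNorm.tendsto_zero hpq
      (fun k => ((hg k).measurable.sub hf.measurable).enorm) hB.measurable.enorm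
      (hB.iteratedNorm_lt_top p) (fun k => Filter.Eventually.of_forall fun x => ?_) ?_
    · by_cases hx : x ∈ Metric.closedBall (0 : Fin n → ℝ) (max R R')
      · rw [Set.indicator_of_mem hx, enorm_le_iff_norm_le]
        refine (norm_sub_le _ _).trans ((add_le_add (hM k x) (hM' x)).trans ?_)
        rw [Complex.norm_real, Real.norm_of_nonneg (NNReal.coe_nonneg _), NNReal.coe_add]
      · rw [mem_closedBall_zero_iff] at hx
        have h1 : g k x = 0 := by
          by_contra h
          exact hx ((hR k x h).trans (le_max_left _ _))
        have h2 : f x = 0 := by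
          by_contra h
          exact hx ((hR' x h).trans (le_max_right _ _))
        simp [h1, h2]
    · filter_upwards [hlim] with x hx
      have := (continuous_enorm.tendsto _).comp (hx.sub_const (f x))
      simpa [Function.comp_def] using this
  have hN : iteratedNorm n p (fun x => ‖hf.toLp x‖ₑ) = iteratedNorm n p (fun x => ‖f x‖ₑ) :=
    iteratedNorm.congr_ae (hf.coeFn_toLp.mono fun x hx => by rw [hx])
  rw [← hN]
  refine iteratedNorm_le_of_tendsto hpq T (tendsto_Lp_two (hconv ConjExps.two)) (hconv hpq)
    fun k => ?_
  refine (hC (g k) (hg k) (hstep k)).trans_eq ?_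
  congr 1
  exact iteratedNorm.congr_ae ((hg k).coeFn_toLp.mono fun x hx => by rw [hx])

/-- Test functions are dense in the intersection of `L²` with a mixed Lebesgue space. -/
theorem exists_test_approx (hpq : ConjExps p q) {f : (Fin n → ℝ) → ℂ} (hf : Measurable f)
    (hfp : iteratedNorm n p (fun x => ‖f x‖ₑ) < ∞) :
    ∃ g : ℕ → (Fin n → ℝ) → ℂ, (∀ k, IsTest (g k)) ∧
      (∀ k x, ‖g k x - f x‖ₑ ≤ ‖f x‖ₑ) ∧
      (∀ x, Filter.Tendsto (fun k => ‖g k x - f x‖ₑ) Filter.atTop (nhds 0)) ∧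
      Filter.Tendsto (fun k => iteratedNorm n p fun x => ‖g k x - f x‖ₑ) Filter.atTop (nhds 0) := by
  set s : ℕ → Set (Fin n → ℝ) := fun k => {x | ‖f x‖ ≤ k ∧ ‖x‖ ≤ k} with hs
  have hsm : ∀ k, MeasurableSet (s k) := fun k =>
    (measurableSet_le hf.norm measurable_const).inter
      (measurableSet_le measurable_norm measurable_const)
  have hle : ∀ k x, ‖(s k).indicator f x - f x‖ₑ ≤ ‖f x‖ₑ := fun k x => by
    by_cases hx : x ∈ s k <;> simp [hx]
  have hlim : ∀ x, Filter.Tendsto (fun k => ‖(s k).indicator f x - f x‖ₑ) Filter.atTop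
      (nhds 0) := fun x => by
    obtain ⟨N, hN⟩ := exists_nat_ge (max ‖f x‖ ‖x‖)
    refine tendsto_const_nhds.congr' ?_
    filter_upwards [Filter.eventually_ge_atTop N] with k hk
    have hk' : (N : ℝ) ≤ k := by exact_mod_cast hk
    have : x ∈ s k := ⟨(le_max_left _ _).trans (hN.trans hk'), (le_max_right _ _).trans
      (hN.trans hk')⟩
    simp [this]
  refine ⟨fun k => (s k).indicator f, fun k => IsTest.of_bound (hf.indicator (hsm k)) k
    (fun x => ?_) k fun x hx => (Set.mem_of_indicator_ne_zero hx).2, hle, hlim, ?_⟩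
  · by_cases hx : x ∈ s k
    · simpa [hx] using hx.1
    · simp [hx]
  · exact iteratedNorm.tendsto_zero hpq (fun k => ((hf.indicator (hsm k)).sub hf).enorm) hf.enorm
      hfp (fun k => Filter.Eventually.of_forall (hle k)) (Filter.Eventually.of_forall hlim)

/-- A mixed norm estimate on test functions extends to the intersection with `L²`. -/
theorem iteratedNorm_le_of_test (hpq : ConjExps p q)
    (T : Lp ℂ 2 (volume : Measure (Fin n → ℝ)) →L[ℂ] Lp ℂ 2 (volume : Measure (Fin n → ℝ)))
    {C : ℝ≥0} (hC : ∀ (f : (Fin n → ℝ) → ℂ) (hf : IsTest f),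
      iteratedNorm n p (fun x => ‖T hf.toLp x‖ₑ) ≤ C * iteratedNorm n p (fun x => ‖f x‖ₑ))
    (f : Lp ℂ 2 (volume : Measure (Fin n → ℝ)))
    (hfp : iteratedNorm n p (fun x => ‖f x‖ₑ) < ∞) :
    iteratedNorm n p (fun x => ‖T f x‖ₑ) ≤ C * iteratedNorm n p (fun x => ‖f x‖ₑ) := by
  have hfm : Measurable f := (Lp.stronglyMeasurable f).measurable
  obtain ⟨g, hg, hle, hlim, hp⟩ := exists_test_approx hpq hfm hfp
  have h0 : ∀ (p : Fin n → ℝ≥0∞) k, iteratedNorm n p (fun x => ‖g k x - f x‖ₑ) =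
      iteratedNorm n p fun x => ‖(hg k).toLp x - f x‖ₑ := fun p k =>
    iteratedNorm.congr_ae ((hg k).coeFn_toLp.mono fun x h1 => by rw [h1])
  refine iteratedNorm_le_of_tendsto hpq T (F := fun k => (hg k).toLp) (tendsto_Lp_two ?_) ?_
    fun k => ?_
  · simp_rw [← h0]
    refine iteratedNorm.tendsto_zero ConjExps.two (fun k => ((hg k).measurable.sub hfm).enorm)
      hfm.enorm ?_ (fun k => Filter.Eventually.of_forall (hle k)) (Filter.Eventually.of_forall hlim)
    rw [← eLpNorm_two_eq hfm]
    exact (Lp.memLp f).eLpNorm_lt_top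
  · simp_rw [← h0]
    exact hp
  · refine (hC (g k) (hg k)).trans_eq ?_
    congr 1
    exact iteratedNorm.congr_ae ((hg k).coeFn_toLp.mono fun x hx => by rw [hx])

end density

/-! ### Projections onto the two blocks. -/

section blocks

variable {j m : ℕ}

/-- The first `j` coordinates. -/
def blockFst (x : Fin (m + j) → ℝ) : Fin j → ℝ := fun i => x ⟨i, by omega⟩

/-- The last `m` coordinates. -/
def blockSnd (x : Fin (m + j) → ℝ) : Fin m → ℝ := fun i => x ⟨i + j, by omega⟩

@[simp] theorem blockFst_glue (u : Fin j → ℝ) (v : Fin m → ℝ) : blockFst (glue u v) = u :=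
  funext fun i => glue_eq_left u v i

@[simp] theorem blockSnd_glue (u : Fin j → ℝ) (v : Fin m → ℝ) : blockSnd (glue u v) = v :=
  funext fun i => glue_eq_right u v i

theorem glue_block (x : Fin (m + j) → ℝ) : glue (blockFst x) (blockSnd x) = x := by
  obtain ⟨u, v, rfl⟩ := exists_glue x
  simp

theorem continuous_blockFst : Continuous (blockFst : (Fin (m + j) → ℝ) → Fin j → ℝ) :=
  continuous_pi fun _ => continuous_apply _

theorem continuous_blockSnd : Continuous (blockSnd : (Fin (m + j) → ℝ) → Fin m → ℝ) :=
  continuous_pi fun _ => continuous_apply _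

theorem continuous_glue_left (v : Fin m → ℝ) : Continuous fun u : Fin j → ℝ => glue u v := by
  refine continuous_pi fun i => ?_
  simp only [glue]
  split_ifs
  · exact continuous_apply _
  · exact continuous_const

theorem norm_le_of_block_le {x : Fin (m + j) → ℝ} {R : ℝ} (h1 : ‖blockFst x‖ ≤ R)
    (h2 : ‖blockSnd x‖ ≤ R) : ‖x‖ ≤ R := by
  have hR : 0 ≤ R := (norm_nonneg _).trans h1
  rw [← glue_block x]
  refine (pi_norm_le_iff_of_nonneg hR).2 fun i => ?_
  simp only [glue]
  split_ifs
  · exact (norm_le_pi_norm _ _).trans h1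
  · exact (norm_le_pi_norm _ _).trans h2

end blocks

/-! ### Dyadic cubes and the stopping-time selection. -/

section cubes

variable {m : ℕ}

/-- The cube with level `Q.1` and index `Q.2` in the dyadic grid with finest mesh `δ`. -/
def dyadicCube (δ : ℝ) (Q : ℕ × (Fin m → ℤ)) : Set (Fin m → ℝ) :=
  {v | ∀ i, ⌊v i / (δ * 2 ^ Q.1)⌋ = Q.2 i}

/-- The index of the cube of level `l` containing `v`. -/
def dyadicIndex (δ : ℝ) (l : ℕ) (v : Fin m → ℝ) : Fin m → ℤ := fun i => ⌊v i / (δ * 2 ^ l)⌋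

theorem mem_dyadicCube {δ : ℝ} {Q : ℕ × (Fin m → ℤ)} {v : Fin m → ℝ} :
    v ∈ dyadicCube δ Q ↔ dyadicIndex δ Q.1 v = Q.2 := funext_iff.symm

/-- Nesting of dyadic cubes, which grow with the level: `⌊t / (2 * s)⌋` depends only on `⌊t / s⌋`.
-/
theorem dyadicIndex_succ {δ : ℝ} {l : ℕ} {v w : Fin m → ℝ}
    (h : dyadicIndex δ l v = dyadicIndex δ l w) :
    dyadicIndex δ (l + 1) v = dyadicIndex δ (l + 1) w := by
  funext i
  have hi := congrFun h i
  simp only [dyadicIndex] at hi ⊢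
  have h2 : ∀ t : ℝ, t / (δ * 2 ^ (l + 1)) = t / (δ * 2 ^ l) / ((2 : ℕ) : ℝ) := fun t => by
    rw [pow_succ, ← mul_assoc, div_div]
    norm_num
  rw [h2, h2, Int.floor_div_natCast, Int.floor_div_natCast, hi]

theorem dyadicIndex_le {δ : ℝ} {l k : ℕ} (hlk : l ≤ k) {v w : Fin m → ℝ}
    (h : dyadicIndex δ l v = dyadicIndex δ l w) : dyadicIndex δ k v = dyadicIndex δ k w := by
  induction k, hlk using Nat.le_induction with
  | base => exact h
  | succ k _ ih => exact dyadicIndex_succ ih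

theorem dyadicCube_eq_pi {δ : ℝ} (hδ : 0 < δ) (Q : ℕ × (Fin m → ℤ)) :
    dyadicCube δ Q = Set.pi Set.univ fun i =>
      Set.Ico (Q.2 i * (δ * 2 ^ Q.1)) ((Q.2 i + 1) * (δ * 2 ^ Q.1)) := by
  ext v
  have hs : 0 < δ * 2 ^ Q.1 := by positivity
  simp only [dyadicCube, Set.mem_ofPred_eq, Set.mem_pi, Set.mem_univ, true_imp_iff, Set.mem_Ico,
    Int.floor_eq_iff, le_div_iff₀ hs, div_lt_iff₀ hs]

theorem measurableSet_dyadicCube {δ : ℝ} (hδ : 0 < δ) (Q : ℕ × (Fin m → ℤ)) :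
    MeasurableSet (dyadicCube δ Q) := by
  rw [dyadicCube_eq_pi hδ]
  exact MeasurableSet.univ_pi fun i => measurableSet_Ico

theorem volume_dyadicCube {δ : ℝ} (hδ : 0 < δ) (Q : ℕ × (Fin m → ℤ)) :
    volume (dyadicCube δ Q) = ENNReal.ofReal (δ * 2 ^ Q.1) ^ m := by
  rw [dyadicCube_eq_pi hδ, volume_pi_pi]
  simp only [Real.volume_Ico]
  have : ∀ i, (Q.2 i + 1 : ℝ) * (δ * 2 ^ Q.1) - Q.2 i * (δ * 2 ^ Q.1) = δ * 2 ^ Q.1 :=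
    fun i => by ring
  simp [this]

/-- The corner of a dyadic cube. -/
def dyadicCorner (δ : ℝ) (Q : ℕ × (Fin m → ℤ)) : Fin m → ℝ := fun i => Q.2 i * (δ * 2 ^ Q.1)

theorem norm_sub_dyadicCorner_le {δ : ℝ} (hδ : 0 < δ) {Q : ℕ × (Fin m → ℤ)} {v : Fin m → ℝ}
    (hv : v ∈ dyadicCube δ Q) : ‖v - dyadicCorner δ Q‖ ≤ δ * 2 ^ Q.1 := by
  rw [dyadicCube_eq_pi hδ] at hv
  refine (pi_norm_le_iff_of_nonneg (by positivity)).2 fun i => ?_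
  have := hv i (Set.mem_univ i)
  rw [Set.mem_Ico] at this
  simp only [Pi.sub_apply, dyadicCorner, Real.norm_eq_abs, abs_le]
  constructor <;> nlinarith [this.1, this.2, show 0 < δ * 2 ^ Q.1 by positivity]

/-- Calderón–Zygmund stopping cubes, for a function that is constant on the finest cubes. -/
theorem exists_stopping_cubes (hm : 0 < m) {δ : ℝ} (hδ : 0 < δ) {F : (Fin m → ℝ) → ℝ≥0∞}
    (hstep : ∀ v w, dyadicIndex δ 0 v = dyadicIndex δ 0 w → F v = F w)
    {R : ℝ} (hR : ∀ v, F v ≠ 0 → ‖v‖ ≤ R) (hint : ∫⁻ v, F v ≠ ∞) {t : ℝ≥0∞} (ht : t ≠ 0) :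
    ∃ 𝒬 : Finset (ℕ × (Fin m → ℤ)),
      (∀ Q ∈ 𝒬, ∀ Q' ∈ 𝒬, Q ≠ Q' → Disjoint (dyadicCube δ Q) (dyadicCube δ Q')) ∧
      (∀ v, (∀ Q ∈ 𝒬, v ∉ dyadicCube δ Q) → F v ≤ t) ∧
      ∀ Q ∈ 𝒬, t * volume (dyadicCube δ Q) ≤ ∫⁻ v in dyadicCube δ Q, F v ∧
        ∫⁻ v in dyadicCube δ Q, F v ≤ 2 ^ m * t * volume (dyadicCube δ Q) := by
  have hvol0 : ∀ Q : ℕ × (Fin m → ℤ), volume (dyadicCube δ Q) ≠ 0 := fun Q => by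
    rw [volume_dyadicCube hδ]
    exact pow_ne_zero _ (by rw [Ne, ENNReal.ofReal_eq_zero, not_le]; positivity)
  have hvolt : ∀ Q : ℕ × (Fin m → ℤ), volume (dyadicCube δ Q) ≠ ∞ := fun Q => by
    rw [volume_dyadicCube hδ]
    exact ENNReal.pow_ne_top ENNReal.ofReal_ne_top
  set big : ℕ → (Fin m → ℝ) → Prop := fun l v =>
    t * volume (dyadicCube δ (l, dyadicIndex δ l v)) <
      ∫⁻ w in dyadicCube δ (l, dyadicIndex δ l v), F w with hbig
  -- A cube is big when the average of `F` over it exceeds `t`. The stopping cubes are the maximal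
  -- big ones, hence pairwise disjoint.
  set sel : ℕ → (Fin m → ℝ) → Prop := fun l v => big l v ∧ ∀ k > l, ¬ big k v with hsel
  have hself : ∀ (l : ℕ) (v : Fin m → ℝ), v ∈ dyadicCube δ (l, dyadicIndex δ l v) := fun l v => mem_dyadicCube.2 rfl
  have hbigcongr : ∀ l v w, dyadicIndex δ l v = dyadicIndex δ l w → big l v → big l w :=
    fun l v w h hb => by
      simp only [hbig] at hb ⊢
      rwa [← h]
  have hselcongr : ∀ l v w, dyadicIndex δ l v = dyadicIndex δ l w → sel l v → sel l w :=
    fun l v w h hs => ⟨hbigcongr l v w h hs.1, fun k hk hb =>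
      hs.2 k hk (hbigcongr k w v (dyadicIndex_le hk.le h.symm) hb)⟩
  -- A cube with `t` times its volume above the total integral cannot be big; as `m > 0`, this
  -- covers all high levels.
  obtain ⟨L, hL⟩ : ∃ L : ℕ, ∀ l, L ≤ l → ∀ v, ¬ big l v := by
    have hlim : Filter.Tendsto (fun l : ℕ => t * ENNReal.ofReal (δ * 2 ^ l) ^ m)
        Filter.atTop (nhds ∞) := by
      have h1 : Filter.Tendsto (fun l : ℕ => δ * (2 : ℝ) ^ l) Filter.atTop Filter.atTop :=
        (tendsto_pow_atTop_atTop_of_one_lt one_lt_two).const_mul_atTop hδ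
      have h2 := ENNReal.tendsto_ofReal_nhds_top.2 h1
      have h3 := ((ENNReal.continuous_pow m).tendsto ∞).comp h2
      rw [ENNReal.top_pow hm.ne'] at h3
      have h4 := ENNReal.Tendsto.const_mul (a := t) h3 (Or.inl ENNReal.top_ne_zero)
      rwa [ENNReal.mul_top ht] at h4
    obtain ⟨L, hL⟩ := Filter.eventually_atTop.1 (hlim.eventually (lt_mem_nhds hint.lt_top))
    refine ⟨L, fun l hl v hb => ?_⟩
    have h1 := hL l hl
    simp only [hbig, volume_dyadicCube hδ] at hb
    exact absurd (hb.trans_le (setLIntegral_le_lintegral _ _)) h1.not_gt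
  set S : Set (ℕ × (Fin m → ℤ)) := {Q | ∃ v, dyadicIndex δ Q.1 v = Q.2 ∧ sel Q.1 v} with hS
  have hfinite : S.Finite := by
    -- A selected cube has level below `L` and meets the bounded support of `F`, which leaves
    -- finitely many.
    have hsub : S ⊆ ⋃ l ∈ Finset.range L, (fun z => (l, z)) ''
        Set.Icc (fun _ => ⌊-R / (δ * 2 ^ l)⌋) (fun _ => ⌊R / (δ * 2 ^ l)⌋) := by
      rintro ⟨l, z⟩ ⟨v, hv, hs⟩
      simp only at hv hs
      have hl : l < L := by
        by_contra h
        exact hL l (not_lt.1 h) v hs.1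
      obtain ⟨w, hw, hw0⟩ : ∃ w ∈ dyadicCube δ (l, dyadicIndex δ l v), F w ≠ 0 := by
        by_contra! hcon
        have h0 : ∫⁻ w in dyadicCube δ (l, dyadicIndex δ l v), F w = 0 := by
          rw [setLIntegral_congr_fun (measurableSet_dyadicCube hδ _) hcon]
          simp
        have := hs.1
        simp only [hbig, h0] at this
        exact not_lt_zero this
      refine Set.mem_biUnion (Finset.mem_coe.2 (Finset.mem_range.2 hl)) ⟨z, ?_, rfl⟩
      have hs : 0 < δ * 2 ^ l := by positivity
      have hz : ∀ i, ⌊w i / (δ * 2 ^ l)⌋ = z i := fun i => by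
        rw [← hv]
        exact hw i
      have hwR : ∀ i, |w i| ≤ R := fun i => (norm_le_pi_norm w i).trans (hR w hw0)
      refine ⟨fun i => ?_, fun i => ?_⟩
      · rw [← hz]
        exact Int.floor_le_floor (div_le_div_of_nonneg_right (abs_le.1 (hwR i)).1 hs.le)
      · rw [← hz]
        exact Int.floor_le_floor (div_le_div_of_nonneg_right (abs_le.1 (hwR i)).2 hs.le)
    refine Set.Finite.subset ?_ hsub
    exact Set.Finite.biUnion (Finset.finite_toSet _) fun l _ => (Set.finite_Icc _ _).image _
  have hmem : ∀ {Q}, Q ∈ hfinite.toFinset → ∀ v ∈ dyadicCube δ Q, sel Q.1 v := by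
    intro Q hQ v hv
    obtain ⟨w, hw, hs⟩ := hfinite.mem_toFinset.1 hQ
    exact hselcongr Q.1 w v (hw.trans (mem_dyadicCube.1 hv).symm) hs
  refine ⟨hfinite.toFinset, fun Q hQ Q' hQ' hne => ?_, fun v hv => ?_, fun Q hQ => ?_⟩
  · refine Set.disjoint_left.2 fun v hv hv' => hne ?_
    have h1 := hmem hQ v hv
    have h2 := hmem hQ' v hv'
    have h3 : Q.1 = Q'.1 := by
      rcases lt_trichotomy Q.1 Q'.1 with h | h | h
      · exact absurd h2.1 (h1.2 _ h)
      · exact h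
      · exact absurd h1.1 (h2.2 _ h)
    refine Prod.ext h3 ?_
    rw [← mem_dyadicCube.1 hv, ← mem_dyadicCube.1 hv', h3]
  · by_contra hcon
    -- Since `F` is constant on the finest cube of `v`, the inequality `F v > t` makes that cube
    -- big; some big cube containing it is then selected.
    have hb0 : big 0 v := by
      simp only [hbig]
      have : ∫⁻ w in dyadicCube δ (0, dyadicIndex δ 0 v), F w
          = F v * volume (dyadicCube δ (0, dyadicIndex δ 0 v)) := by
        rw [setLIntegral_congr_fun (g := fun _ => F v) (measurableSet_dyadicCube hδ _)
          fun w hw => hstep w v (mem_dyadicCube.1 hw), setLIntegral_const]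
      rw [this]
      exact ENNReal.mul_lt_mul_left (hvol0 _) (hvolt _) (not_le.1 hcon)
    have hne : ∃ l, sel l v := by
      classical
      set l := Nat.findGreatest (fun l => big l v) L with hl
      have h1 : big l v := Nat.findGreatest_spec (P := fun l => big l v) (Nat.zero_le L) hb0
      refine ⟨l, h1, fun k hk hb => ?_⟩
      by_cases hkL : k ≤ L
      · exact Nat.findGreatest_is_greatest hk hkL hb
      · exact hL k (not_le.1 hkL).le v hb
    obtain ⟨l, hl⟩ := hne
    exact hv (l, dyadicIndex δ l v) (hfinite.mem_toFinset.2 ⟨v, rfl, hl⟩) (hself l v)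
  · obtain ⟨v, hv, hs⟩ := hfinite.mem_toFinset.1 hQ
    have hQe : Q = (Q.1, dyadicIndex δ Q.1 v) := Prod.ext rfl hv.symm
    have h1 := hs.1
    -- By maximality the parent is not big; its volume is `2 ^ m` times larger, whence the upper
    -- bound.
    have h2 := hs.2 (Q.1 + 1) (Nat.lt_succ_self _)
    simp only [hbig] at h1 h2
    rw [← hQe] at h1
    refine ⟨h1.le, ?_⟩
    have hsub : dyadicCube δ Q ⊆ dyadicCube δ (Q.1 + 1, dyadicIndex δ (Q.1 + 1) v) := by
      intro w hw
      refine mem_dyadicCube.2 (dyadicIndex_succ ?_)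
      rw [mem_dyadicCube.1 hw, hv]
    refine (lintegral_mono_set hsub).trans ((not_lt.1 h2).trans_eq ?_)
    rw [volume_dyadicCube hδ, volume_dyadicCube hδ, pow_succ, ← mul_assoc,
      ENNReal.ofReal_mul (by positivity), mul_pow, ENNReal.ofReal_ofNat]
    ring

end cubes

/-! ### The vector-valued Hörmander estimate. -/

theorem lintegral_tail_norm_rpow_le (n : ℕ) {ε : ℝ} (hε : 0 < ε) : ∃ C : ℝ≥0, ∀ ρ : ℝ, 0 < ρ →
    ∫⁻ z in {z : Fin n → ℝ | ρ < ‖z‖}, ENNReal.ofReal (‖z‖ ^ (-((n : ℝ) + ε))) ≤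
      C * ENNReal.ofReal (ρ ^ (-ε)) := by
  set r : ℝ := (n : ℝ) + ε with hr
  have hr0 : 0 < r := by positivity
  have hI : ∫⁻ x : Fin n → ℝ, ENNReal.ofReal ((1 + ‖x‖) ^ (-r)) < ∞ :=
    finite_integral_one_add_norm (by simp [hr, hε])
  set I := ∫⁻ x : Fin n → ℝ, ENNReal.ofReal ((1 + ‖x‖) ^ (-r)) with hIdef
  refine ⟨(ENNReal.ofReal (2 ^ r) * I).toNNReal, fun ρ hρ => ?_⟩
  rw [ENNReal.coe_toNNReal (ENNReal.mul_lt_top ENNReal.ofReal_lt_top hI).ne]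
  have hmeas : Measurable fun x : Fin n → ℝ => ENNReal.ofReal ((1 + ‖x‖) ^ (-r)) := by fun_prop
  -- On `ρ < ‖z‖` the function is comparable to a dilate of the integrable `(1 + ‖x‖) ^ (-r)`;
  -- scaling produces the factor `ρ ^ (-ε)` with a constant free of `ρ`.
  have hscale : ∫⁻ z : Fin n → ℝ, ENNReal.ofReal ((1 + ‖ρ⁻¹ • z‖) ^ (-r))
      = ENNReal.ofReal (ρ ^ n) * I := by
    rw [← lintegral_map (μ := volume) hmeas (measurable_const_smul ρ⁻¹),
      Measure.map_addHaar_smul volume (inv_ne_zero hρ.ne'), lintegral_smul_measure]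
    simp [abs_of_pos hρ, hIdef]
  calc ∫⁻ z in {z : Fin n → ℝ | ρ < ‖z‖}, ENNReal.ofReal (‖z‖ ^ (-r))
      ≤ ∫⁻ z in {z : Fin n → ℝ | ρ < ‖z‖},
          ENNReal.ofReal ((2 / ρ) ^ r) * ENNReal.ofReal ((1 + ‖ρ⁻¹ • z‖) ^ (-r)) := by
        refine setLIntegral_mono (hmeas.comp (measurable_const_smul ρ⁻¹) |>.const_mul _)
          fun z hz => ?_
        have hz : ρ < ‖z‖ := hz
        rw [← ENNReal.ofReal_mul (by positivity)]
        refine ENNReal.ofReal_le_ofReal ?_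
        have hz0 : 0 < ‖z‖ := hρ.trans hz
        have h1 : 1 + ‖ρ⁻¹ • z‖ ≤ 2 / ρ * ‖z‖ := by
          rw [norm_smul, norm_inv, Real.norm_of_nonneg hρ.le]
          have : 1 ≤ ρ⁻¹ * ‖z‖ := by
            rw [← div_eq_inv_mul, one_le_div hρ]
            exact hz.le
          have h2 : 2 / ρ * ‖z‖ = ρ⁻¹ * ‖z‖ + ρ⁻¹ * ‖z‖ := by ring
          linarith
        have h2 := Real.rpow_le_rpow_of_nonpos (by positivity) h1 (neg_nonpos.2 hr0.le)
        refine le_trans (le_of_eq ?_) (mul_le_mul_of_nonneg_left h2 (by positivity))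
        rw [Real.mul_rpow (by positivity) hz0.le, ← mul_assoc, ← Real.rpow_add (by positivity)]
        simp
    _ ≤ ∫⁻ z, ENNReal.ofReal ((2 / ρ) ^ r) * ENNReal.ofReal ((1 + ‖ρ⁻¹ • z‖) ^ (-r)) :=
        setLIntegral_le_lintegral _ _
    _ = ENNReal.ofReal (2 ^ r) * I * ENNReal.ofReal (ρ ^ (-ε)) := by
        rw [lintegral_const_mul (f := fun z : Fin n → ℝ => ENNReal.ofReal ((1 + ‖ρ⁻¹ • z‖) ^ (-r))) _
          (hmeas.comp (measurable_const_smul ρ⁻¹)), hscale, ← mul_assoc,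
          ← ENNReal.ofReal_mul (by positivity), mul_right_comm, ← ENNReal.ofReal_mul (by positivity)]
        congr 2
        rw [Real.div_rpow (by positivity) hρ.le, hr, Real.rpow_add hρ, Real.rpow_natCast,
          Real.rpow_neg hρ.le]
        field_simp

section fiberNorm

variable {j m : ℕ}

/-- The mixed norm in the first `j` variables. -/
def fiberNorm (a : Fin j → ℝ≥0∞) (F : (Fin (m + j) → ℝ) → ℝ≥0∞) (v : Fin m → ℝ) : ℝ≥0∞ :=
  iteratedNorm j a fun u => F (glue u v)

theorem measurable_fiberNorm (a : Fin j → ℝ≥0∞) {F : (Fin (m + j) → ℝ) → ℝ≥0∞}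
    (hF : Measurable F) : Measurable (fiberNorm a F) := iteratedNorm.measurable_glue a hF

theorem iteratedNorm_glue_const (a : Fin j → ℝ≥0∞) {p : ℝ≥0∞} (h0 : p ≠ 0) (htop : p ≠ ∞)
    {F : (Fin (m + j) → ℝ) → ℝ≥0∞} (hF : Measurable F) :
    iteratedNorm (m + j) (glue a fun _ => p) F =
      (∫⁻ v, fiberNorm a F v ^ p.toReal) ^ (1 / p.toReal) :=
  (iteratedNorm.glue_eq _ a F).trans (iteratedNorm.const_eq h0 htop (measurable_fiberNorm a hF))

theorem integral_glue {f : (Fin (m + j) → ℝ) → ℂ} (hf : Integrable f) :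
    ∫ x, f x = ∫ u : Fin j → ℝ, ∫ v : Fin m → ℝ, f (glue u v) := by
  have hmp := measurePreserving_glue m j
  have hi : Integrable (fun z : (Fin j → ℝ) × (Fin m → ℝ) => f (glue z.1 z.2))
      (volume.prod volume) := hmp.integrable_comp_of_integrable hf
  rw [← integral_prod _ hi]
  rw [← hmp.map_eq, integral_map hmp.measurable.aemeasurable]
  · rfl
  · rw [hmp.map_eq]
    exact hf.aestronglyMeasurable

variable {a a' : Fin j → ℝ≥0∞}
  {K : (Fin (m + j) → ℝ) → (Fin (m + j) → ℝ) → ℂ}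
  {T : Lp ℂ 2 (volume : Measure (Fin (m + j) → ℝ)) →L[ℂ]
    Lp ℂ 2 (volume : Measure (Fin (m + j) → ℝ))}

/-- Away from the support, an operator with kernel acts on a function with mean zero in the last
variables through differences of the kernel. -/
theorem IsCZ.enorm_le_of_mean_zero (h : IsCZ K T) {b : (Fin (m + j) → ℝ) → ℂ} (hb : IsTest b)
    {c : Fin m → ℝ} {s : ℝ} (hs : ∀ x, b x ≠ 0 → ‖blockSnd x - c‖ ≤ s)
    (hmean : ∀ u, ∫ v, b (glue u v) = 0) :
    ∀ᵐ x, s < ‖blockSnd x - c‖ → ‖T hb.toLp x‖ₑ ≤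
      ∫⁻ y, ‖K x y - K x (glue (blockFst y) c)‖ₑ * ‖b y‖ₑ := by
  filter_upwards [h.representation b hb.toLp hb.memLp_top hb.compact hb.coeFn_toLp] with x hx hxs
  have hts : tsupport b ⊆ {x | ‖blockSnd x - c‖ ≤ s} :=
    closure_minimal (fun x hx => hs x hx)
      (isClosed_le (continuous_blockSnd.sub continuous_const).norm continuous_const)
  have hxt : x ∉ tsupport b := fun hh => (hts hh).not_gt hxs
  have hint1 := h.integrable_mul hb hxt
  have hs0 : 0 < ‖blockSnd x - c‖ ∨ ∀ x, b x = 0 := by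
    by_cases hz : ∀ x, b x = 0
    · exact Or.inr hz
    · push Not at hz
      obtain ⟨y, hy⟩ := hz
      exact Or.inl (((norm_nonneg _).trans (hs y hy)).trans_lt hxs)
  have hint2 : Integrable fun y => K x (glue (blockFst y) c) * b y := by
    rcases hs0 with hs0 | hz
    · have hc : Continuous fun y : Fin (m + j) → ℝ => K x (glue (blockFst y) c) := by
        refine h.continuousOn.comp_continuous (f := fun y => (x, glue (blockFst y) c))
          (continuous_const.prodMk ((continuous_glue_left c).comp continuous_blockFst))
          fun y hxy => ?_
        have hxy : x = glue (blockFst y) c := hxy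
        rw [hxy] at hs0
        simp at hs0
      obtain ⟨M, hM⟩ := hb.compact.isCompact.exists_bound_of_continuousOn hc.continuousOn
      refine (hb.integrable.norm.const_mul M).mono'
        (hc.aestronglyMeasurable.mul hb.integrable.aestronglyMeasurable)
        (Filter.Eventually.of_forall fun y => ?_)
      rw [norm_mul]
      by_cases hy : y ∈ tsupport b
      · exact mul_le_mul_of_nonneg_right (hM y hy) (norm_nonneg _)
      · simp [image_eq_zero_of_notMem_tsupport hy]
    · simp [hz]
  -- The frozen kernel does not depend on the last variables, in which `b` has mean zero; the first
  -- variables are left untouched.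
  have hzero : ∫ y, K x (glue (blockFst y) c) * b y = 0 := by
    rw [integral_glue hint2]
    simp only [blockFst_glue]
    simp_rw [integral_const_mul, hmean]
    simp
  rw [hx hxt, ← sub_zero (∫ y, K x y * b y), ← hzero, ← integral_sub hint1 hint2]
  refine (enorm_integral_le_lintegral_enorm _).trans_eq (lintegral_congr fun y => ?_)
  rw [← sub_mul, enorm_mul]

theorem measurable_comp_glue {F : (Fin (m + j) → ℝ) → ℝ≥0∞} (hF : Measurable F) :
    Measurable fun z : (Fin j → ℝ) × (Fin m → ℝ) => F (glue z.1 z.2) := hF.comp measurable_glue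

/-- A convolution-type estimate for the mixed norm in the first variables. -/
theorem iteratedNorm_conv_le (ha : ConjExps a a') {Φ : (Fin j → ℝ) → ℝ≥0∞} (hΦ : Measurable Φ)
    (hΦtop : ∀ h, Φ h ≠ ∞) {B : (Fin (m + j) → ℝ) → ℝ≥0∞} (hB : Measurable B) :
    iteratedNorm j a (fun u => ∫⁻ v : Fin m → ℝ, ∫⁻ u' : Fin j → ℝ, Φ (u - u') * B (glue u' v)) ≤
      (∫⁻ h, Φ h) * ∫⁻ v, fiberNorm a B v := by
  -- Substituting `h = u - u'` writes the convolution as a superposition of translates of `B`.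
  -- Minkowski is then applied in `v` and in `h`, and translation invariance leaves the integral of
  -- `Φ`.
  have hsub : ∀ u (v : Fin m → ℝ), ∫⁻ u' : Fin j → ℝ, Φ (u - u') * B (glue u' v)
      = ∫⁻ h, Φ h * B (glue (u - h) v) := fun u v => by
    rw [← lintegral_sub_left_eq_self (μ := volume) _ u]
    simp
  simp_rw [hsub]
  have hm3 : Measurable fun z : ((Fin j → ℝ) × (Fin m → ℝ)) × (Fin j → ℝ) =>
      Φ z.2 * B (glue (z.1.1 - z.2) z.1.2) :=
    (hΦ.comp measurable_snd).mul ((measurable_comp_glue hB).comp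
      (((measurable_fst.comp measurable_fst).sub measurable_snd).prodMk
        (measurable_snd.comp measurable_fst)))
  refine (iteratedNorm.lintegral_le ha (G := fun u (v : Fin m → ℝ) =>
    ∫⁻ h, Φ h * B (glue (u - h) v)) hm3.lintegral_prod_right').trans ?_
  rw [← lintegral_const_mul _ (measurable_fiberNorm a hB)]
  refine lintegral_mono fun v => ?_
  have hm2 : Measurable fun z : (Fin j → ℝ) × (Fin j → ℝ) => Φ z.2 * B (glue (z.1 - z.2) v) :=
    hm3.comp ((measurable_fst.prodMk measurable_const).prodMk measurable_snd)
  refine (iteratedNorm.lintegral_le ha (G := fun u h => Φ h * B (glue (u - h) v)) hm2).trans ?_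
  rw [← lintegral_mul_const _ hΦ]
  refine lintegral_mono fun h => ?_
  refine (iteratedNorm.const_mul_le' a (hΦtop h) _).trans_eq ?_
  congr 1
  exact iteratedNorm.comp_sub_right a (F := fun u => B (glue u v))
    (hB.comp (measurable_glue_left v)) h

/-- The estimate away from the support for functions with mean zero in the last variables. -/
theorem IsCZ.lintegral_fiberNorm_le_of_mean_zero (ha : ConjExps a a') (h : IsCZ K T) :
    ∃ (A : ℝ) (C : ℝ≥0), 1 ≤ A ∧ ∀ (b : (Fin (m + j) → ℝ) → ℂ) (hb : IsTest b)
      (c : Fin m → ℝ) (s : ℝ), 0 < s → (∀ x, b x ≠ 0 → ‖blockSnd x - c‖ ≤ s) →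
      (∀ u, ∫ v, b (glue u v) = 0) →
      ∫⁻ v in {v | A * s < ‖v - c‖}, fiberNorm a (fun x => ‖T hb.toLp x‖ₑ) v ≤
        C * ∫⁻ v, fiberNorm a (fun x => ‖b x‖ₑ) v := by
  obtain ⟨ε, hε, Cr, hCr, A, hA, hreg⟩ := h.regularity
  obtain ⟨C0, hC0⟩ := lintegral_tail_norm_rpow_le (m + j) hε
  refine ⟨A, Cr.toNNReal * C0, by linarith, fun b hb c s hs hsupp hmean => ?_⟩
  set r : ℝ := ((m + j : ℕ) : ℝ) + ε with hr
  have hA0 : 0 < A := by linarith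
  -- Majorant of the kernel difference: replacing `y` by `(blockFst y, c)` moves it by at most `s`,
  -- and `z` is the difference of `x` and the moved point.
  set Φ : (Fin (m + j) → ℝ) → ℝ≥0∞ := fun z =>
    ENNReal.ofReal (Cr * s ^ ε) * ENNReal.ofReal (‖z‖ ^ (-r)) with hΦ
  have hΦm : Measurable Φ := by fun_prop
  have hΦtop : ∀ z, Φ z ≠ ∞ := fun z => ENNReal.mul_ne_top (by simp) (by simp)
  have hbm : Measurable fun x => ‖b x‖ₑ := hb.measurable.enorm
  have hpt : ∀ᵐ v : Fin m → ℝ, A * s < ‖v - c‖ →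
      fiberNorm a (fun x => ‖T hb.toLp x‖ₑ) v ≤
        (∫⁻ u, Φ (glue u (v - c))) * ∫⁻ v, fiberNorm a (fun x => ‖b x‖ₑ) v := by
    filter_upwards [ae_glue (h.enorm_le_of_mean_zero hb hsupp hmean)] with v hv hvc
    have hvs : s < ‖v - c‖ := by nlinarith
    have hΦv : Measurable fun u => Φ (glue u (v - c)) := hΦm.comp (measurable_glue_left _)
    refine le_trans (iteratedNorm.mono_ae ?_)
      (iteratedNorm_conv_le ha hΦv (fun u => hΦtop _) hbm)
    filter_upwards [hv] with u hu
    simp only [blockSnd_glue] at hu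
    refine (hu hvs).trans ?_
    have hbound : ∀ y, ‖K (glue u v) y - K (glue u v) (glue (blockFst y) c)‖ₑ * ‖b y‖ₑ ≤
        Φ (glue (u - blockFst y) (v - c)) * ‖b y‖ₑ := by
      intro y
      by_cases hy : b y = 0
      · simp [hy]
      have hys := hsupp y hy
      refine mul_le_mul_left ?_ _
      have hnorm1 : ‖glue (blockFst y) c - y‖ ≤ s := by
        conv_lhs => rw [← glue_block y]
        rw [blockFst_glue, glue_sub, sub_self]
        refine (norm_glue_zero_le _).trans ?_
        rw [norm_sub_rev]
        exact hys
      have hnorm2 : ‖glue (blockFst y) c - glue u v‖ = ‖glue (u - blockFst y) (v - c)‖ := by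
        rw [norm_sub_rev, glue_sub]
      have hnorm3 : ‖v - c‖ ≤ ‖glue (u - blockFst y) (v - c)‖ := norm_le_norm_glue _ _
      have hpos : 0 < ‖glue (u - blockFst y) (v - c)‖ := (hs.trans hvs).trans_le hnorm3
      have hne : glue (blockFst y) c ≠ glue u v := fun hh => by
        rw [← hnorm2, hh, sub_self, norm_zero] at hpos
        exact hpos.false
      have h1 := hreg (glue (blockFst y) c) (glue u v) y hne (by
        rw [hnorm2]
        calc A * ‖glue (blockFst y) c - y‖ ≤ A * s := by gcongr
          _ ≤ _ := hvc.le.trans hnorm3)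
      rw [hnorm2] at h1
      have h2 : ‖K (glue u v) y - K (glue u v) (glue (blockFst y) c)‖
          ≤ Cr * s ^ ε * ‖glue (u - blockFst y) (v - c)‖ ^ (-r) := by
        rw [norm_sub_rev]
        refine (le_add_of_nonneg_left (norm_nonneg _)).trans (h1.trans ?_)
        rw [Real.rpow_neg hpos.le, ← div_eq_mul_inv]
        gcongr
      rw [← ofReal_norm]
      simp only [hΦ]
      rw [← ENNReal.ofReal_mul (by positivity)]
      exact ENNReal.ofReal_le_ofReal h2
    refine (lintegral_mono hbound).trans_eq ?_
    have hΦg : Measurable fun y : Fin (m + j) → ℝ => Φ (glue (u - blockFst y) (v - c)) :=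
      hΦv.comp (continuous_blockFst.measurable.const_sub u)
    rw [lintegral_glue (F := fun y => Φ (glue (u - blockFst y) (v - c)) * ‖b y‖ₑ) (hΦg.mul hbm)]
    simp
  have hset : MeasurableSet {v : Fin m → ℝ | A * s < ‖v - c‖} :=
    measurableSet_lt measurable_const (measurable_id.sub_const c).norm
  have hΦ2 : Measurable fun v : Fin m → ℝ => ∫⁻ u : Fin j → ℝ, Φ (glue u (v - c)) := by
    have : Measurable fun z : (Fin m → ℝ) × (Fin j → ℝ) => Φ (glue z.2 (z.1 - c)) :=
      hΦm.comp (measurable_glue.comp (measurable_snd.prodMk (measurable_fst.sub_const c)))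
    exact this.lintegral_prod_right'
  -- The region lies in the exterior `A * s < ‖z‖` in all variables. There `s ^ ε` cancels against
  -- `(A * s) ^ (-ε)`, so the bound is independent of `s`.
  have htail : ∫⁻ v in {v : Fin m → ℝ | A * s < ‖v - c‖}, ∫⁻ u : Fin j → ℝ, Φ (glue u (v - c)) ≤
      (Cr.toNNReal * C0 : ℝ≥0) := by
    have hset2 : MeasurableSet {z : Fin (m + j) → ℝ | A * s < ‖z‖} :=
      measurableSet_lt measurable_const measurable_norm
    calc ∫⁻ v in {v : Fin m → ℝ | A * s < ‖v - c‖}, ∫⁻ u : Fin j → ℝ, Φ (glue u (v - c))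
        ≤ ∫⁻ v : Fin m → ℝ, ∫⁻ u : Fin j → ℝ,
            {z : Fin (m + j) → ℝ | A * s < ‖z‖}.indicator Φ (glue u (v - c)) := by
          rw [← lintegral_indicator hset]
          refine lintegral_mono fun v => ?_
          by_cases hv : v ∈ {v : Fin m → ℝ | A * s < ‖v - c‖}
          · rw [Set.indicator_of_mem hv]
            refine lintegral_mono fun u => ?_
            have : glue u (v - c) ∈ {z : Fin (m + j) → ℝ | A * s < ‖z‖} :=
              lt_of_lt_of_le hv (norm_le_norm_glue u (v - c))
            rw [Set.indicator_of_mem this]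
          · rw [Set.indicator_of_notMem hv]
            exact zero_le
      _ = ∫⁻ z in {z : Fin (m + j) → ℝ | A * s < ‖z‖}, Φ z := by
          rw [lintegral_sub_right_eq_self (fun v : Fin m → ℝ => ∫⁻ u : Fin j → ℝ,
            {z : Fin (m + j) → ℝ | A * s < ‖z‖}.indicator Φ (glue u v)) c,
            ← lintegral_glue (hΦm.indicator hset2), lintegral_indicator hset2]
      _ ≤ ENNReal.ofReal (Cr * s ^ ε) * (C0 * ENNReal.ofReal ((A * s) ^ (-ε))) := by
          rw [hΦ, lintegral_const_mul _ (by fun_prop)]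
          exact mul_le_mul_right (hC0 _ (by positivity)) _
      _ ≤ ((Cr.toNNReal * C0 : ℝ≥0) : ℝ≥0∞) := by
          have h1 : Cr * s ^ ε * (A * s) ^ (-ε) ≤ Cr := by
            rw [Real.mul_rpow hA0.le hs.le, Real.rpow_neg hs.le, Real.rpow_neg hA0.le]
            have hse : 0 < s ^ ε := Real.rpow_pos_of_pos hs _
            have hAe : 1 ≤ A ^ ε := Real.one_le_rpow (by linarith) hε.le
            have : Cr * s ^ ε * ((A ^ ε)⁻¹ * (s ^ ε)⁻¹) = Cr * (A ^ ε)⁻¹ := by field_simp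
            rw [this]
            exact mul_le_of_le_one_right hCr.le (inv_le_one_of_one_le₀ hAe)
          rw [mul_left_comm, ← ENNReal.ofReal_mul (by positivity), mul_comm, ENNReal.coe_mul]
          exact mul_le_mul_left (ENNReal.ofReal_le_ofReal h1) _
  calc ∫⁻ v in {v | A * s < ‖v - c‖}, fiberNorm a (fun x => ‖T hb.toLp x‖ₑ) v
      ≤ ∫⁻ v in {v | A * s < ‖v - c‖}, (∫⁻ u, Φ (glue u (v - c))) *
          ∫⁻ v, fiberNorm a (fun x => ‖b x‖ₑ) v := by
        refine lintegral_mono_ae ((ae_restrict_iff' hset).2 ?_)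
        filter_upwards [hpt] with v hv hv'
        exact hv hv'
    _ = (∫⁻ v in {v | A * s < ‖v - c‖}, ∫⁻ u, Φ (glue u (v - c))) *
          ∫⁻ v, fiberNorm a (fun x => ‖b x‖ₑ) v := lintegral_mul_const _ hΦ2
    _ ≤ _ := mul_le_mul_left htail _

end fiberNorm

/-! ### A Marcinkiewicz-type interpolation argument. -/

section interpolation

variable {α : Type*} [MeasurableSpace α] {μ : Measure α} [SFinite μ]

theorem lintegral_Ioi_rpow_of_le {c s : ℝ} (hc : 0 < c) (hs : 0 < s) :
    ∫⁻ t in Set.Ioi (0 : ℝ), (Set.Ici c).indicator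
      (fun t => ENNReal.ofReal (t ^ (-s - 1))) t = ENNReal.ofReal (c ^ (-s) / s) := by
  have hsub : Set.Ici c ⊆ Set.Ioi (0 : ℝ) := fun x hx => hc.trans_le (Set.mem_Ici.1 hx)
  rw [setLIntegral_indicator measurableSet_Ici, Set.inter_eq_left.2 hsub, setLIntegral_congr Ioi_ae_eq_Ici.symm,
    ← ofReal_integral_eq_lintegral_ofReal, integral_Ioi_rpow_of_lt (by linarith) hc]
  · congr 1
    rw [sub_add_cancel, div_neg, neg_div, neg_neg]
  · exact integrableOn_Ioi_rpow_of_lt (by linarith) hc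
  · filter_upwards [self_mem_ae_restrict measurableSet_Ioi] with t ht
    exact Real.rpow_nonneg (hc.trans ht).le _

theorem lintegral_Ioi_rpow_of_lt {c s : ℝ} (hc : 0 < c) (hs : 0 < s) :
    ∫⁻ t in Set.Ioi (0 : ℝ), (Set.Iio c).indicator
      (fun t => ENNReal.ofReal (t ^ (s - 1))) t = ENNReal.ofReal (c ^ s / s) := by
  have hi : IntervalIntegrable (fun t : ℝ => t ^ (s - 1)) volume 0 c :=
    intervalIntegral.intervalIntegrable_rpow' (by linarith)
  rw [setLIntegral_indicator measurableSet_Iio, Set.inter_comm, Set.Ioi_inter_Iio,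
    setLIntegral_congr Ioo_ae_eq_Ioc, ← ofReal_integral_eq_lintegral_ofReal,
    ← intervalIntegral.integral_of_le hc.le, integral_rpow (Or.inl (by linarith))]
  · simp [hs.ne']
  · exact (intervalIntegrable_iff_integrableOn_Ioc_of_le hc.le).1 hi
  · filter_upwards [self_mem_ae_restrict measurableSet_Ioc] with t ht
    exact Real.rpow_nonneg ht.1.le _

/-- A Marcinkiewicz-type argument: a weak-type bound by truncations at each height gives a strong
bound for smaller exponents. -/
theorem lintegral_rpow_le_of_weak {p r : ℝ} (hr : 1 < r) (hrp : r < p) (C₁ C₂ : ℝ≥0) :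
    ∃ C : ℝ≥0, ∀ U F : α → ℝ≥0∞, Measurable U → Measurable F → (∀ᵐ v ∂μ, U v < ∞) →
      (∀ v, F v < ∞) →
      (∀ t : ℝ, 0 < t → μ {v | ENNReal.ofReal (2 * t) < U v} ≤
        C₁ * (ENNReal.ofReal (t ^ (-p)) * ∫⁻ v in {v | F v ≤ ENNReal.ofReal t}, F v ^ p ∂μ) +
        C₂ * (ENNReal.ofReal (t ^ (-1 : ℝ)) *
          ∫⁻ v in {v | ENNReal.ofReal (t / 2) < F v}, F v ∂μ)) →
      ∫⁻ v, U v ^ r ∂μ ≤ C * ∫⁻ v, F v ^ r ∂μ := by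
  have hr0 : 0 < r := by linarith
  -- `D` comes from the layer-cake formula at height `2 * t`; `E₁` and `E₂` come from the
  -- `t`-integrals over small and large values of `F`.
  set D : ℝ≥0 := Real.toNNReal (r * 2 ^ r) with hD
  set E₁ : ℝ≥0 := Real.toNNReal (1 / (p - r)) with hE₁
  set E₂ : ℝ≥0 := Real.toNNReal (2 ^ (r - 1) / (r - 1)) with hE₂
  refine ⟨D * (C₁ * E₁ + C₂ * E₂), fun U F hU hF hUfin hFfin hweak => ?_⟩
  have hlayer : ∫⁻ v, U v ^ r ∂μ = D * ∫⁻ t in Set.Ioi (0 : ℝ),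
      μ {v | ENNReal.ofReal (2 * t) < U v} * ENNReal.ofReal (t ^ (r - 1)) := by
    have h1 := lintegral_rpow_eq_lintegral_meas_lt_mul μ (f := fun v => (U v).toReal / 2)
      (Filter.Eventually.of_forall fun v => div_nonneg ENNReal.toReal_nonneg zero_le_two)
      (hU.ennreal_toReal.div_const 2).aemeasurable hr0
    have h2 : ∫⁻ v, U v ^ r ∂μ
        = ENNReal.ofReal (2 ^ r) * ∫⁻ v, ENNReal.ofReal (((U v).toReal / 2) ^ r) ∂μ := by
      rw [← lintegral_const_mul' _ _ ENNReal.ofReal_ne_top]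
      refine lintegral_congr_ae ?_
      filter_upwards [hUfin] with v hv
      rw [← ENNReal.ofReal_mul (by positivity),
        ← Real.mul_rpow (by positivity) (div_nonneg ENNReal.toReal_nonneg zero_le_two),
        mul_div_cancel₀ _ two_ne_zero, ← ENNReal.ofReal_rpow_of_nonneg ENNReal.toReal_nonneg hr0.le,
        ENNReal.ofReal_toReal hv.ne]
    rw [h2, h1, ← mul_assoc, ← ENNReal.ofReal_mul (by positivity), mul_comm (2 ^ r) r]
    congr 1
    refine setLIntegral_congr_fun measurableSet_Ioi fun t ht => ?_
    have ht : 0 < t := ht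
    refine congrArg (· * _) (measure_congr ?_)
    filter_upwards [hUfin] with v hv
    refine propext ?_
    change t < (U v).toReal / 2 ↔ ENNReal.ofReal (2 * t) < U v
    rw [ENNReal.ofReal_lt_iff_lt_toReal (by positivity) hv.ne, lt_div_iff₀ two_pos, mul_comm]
  have hterm : ∀ t ∈ Set.Ioi (0 : ℝ), μ {v | ENNReal.ofReal (2 * t) < U v} *
      ENNReal.ofReal (t ^ (r - 1)) ≤
      C₁ * (∫⁻ v, F v ^ p * {v : α | F v ≤ ENNReal.ofReal t}.indicator
        (fun _ => ENNReal.ofReal (t ^ (-(p - r) - 1))) v ∂μ) +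
      C₂ * (∫⁻ v, F v * {v : α | ENNReal.ofReal (t / 2) < F v}.indicator
        (fun _ => ENNReal.ofReal (t ^ (r - 1 - 1))) v ∂μ) := by
    intro t ht
    have ht : 0 < t := ht
    refine (mul_le_mul_left (hweak t ht) _).trans_eq ?_
    rw [add_mul, mul_assoc (C₁ : ℝ≥0∞), mul_assoc (C₂ : ℝ≥0∞)]
    refine congrArg₂ (· + ·) (congrArg _ ?_) (congrArg _ ?_)
    · rw [mul_right_comm, ← ENNReal.ofReal_mul (by positivity), ← Real.rpow_add ht,
        ← lintegral_const_mul' _ _ ENNReal.ofReal_ne_top,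
        ← lintegral_indicator (measurableSet_le hF measurable_const)]
      refine lintegral_congr fun v => ?_
      by_cases hv : v ∈ {v : α | F v ≤ ENNReal.ofReal t}
      · rw [Set.indicator_of_mem hv, Set.indicator_of_mem hv, mul_comm]
        congr 3
        ring
      · rw [Set.indicator_of_notMem hv, Set.indicator_of_notMem hv, mul_zero]
    · rw [mul_right_comm, ← ENNReal.ofReal_mul (by positivity), ← Real.rpow_add ht,
        ← lintegral_const_mul' _ _ ENNReal.ofReal_ne_top,
        ← lintegral_indicator (measurableSet_lt measurable_const hF)]
      refine lintegral_congr fun v => ?_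
      by_cases hv : v ∈ {v : α | ENNReal.ofReal (t / 2) < F v}
      · rw [Set.indicator_of_mem hv, Set.indicator_of_mem hv, mul_comm]
        congr 3
        ring
      · rw [Set.indicator_of_notMem hv, Set.indicator_of_notMem hv, mul_zero]
  have hm1 : Measurable fun z : ℝ × α => F z.2 ^ p * {v : α | F v ≤ ENNReal.ofReal z.1}.indicator
      (fun _ => ENNReal.ofReal (z.1 ^ (-(p - r) - 1))) z.2 := by
    refine ((hF.comp measurable_snd).pow_const p).mul ?_
    have : Measurable ({z : ℝ × α | F z.2 ≤ ENNReal.ofReal z.1}.indicator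
        fun z => ENNReal.ofReal (z.1 ^ (-(p - r) - 1))) :=
      Measurable.indicator (by fun_prop) (measurableSet_le (hF.comp measurable_snd)
        (ENNReal.measurable_ofReal.comp measurable_fst))
    exact this
  have hm2 : Measurable fun z : ℝ × α => F z.2 *
      {v : α | ENNReal.ofReal (z.1 / 2) < F v}.indicator
      (fun _ => ENNReal.ofReal (z.1 ^ (r - 1 - 1))) z.2 := by
    refine (hF.comp measurable_snd).mul ?_
    have : Measurable ({z : ℝ × α | ENNReal.ofReal (z.1 / 2) < F z.2}.indicator
        fun z => ENNReal.ofReal (z.1 ^ (r - 1 - 1))) :=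
      Measurable.indicator (by fun_prop) (measurableSet_lt
        (ENNReal.measurable_ofReal.comp (measurable_fst.div_const 2)) (hF.comp measurable_snd))
    exact this
  -- After Tonelli, `t ^ (r - p - 1)` is integrated over `t ≥ F v`, which converges because `r < p`.
  have hT1 : ∫⁻ t in Set.Ioi (0 : ℝ), ∫⁻ v, F v ^ p * {v : α | F v ≤ ENNReal.ofReal t}.indicator
        (fun _ => ENNReal.ofReal (t ^ (-(p - r) - 1))) v ∂μ ≤ E₁ * ∫⁻ v, F v ^ r ∂μ := by
    rw [lintegral_lintegral_swap hm1.aemeasurable, ← lintegral_const_mul' _ _ ENNReal.coe_ne_top]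
    refine lintegral_mono fun v => ?_
    rcases eq_or_ne (F v) 0 with h0 | h0
    · simp [h0, hr0.trans hrp]
    obtain ⟨c, hc⟩ : ∃ c, c = (F v).toReal := ⟨_, rfl⟩
    have hFc : F v = ENNReal.ofReal c := by rw [hc, ENNReal.ofReal_toReal (hFfin v).ne]
    have hc0 : 0 < c := hc ▸ ENNReal.toReal_pos h0 (hFfin v).ne
    have hind : ∀ t ∈ Set.Ioi (0 : ℝ), F v ^ p * {v : α | F v ≤ ENNReal.ofReal t}.indicator
        (fun _ => ENNReal.ofReal (t ^ (-(p - r) - 1))) v =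
        F v ^ p * (Set.Ici c).indicator (fun t => ENNReal.ofReal (t ^ (-(p - r) - 1))) t := by
      intro t ht
      have : v ∈ {v : α | F v ≤ ENNReal.ofReal t} ↔ t ∈ Set.Ici c := by
        change F v ≤ ENNReal.ofReal t ↔ c ≤ t
        rw [hFc, ENNReal.ofReal_le_ofReal_iff (le_of_lt ht)]
      by_cases hv : t ∈ Set.Ici c
      · rw [Set.indicator_of_mem hv, Set.indicator_of_mem (this.2 hv)]
      · rw [Set.indicator_of_notMem hv, Set.indicator_of_notMem (fun h => hv (this.1 h))]
    rw [setLIntegral_congr_fun measurableSet_Ioi hind, lintegral_const_mul'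
      _ _ (ENNReal.rpow_ne_top_of_nonneg (hr0.trans hrp).le (hFfin v).ne),
      lintegral_Ioi_rpow_of_le hc0 (sub_pos.2 hrp), hFc,
      ENNReal.ofReal_rpow_of_pos hc0, ENNReal.ofReal_rpow_of_pos hc0,
      ← ENNReal.ofReal_mul (by positivity)]
    have hE : (E₁ : ℝ≥0∞) = ENNReal.ofReal (1 / (p - r)) := rfl
    rw [hE, ← ENNReal.ofReal_mul (by have := sub_pos.2 hrp; positivity)]
    refine le_of_eq (congrArg _ ?_)
    have h3 : c ^ p * c ^ (-(p - r)) = c ^ r := by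
      rw [← Real.rpow_add hc0]
      congr 1
      ring
    rw [← h3]
    ring
  -- Here `t ^ (r - 2)` is integrated over `0 < t < 2 * F v`, which converges because `r > 1`.
  have hT2 : ∫⁻ t in Set.Ioi (0 : ℝ), ∫⁻ v, F v * {v : α | ENNReal.ofReal (t / 2) < F v}.indicator
        (fun _ => ENNReal.ofReal (t ^ (r - 1 - 1))) v ∂μ ≤ E₂ * ∫⁻ v, F v ^ r ∂μ := by
    rw [lintegral_lintegral_swap hm2.aemeasurable, ← lintegral_const_mul' _ _ ENNReal.coe_ne_top]
    refine lintegral_mono fun v => ?_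
    rcases eq_or_ne (F v) 0 with h0 | h0
    · simp [h0]
    obtain ⟨c, hc⟩ : ∃ c, c = (F v).toReal := ⟨_, rfl⟩
    have hFc : F v = ENNReal.ofReal c := by rw [hc, ENNReal.ofReal_toReal (hFfin v).ne]
    have hc0 : 0 < c := hc ▸ ENNReal.toReal_pos h0 (hFfin v).ne
    have hind : ∀ t ∈ Set.Ioi (0 : ℝ), F v * {v : α | ENNReal.ofReal (t / 2) < F v}.indicator
        (fun _ => ENNReal.ofReal (t ^ (r - 1 - 1))) v =
        F v * (Set.Iio (2 * c)).indicator (fun t => ENNReal.ofReal (t ^ (r - 1 - 1))) t := by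
      intro t ht
      have : v ∈ {v : α | ENNReal.ofReal (t / 2) < F v} ↔ t ∈ Set.Iio (2 * c) := by
        change ENNReal.ofReal (t / 2) < F v ↔ t < 2 * c
        rw [hFc, ENNReal.ofReal_lt_ofReal_iff hc0, div_lt_iff₀' two_pos]
      by_cases hv : t ∈ Set.Iio (2 * c)
      · rw [Set.indicator_of_mem hv, Set.indicator_of_mem (this.2 hv)]
      · rw [Set.indicator_of_notMem hv, Set.indicator_of_notMem (fun h => hv (this.1 h))]
    rw [setLIntegral_congr_fun measurableSet_Ioi hind, lintegral_const_mul' _ _ (hFfin v).ne,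
      lintegral_Ioi_rpow_of_lt (by positivity) (sub_pos.2 hr), hFc,
      ENNReal.ofReal_rpow_of_pos hc0, ← ENNReal.ofReal_mul (by positivity)]
    have hr1 : 0 < r - 1 := sub_pos.2 hr
    have hE : (E₂ : ℝ≥0∞) = ENNReal.ofReal (2 ^ (r - 1) / (r - 1)) := rfl
    rw [hE, ← ENNReal.ofReal_mul (by positivity)]
    refine le_of_eq (congrArg _ ?_)
    have h3 : c ^ (r - 1) * c = c ^ r := by
      rw [← Real.rpow_add_one hc0.ne']
      congr 1
      ring
    rw [← h3, Real.mul_rpow two_pos.le hc0.le]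
    ring
  have hn1 : Measurable fun t : ℝ => ∫⁻ v, F v ^ p * {v : α | F v ≤ ENNReal.ofReal t}.indicator
        (fun _ => ENNReal.ofReal (t ^ (-(p - r) - 1))) v ∂μ := hm1.lintegral_prod_right'
  rw [hlayer]
  calc _ ≤ (D : ℝ≥0∞) * (C₁ * (E₁ * ∫⁻ v, F v ^ r ∂μ) + C₂ * (E₂ * ∫⁻ v, F v ^ r ∂μ)) := by
        refine mul_le_mul_right ((setLIntegral_mono' measurableSet_Ioi hterm).trans ?_) _
        rw [lintegral_add_left (hn1.const_mul _), lintegral_const_mul' _ _ ENNReal.coe_ne_top,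
          lintegral_const_mul' _ _ ENNReal.coe_ne_top]
        exact add_le_add (mul_le_mul_right hT1 _) (mul_le_mul_right hT2 _)
    _ = _ := by
        push_cast
        ring

end interpolation

/-! ### Averages and oscillations in the last variables. -/

section oscillation

variable {j m : ℕ}

/-- The average over `D` in the last variables. -/
def fiberAvg (f : (Fin (m + j) → ℝ) → ℂ) (D : Set (Fin m → ℝ)) (u : Fin j → ℝ) : ℂ :=
  (volume.real D)⁻¹ • ∫ w in D, f (glue u w)

/-- The oscillation on `D` in the last variables. -/
def fiberOsc (f : (Fin (m + j) → ℝ) → ℂ) (D : Set (Fin m → ℝ)) (x : Fin (m + j) → ℝ) : ℂ :=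
  (blockSnd ⁻¹' D).indicator (fun x => f x - fiberAvg f D (blockFst x)) x

variable {f : (Fin (m + j) → ℝ) → ℂ} {D : Set (Fin m → ℝ)}

theorem measurable_fiberAvg (hf : Measurable f) : Measurable (fiberAvg f D) := by
  have h1 : StronglyMeasurable fun z : (Fin j → ℝ) × (Fin m → ℝ) => f (glue z.1 z.2) :=
    (hf.comp measurable_glue).stronglyMeasurable
  have h2 := (h1.integral_prod_right' (ν := volume.restrict D)).measurable
  exact h2.const_smul ((volume.real D)⁻¹)

theorem measurable_glue_right (u : Fin j → ℝ) : Measurable fun v : Fin m → ℝ => glue u v :=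
  measurable_glue.comp (measurable_const.prodMk measurable_id)

theorem IsTest.integrableOn_glue (hf : IsTest f) (hDt : volume D ≠ ∞) (u : Fin j → ℝ) :
    IntegrableOn (fun v => f (glue u v)) D := by
  obtain ⟨M, hM⟩ := hf.bounded
  exact Measure.integrableOn_of_bounded hDt
    (hf.measurable.comp (measurable_glue_right u)).aestronglyMeasurable
    (Filter.Eventually.of_forall fun v => hM _)

theorem integral_fiberOsc (hf : IsTest f) (hD : MeasurableSet D) (hD0 : volume D ≠ 0)
    (hDt : volume D ≠ ∞) (u : Fin j → ℝ) : ∫ v, fiberOsc f D (glue u v) = 0 := by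
  have h1 : ∀ v, fiberOsc f D (glue u v) =
      D.indicator (fun v => f (glue u v) - fiberAvg f D u) v := fun v => by
    by_cases hv : v ∈ D
    · rw [fiberOsc, Set.indicator_of_mem (by simpa using hv), Set.indicator_of_mem hv,
        blockFst_glue]
    · rw [fiberOsc, Set.indicator_of_notMem (by simpa using hv), Set.indicator_of_notMem hv]
  simp_rw [h1]
  rw [integral_indicator hD, integral_sub (hf.integrableOn_glue hDt u) (integrableOn_const hDt),
    setIntegral_const, fiberAvg, smul_smul, mul_inv_cancel₀, one_smul, sub_self]
  exact (ENNReal.toReal_pos hD0 hDt).ne'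

theorem IsTest.fiberOsc (hf : IsTest f) (hD : MeasurableSet D) (hDb : Bornology.IsBounded D)
    (hD0 : volume D ≠ 0) : IsTest (fiberOsc f D) := by
  have hDt : volume D ≠ ∞ := hDb.measure_lt_top.ne
  obtain ⟨M, hM⟩ := hf.bounded
  obtain ⟨R, -, hR⟩ := hf.exists_radius
  obtain ⟨R', hR'⟩ := hDb.exists_norm_le
  have havg : ∀ u, ‖fiberAvg f D u‖ ≤ M := fun u => by
    have hr : 0 < volume.real D := ENNReal.toReal_pos hD0 hDt
    rw [fiberAvg, norm_smul, norm_inv, Real.norm_of_nonneg hr.le, inv_mul_le_iff₀ hr, mul_comm]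
    exact norm_setIntegral_le_of_norm_le_const hDt.lt_top fun w _ => hM _
  have havg0 : ∀ u, fiberAvg f D u ≠ 0 → ‖u‖ ≤ R := fun u hu => by
    by_contra hcon
    refine hu ?_
    have : ∀ w, f (glue u w) = 0 := fun w => by
      by_contra h
      exact hcon ((norm_le_norm_glue_left u w).trans (hR _ h))
    simp [fiberAvg, this]
  refine IsTest.of_bound ?_ (M + M) (fun x => ?_) (max R R') fun x hx => ?_
  · exact (hf.measurable.sub ((measurable_fiberAvg hf.measurable).comp
      continuous_blockFst.measurable)).indicator (continuous_blockSnd.measurable hD)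
  · refine (norm_indicator_le_norm_self _ _).trans ((norm_sub_le _ _).trans ?_)
    push_cast
    exact add_le_add (hM _) (havg _)
  · have hmem := Set.mem_of_indicator_ne_zero hx
    rw [_root_.fiberOsc, Set.indicator_of_mem hmem] at hx
    by_cases h0 : f x = 0
    · rw [h0, zero_sub, neg_ne_zero] at hx
      exact norm_le_of_block_le ((havg0 _ hx).trans (le_max_left _ _))
        ((hR' _ hmem).trans (le_max_right _ _))
    · exact (hR x h0).trans (le_max_left _ _)

variable {a a' : Fin j → ℝ≥0∞}

/-- Minkowski: the norm of an average is at most the average of the norms. -/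
theorem iteratedNorm_fiberAvg_mul_le (ha : ConjExps a a') (hf : Measurable f)
    (hD0 : volume D ≠ 0) (hDt : volume D ≠ ∞) :
    iteratedNorm j a (fun u => ‖fiberAvg f D u‖ₑ) * volume D ≤
      ∫⁻ v in D, fiberNorm a (fun x => ‖f x‖ₑ) v := by
  have h1 : ∀ u, ‖fiberAvg f D u‖ₑ ≤ (volume D)⁻¹ * ∫⁻ w in D, ‖f (glue u w)‖ₑ := fun u => by
    rw [fiberAvg, enorm_smul]
    refine mul_le_mul' (le_of_eq ?_) (enorm_integral_le_lintegral_enorm _)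
    rw [Measure.real, enorm_inv (ENNReal.toReal_pos hD0 hDt).ne',
      Real.enorm_of_nonneg ENNReal.toReal_nonneg, ENNReal.ofReal_toReal hDt]
  have hm : Measurable (Function.uncurry fun (u : Fin j → ℝ) (w : Fin m → ℝ) =>
      ‖f (glue u w)‖ₑ) := (hf.comp measurable_glue).enorm
  calc iteratedNorm j a (fun u => ‖fiberAvg f D u‖ₑ) * volume D
      ≤ (volume D)⁻¹ * (∫⁻ v in D, fiberNorm a (fun x => ‖f x‖ₑ) v) * volume D := by
        refine mul_le_mul_left ((iteratedNorm.mono h1).trans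
          ((iteratedNorm.const_mul_le' a (ENNReal.inv_ne_top.2 hD0) _).trans ?_)) _
        exact mul_le_mul_right (iteratedNorm.lintegral_le ha hm) _
    _ = _ := by
        rw [mul_right_comm, ENNReal.inv_mul_cancel hD0 hDt, one_mul]

/-- The factor `2` accounts for `f` and its average, each contributing the same bound. -/
theorem lintegral_fiberNorm_fiberOsc_le (ha : ConjExps a a') (hf : Measurable f)
    (hD : MeasurableSet D) (hD0 : volume D ≠ 0) (hDt : volume D ≠ ∞) :
    ∫⁻ v, fiberNorm a (fun x => ‖fiberOsc f D x‖ₑ) v ≤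
      2 * ∫⁻ v in D, fiberNorm a (fun x => ‖f x‖ₑ) v := by
  have hFm : Measurable (fiberNorm a fun x => ‖f x‖ₑ) := measurable_fiberNorm a hf.enorm
  have hpt : ∀ v, fiberNorm a (fun x => ‖fiberOsc f D x‖ₑ) v ≤ D.indicator (fun v =>
      fiberNorm a (fun x => ‖f x‖ₑ) v + iteratedNorm j a (fun u => ‖fiberAvg f D u‖ₑ)) v := by
    intro v
    by_cases hv : v ∈ D
    · rw [Set.indicator_of_mem hv]
      refine le_trans (iteratedNorm.mono fun u => ?_) (iteratedNorm.add_le ha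
        (hf.comp (measurable_glue_left v)).enorm (measurable_fiberAvg (D := D) hf).enorm)
      have : fiberOsc f D (glue u v) = f (glue u v) - fiberAvg f D u := by
        rw [fiberOsc, Set.indicator_of_mem (by simpa using hv), blockFst_glue]
      simp only [this]
      exact enorm_sub_le
    · rw [Set.indicator_of_notMem hv]
      have : ∀ u, fiberOsc f D (glue u v) = 0 := fun u => by
        rw [fiberOsc, Set.indicator_of_notMem (by simpa using hv)]
      simp only [fiberNorm, this, enorm_zero]
      rw [iteratedNorm_zero]
  refine (lintegral_mono hpt).trans ?_
  rw [lintegral_indicator hD, lintegral_add_left hFm, setLIntegral_const, two_mul]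
  exact add_le_add le_rfl (iteratedNorm_fiberAvg_mul_le ha hf hD0 hDt)

end oscillation

namespace IsTest

variable {n : ℕ}

theorem toLp_congr {f g : (Fin n → ℝ) → ℂ} (hf : IsTest f) (hg : IsTest g) (h : f = g) :
    hf.toLp = hg.toLp := by
  subst h
  rfl

theorem toLp_add {f g : (Fin n → ℝ) → ℂ} (hf : IsTest f) (hg : IsTest g) :
    (hf.add hg).toLp = hf.toLp + hg.toLp := rfl

theorem toLp_sum {ι : Type*} (s : Finset ι) {F : ι → (Fin n → ℝ) → ℂ} (hF : ∀ i, IsTest (F i)) :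
    (IsTest.sum s fun i _ => hF i).toLp = ∑ i ∈ s, (hF i).toLp := by
  classical
  induction s using Finset.induction_on with
  | empty =>
    rw [Finset.sum_empty]
    refine (toLp_congr _ IsTest.zero (by simp)).trans ?_
    exact MemLp.toLp_zero _
  | insert i s hi ih =>
    rw [Finset.sum_insert hi, ← ih, ← toLp_add]
    exact toLp_congr _ _ (by simp [Finset.sum_insert hi])

end IsTest

theorem coeFn_sum_Lp {n : ℕ} {ι : Type*} (s : Finset ι)
    (F : ι → Lp ℂ 2 (volume : Measure (Fin n → ℝ))) :
    (∑ i ∈ s, F i : Lp ℂ 2 (volume : Measure (Fin n → ℝ))) =ᵐ[volume] fun x => ∑ i ∈ s, F i x := by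
  classical
  induction s using Finset.induction_on with
  | empty =>
    simp only [Finset.sum_empty]
    exact Lp.coeFn_zero _ _ _
  | insert i s hi ih =>
    simp only [Finset.sum_insert hi]
    filter_upwards [Lp.coeFn_add (F i) (∑ i ∈ s, F i), ih] with x h1 h2
    rw [h1, Pi.add_apply, h2]

/-! ### Calderón–Zygmund decomposition and the weak-type inequality. -/

section weak

variable {j m : ℕ} {a a' : Fin j → ℝ≥0∞}
  {K : (Fin (m + j) → ℝ) → (Fin (m + j) → ℝ) → ℂ}
  {T : Lp ℂ 2 (volume : Measure (Fin (m + j) → ℝ)) →L[ℂ]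
    Lp ℂ 2 (volume : Measure (Fin (m + j) → ℝ))}

/-- The total measure of stopping cubes is controlled by the large values of the function. -/
theorem sum_measure_le_of_average {ι V : Type*} [MeasurableSpace V] {μ : Measure V}
    (s : Finset ι) {D : ι → Set V} (hD : ∀ i ∈ s, MeasurableSet (D i))
    (hDt : ∀ i ∈ s, μ (D i) ≠ ∞) (hdisj : ∀ i ∈ s, ∀ k ∈ s, i ≠ k → Disjoint (D i) (D k))
    {F : V → ℝ≥0∞} (hF : Measurable F) {t : ℝ} (ht : 0 < t)
    (hle : ∀ i ∈ s, ENNReal.ofReal t * μ (D i) ≤ ∫⁻ v in D i, F v ∂μ) :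
    ∑ i ∈ s, μ (D i) ≤ 2 * (ENNReal.ofReal (t ^ (-1 : ℝ)) *
      ∫⁻ v in {v | ENNReal.ofReal (t / 2) < F v}, F v ∂μ) := by
  set W := ∑ i ∈ s, μ (D i) with hW
  have hWt : W ≠ ∞ := ENNReal.sum_ne_top.2 hDt
  set E : Set V := {v | ENNReal.ofReal (t / 2) < F v} with hE
  have hEm : MeasurableSet E := measurableSet_lt measurable_const hF
  -- Values of `F` up to `t / 2` contribute at most `t / 2` times the measure, which is half of the
  -- left side and is absorbed, as the total measure `W` is finite.
  have hsum : ∀ i ∈ s, ENNReal.ofReal t * μ (D i) ≤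
      ∫⁻ v in D i, E.indicator F v ∂μ + ENNReal.ofReal (t / 2) * μ (D i) := fun i hi => by
    refine (hle i hi).trans ?_
    rw [← setLIntegral_const, ← lintegral_add_left (hF.indicator hEm)]
    refine lintegral_mono fun v => ?_
    by_cases hv : v ∈ E
    · rw [Set.indicator_of_mem hv]
      exact le_self_add
    · rw [Set.indicator_of_notMem hv, zero_add]
      exact not_lt.1 hv
  have h1 : ENNReal.ofReal t * W ≤ ∫⁻ v in E, F v ∂μ + ENNReal.ofReal (t / 2) * W := by
    rw [hW, Finset.mul_sum, Finset.mul_sum]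
    refine (Finset.sum_le_sum hsum).trans ?_
    rw [Finset.sum_add_distrib]
    refine add_le_add ?_ le_rfl
    rw [← lintegral_biUnion_finset (fun i hi k hk hik => hdisj i hi k hk hik) hD,
      ← lintegral_indicator hEm]
    exact setLIntegral_le_lintegral _ _
  have h2 : ENNReal.ofReal t * W = ENNReal.ofReal (t / 2) * W + ENNReal.ofReal (t / 2) * W := by
    rw [← add_mul, ← ENNReal.ofReal_add (by positivity) (by positivity), add_halves]
  rw [h2] at h1
  have h3 := (ENNReal.add_le_add_iff_right (ENNReal.mul_ne_top ENNReal.ofReal_ne_top hWt)).1 h1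
  calc W = 2 * (ENNReal.ofReal (t ^ (-1 : ℝ)) * (ENNReal.ofReal (t / 2) * W)) := by
        rw [← mul_assoc (ENNReal.ofReal _), ← ENNReal.ofReal_mul (by positivity), ← mul_assoc,
          ← ENNReal.ofReal_ofNat 2, ← ENNReal.ofReal_mul (by positivity), Real.rpow_neg_one]
        have : 2 * (t⁻¹ * (t / 2)) = 1 := by field_simp
        rw [this]
        simp
    _ ≤ _ := by gcongr

/-- The Calderón–Zygmund decomposition at height `t`. -/
theorem exists_calderonZygmund_decomposition (hm : 0 < m) (ha : ConjExps a a')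
    {f : (Fin (m + j) → ℝ) → ℂ} (hf : IsTest f) {δ : ℝ} (hδ : 0 < δ) (hstep : IsStep δ f)
    {t : ℝ} (ht : 0 < t) {P : ℝ} (hP : 0 < P) :
    ∃ (𝒬 : Finset (ℕ × (Fin m → ℤ))) (g : (Fin (m + j) → ℝ) → ℂ),
      IsTest g ∧ (∀ x, f x = g x + ∑ Q ∈ 𝒬, fiberOsc f (dyadicCube δ Q) x) ∧
      (∑ Q ∈ 𝒬, volume (dyadicCube δ Q) ≤ 2 * (ENNReal.ofReal (t ^ (-1 : ℝ)) *
        ∫⁻ v in {v | ENNReal.ofReal (t / 2) < fiberNorm a (fun x => ‖f x‖ₑ) v},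
          fiberNorm a (fun x => ‖f x‖ₑ) v)) ∧
      (∀ Q ∈ 𝒬, ∫⁻ v, fiberNorm a (fun x => ‖fiberOsc f (dyadicCube δ Q) x‖ₑ) v ≤
        2 * (2 ^ m * ENNReal.ofReal t * volume (dyadicCube δ Q))) ∧
      ∫⁻ v, fiberNorm a (fun x => ‖g x‖ₑ) v ^ P ≤
        (∫⁻ v in {v | fiberNorm a (fun x => ‖f x‖ₑ) v ≤ ENNReal.ofReal t},
          fiberNorm a (fun x => ‖f x‖ₑ) v ^ P) +
        (2 ^ m * ENNReal.ofReal t) ^ P * ∑ Q ∈ 𝒬, volume (dyadicCube δ Q) := by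
  set F := fiberNorm a (fun x => ‖f x‖ₑ) with hF
  have hFm : Measurable F := measurable_fiberNorm a hf.measurable.enorm
  obtain ⟨M, hM⟩ := hf.bounded
  obtain ⟨R, hR0, hR⟩ := hf.exists_radius
  -- The fibre norm of a step function is again constant on the finest cubes, since `glue u v` and
  -- `glue u w` lie in one grid cube for every `u`.
  have hFstep : ∀ v w, dyadicIndex δ 0 v = dyadicIndex δ 0 w → F v = F w := fun v w hvw => by
    have h1 : ∀ u : Fin j → ℝ, f (glue u v) = f (glue u w) := fun u => by
      refine hstep _ _ fun i => ?_
      simp only [glue]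
      split_ifs
      · rfl
      · have := congrFun hvw ⟨i - j, by omega⟩
        simpa [dyadicIndex] using this
    simp only [hF, fiberNorm, h1]
  have hFR : ∀ v, F v ≠ 0 → ‖v‖ ≤ R := fun v hv => by
    by_contra hcon
    refine hv ?_
    have : ∀ u : Fin j → ℝ, f (glue u v) = 0 := fun u => by
      by_contra h
      exact hcon ((norm_le_norm_glue u v).trans (hR _ h))
    simp only [hF, fiberNorm, this, enorm_zero]
    exact iteratedNorm_zero _ _
  have hFint : ∫⁻ v, F v ≠ ∞ := by
    have h1 : IsTest fun u : Fin j → ℝ =>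
        (Metric.closedBall (0 : Fin j → ℝ) R).indicator (fun _ => ((M : ℝ) : ℂ)) u := by
      refine IsTest.of_bound (measurable_const.indicator
        Metric.isClosed_closedBall.measurableSet) M (fun x => ?_) R fun x hx => ?_
      · refine (norm_indicator_le_norm_self _ _).trans ?_
        simp
      · simpa using Set.mem_of_indicator_ne_zero hx
    have h2 := h1.iteratedNorm_lt_top a
    have h3 : ∀ v, F v ≤ (Metric.closedBall (0 : Fin m → ℝ) R).indicator (fun _ =>
        iteratedNorm j a fun u => ‖(Metric.closedBall (0 : Fin j → ℝ) R).indicator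
          (fun _ => ((M : ℝ) : ℂ)) u‖ₑ) v := fun v => by
      by_cases hv : v ∈ Metric.closedBall (0 : Fin m → ℝ) R
      · rw [Set.indicator_of_mem hv]
        refine iteratedNorm.mono fun u => ?_
        by_cases hu : u ∈ Metric.closedBall (0 : Fin j → ℝ) R
        · rw [Set.indicator_of_mem hu, enorm_le_iff_norm_le]
          simpa using hM _
        · have : f (glue u v) = 0 := by
            by_contra h
            exact hu (mem_closedBall_zero_iff.2 ((norm_le_norm_glue_left u v).trans (hR _ h)))
          simp [this]
      · rw [Set.indicator_of_notMem hv, nonpos_iff_eq_zero]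
        by_contra h
        exact hv (mem_closedBall_zero_iff.2 (hFR v h))
    refine ((lintegral_mono h3).trans_lt ?_).ne
    rw [lintegral_indicator_const Metric.isClosed_closedBall.measurableSet]
    exact ENNReal.mul_lt_top h2 measure_closedBall_lt_top
  have ht0 : ENNReal.ofReal t ≠ 0 := by
    rw [Ne, ENNReal.ofReal_eq_zero, not_le]
    exact ht
  obtain ⟨𝒬, hdisj, hoff, hQ⟩ := exists_stopping_cubes hm hδ hFstep hFR hFint ht0
  have hvol0 : ∀ Q : ℕ × (Fin m → ℤ), volume (dyadicCube δ Q) ≠ 0 := fun Q => by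
    rw [volume_dyadicCube hδ]
    exact pow_ne_zero _ (by rw [Ne, ENNReal.ofReal_eq_zero, not_le]; positivity)
  have hvolt : ∀ Q : ℕ × (Fin m → ℤ), volume (dyadicCube δ Q) ≠ ∞ := fun Q => by
    rw [volume_dyadicCube hδ]
    exact ENNReal.pow_ne_top ENNReal.ofReal_ne_top
  have hQm : ∀ Q : ℕ × (Fin m → ℤ), MeasurableSet (dyadicCube δ Q) :=
    measurableSet_dyadicCube hδ
  have hQb : ∀ Q : ℕ × (Fin m → ℤ), Bornology.IsBounded (dyadicCube δ Q) := fun Q =>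
    Metric.isBounded_closedBall.subset fun v hv =>
      mem_closedBall_iff_norm.2 (norm_sub_dyadicCorner_le hδ hv)
  have hosc : ∀ Q : ℕ × (Fin m → ℤ), IsTest (fiberOsc f (dyadicCube δ Q)) := fun Q =>
    hf.fiberOsc (hQm Q) (hQb Q) (hvol0 Q)
  refine ⟨𝒬, fun x => f x - ∑ Q ∈ 𝒬, fiberOsc f (dyadicCube δ Q) x,
    hf.sub (IsTest.sum 𝒬 fun Q _ => hosc Q), fun x => (sub_add_cancel _ _).symm,
    sum_measure_le_of_average 𝒬 (fun Q _ => hQm Q) (fun Q _ => hvolt Q) hdisj hFm ht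
      fun Q hQ' => (hQ Q hQ').1,
    fun Q hQ' => (lintegral_fiberNorm_fiberOsc_le ha hf.measurable (hQm Q) (hvol0 Q)
      (hvolt Q)).trans (mul_le_mul_right (hQ Q hQ').2 _), ?_⟩
  set G := fiberNorm a fun x => ‖f x - ∑ Q ∈ 𝒬, fiberOsc f (dyadicCube δ Q) x‖ₑ with hG
  -- Over a stopping cube the good part is the average of `f`, of norm at most `2 ^ m * t`;
  -- elsewhere it is `f` itself, with fibre norm at most `t`.
  have hpt : ∀ v, G v ^ P ≤ {v | F v ≤ ENNReal.ofReal t}.indicator (fun v => F v ^ P) v +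
      ∑ Q ∈ 𝒬, (dyadicCube δ Q).indicator (fun _ => (2 ^ m * ENNReal.ofReal t) ^ P) v := by
    intro v
    by_cases hv : ∃ Q ∈ 𝒬, v ∈ dyadicCube δ Q
    · obtain ⟨Q, hQ', hvQ⟩ := hv
      refine le_trans ?_ le_add_self
      refine le_trans ?_ (Finset.single_le_sum (f := fun Q => (dyadicCube δ Q).indicator
        (fun _ => (2 ^ m * ENNReal.ofReal t) ^ P) v) (fun _ _ => zero_le) hQ')
      rw [Set.indicator_of_mem hvQ]
      refine ENNReal.rpow_le_rpow ?_ hP.le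
      have h1 : ∀ u : Fin j → ℝ, f (glue u v) - ∑ Q ∈ 𝒬, fiberOsc f (dyadicCube δ Q) (glue u v)
          = fiberAvg f (dyadicCube δ Q) u := fun u => by
        rw [Finset.sum_eq_single_of_mem Q hQ' fun Q' hQ'' hne => by
          rw [fiberOsc, Set.indicator_of_notMem]
          intro hmem
          rw [Set.mem_preimage, blockSnd_glue] at hmem
          exact Set.disjoint_left.1 (hdisj Q' hQ'' Q hQ' hne) hmem hvQ]
        rw [fiberOsc, Set.indicator_of_mem (by simpa using hvQ), blockFst_glue, sub_sub_cancel]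
      simp only [hG, fiberNorm, h1]
      have h2 := (iteratedNorm_fiberAvg_mul_le ha hf.measurable (hvol0 Q) (hvolt Q)).trans
        (hQ Q hQ').2
      exact (ENNReal.mul_le_mul_iff_left (hvol0 Q) (hvolt Q)).1 h2
    · push Not at hv
      refine le_trans ?_ le_self_add
      have hmem : v ∈ {v | F v ≤ ENNReal.ofReal t} := hoff v hv
      rw [Set.indicator_of_mem hmem]
      have h1 : ∀ u : Fin j → ℝ,
          f (glue u v) - ∑ Q ∈ 𝒬, fiberOsc f (dyadicCube δ Q) (glue u v) = f (glue u v) :=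
        fun u => by
        rw [Finset.sum_eq_zero, sub_zero]
        intro Q hQ'
        rw [fiberOsc, Set.indicator_of_notMem]
        intro hmem
        rw [Set.mem_preimage, blockSnd_glue] at hmem
        exact hv Q hQ' hmem
      simp only [hG, hF, fiberNorm, h1]
      exact le_rfl
  refine (lintegral_mono hpt).trans_eq ?_
  have hset : MeasurableSet {v | F v ≤ ENNReal.ofReal t} := measurableSet_le hFm measurable_const
  rw [lintegral_add_left ((hFm.pow_const P).indicator hset), lintegral_indicator hset,
    lintegral_finsetSum _ fun Q _ => measurable_const.indicator (hQm Q), Finset.mul_sum]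
  congr 1
  exact Finset.sum_congr rfl fun Q _ => lintegral_indicator_const (hQm Q) _

/-- The weak-type inequality for vector-valued singular integrals. -/
theorem IsCZ.weak_type (hm : 0 < m) (ha : ConjExps a a') {p : ℝ≥0∞} (h0 : p ≠ 0) (htop : p ≠ ∞)
    (h : IsCZ K T) {C : ℝ≥0} (hC : ∀ (f : (Fin (m + j) → ℝ) → ℂ) (hf : IsTest f),
      iteratedNorm (m + j) (glue a fun _ => p) (fun x => ‖T hf.toLp x‖ₑ) ≤
        C * iteratedNorm (m + j) (glue a fun _ => p) (fun x => ‖f x‖ₑ)) :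
    ∃ C₁ C₂ : ℝ≥0, ∀ (f : (Fin (m + j) → ℝ) → ℂ) (hf : IsTest f), (∃ δ > 0, IsStep δ f) →
      ∀ t : ℝ, 0 < t →
        volume {v | ENNReal.ofReal (2 * t) < fiberNorm a (fun x => ‖T hf.toLp x‖ₑ) v} ≤
        C₁ * (ENNReal.ofReal (t ^ (-p.toReal)) *
          ∫⁻ v in {v | fiberNorm a (fun x => ‖f x‖ₑ) v ≤ ENNReal.ofReal t},
            fiberNorm a (fun x => ‖f x‖ₑ) v ^ p.toReal) +
        C₂ * (ENNReal.ofReal (t ^ (-1 : ℝ)) *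
          ∫⁻ v in {v | ENNReal.ofReal (t / 2) < fiberNorm a (fun x => ‖f x‖ₑ) v},
            fiberNorm a (fun x => ‖f x‖ₑ) v) := by
  obtain ⟨A, B, hA, hB⟩ := h.lintegral_fiberNorm_le_of_mean_zero ha
  set P := p.toReal with hPdef
  have hP : 0 < P := ENNReal.toReal_pos h0 htop
  -- In `C₂` the summands come from the good part on the cubes, from the volume of the enlarged
  -- cubes, and from the bad parts away from them. The last factor `2` bounds the total volume of
  -- the cubes.
  refine ⟨C ^ P, (C ^ P * (2 ^ m) ^ P + Real.toNNReal (2 * A) ^ m + B * (2 * 2 ^ m)) * 2,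
    fun f hf hstep t ht => ?_⟩
  obtain ⟨δ, hδ, hstep⟩ := hstep
  obtain ⟨𝒬, g, hg, hfg, hW, hbad, hgood⟩ :=
    exists_calderonZygmund_decomposition hm ha hf hδ hstep ht hP
  set F := fiberNorm a (fun x => ‖f x‖ₑ) with hF
  set W := ∑ Q ∈ 𝒬, volume (dyadicCube δ Q) with hWdef
  set τ := ENNReal.ofReal t with hτ
  have hτ0 : τ ≠ 0 := by
    rw [hτ, Ne, ENNReal.ofReal_eq_zero, not_le]
    exact ht
  have hτt : τ ≠ ∞ := ENNReal.ofReal_ne_top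
  have hvol0 : ∀ Q : ℕ × (Fin m → ℤ), volume (dyadicCube δ Q) ≠ 0 := fun Q => by
    rw [volume_dyadicCube hδ]
    exact pow_ne_zero _ (by rw [Ne, ENNReal.ofReal_eq_zero, not_le]; positivity)
  have hvolt : ∀ Q : ℕ × (Fin m → ℤ), volume (dyadicCube δ Q) ≠ ∞ := fun Q => by
    rw [volume_dyadicCube hδ]
    exact ENNReal.pow_ne_top ENNReal.ofReal_ne_top
  have hQb : ∀ Q : ℕ × (Fin m → ℤ), Bornology.IsBounded (dyadicCube δ Q) := fun Q =>
    Metric.isBounded_closedBall.subset fun v hv =>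
      mem_closedBall_iff_norm.2 (norm_sub_dyadicCorner_le hδ hv)
  have hosc : ∀ Q : ℕ × (Fin m → ℤ), IsTest (fiberOsc f (dyadicCube δ Q)) := fun Q =>
    hf.fiberOsc (measurableSet_dyadicCube hδ Q) (hQb Q) (hvol0 Q)
  have hmeas : ∀ f : Lp ℂ 2 (volume : Measure (Fin (m + j) → ℝ)),
      Measurable fun x => ‖f x‖ₑ := fun f => (Lp.stronglyMeasurable f).measurable.enorm
  set G := fiberNorm a (fun x => ‖T hg.toLp x‖ₑ) with hG
  have hGm : Measurable G := measurable_fiberNorm a (hmeas _)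
  set b : ℕ × (Fin m → ℤ) → (Fin m → ℝ) → ℝ≥0∞ :=
    fun Q => fiberNorm a (fun x => ‖T (hosc Q).toLp x‖ₑ) with hb
  have hbm : ∀ Q, Measurable (b Q) := fun Q => measurable_fiberNorm a (hmeas _)
  have hTf : T hf.toLp = T hg.toLp + ∑ Q ∈ 𝒬, T (hosc Q).toLp := by
    rw [← map_sum, ← map_add, ← IsTest.toLp_sum 𝒬 hosc, ← IsTest.toLp_add]
    exact congrArg _ (IsTest.toLp_congr _ _ (funext hfg))
  have hsplit : ∀ᵐ v, fiberNorm a (fun x => ‖T hf.toLp x‖ₑ) v ≤ G v + ∑ Q ∈ 𝒬, b Q v := by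
    have h1 : ∀ᵐ x, ‖T hf.toLp x‖ₑ ≤ ‖T hg.toLp x‖ₑ + ∑ Q ∈ 𝒬, ‖T (hosc Q).toLp x‖ₑ := by
      rw [hTf]
      filter_upwards [Lp.coeFn_add (T hg.toLp) (∑ Q ∈ 𝒬, T (hosc Q).toLp),
        coeFn_sum_Lp 𝒬 fun Q => T (hosc Q).toLp] with x h1 h2
      rw [h1, Pi.add_apply, h2]
      exact (enorm_add_le _ _).trans (add_le_add le_rfl (enorm_sum_le _ _))
    filter_upwards [ae_glue h1] with v hv
    refine (iteratedNorm.mono_ae hv).trans ?_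
    refine (iteratedNorm.add_le ha ((hmeas _).comp (measurable_glue_left v))
      (Finset.measurable_fun_sum 𝒬 fun Q _ => (hmeas _).comp (measurable_glue_left v))).trans ?_
    exact add_le_add le_rfl (iteratedNorm.sum_le ha 𝒬
      (G := fun Q u => ‖T (hosc Q).toLp (glue u v)‖ₑ)
      fun Q => (hmeas _).comp (measurable_glue_left v))
  -- A cube lies in the ball about its corner with radius its side, so dilating that ball by `A`
  -- reaches the region of the mean-zero estimate.
  set D : ℕ × (Fin m → ℤ) → Set (Fin m → ℝ) := fun Q =>
    Metric.closedBall (dyadicCorner δ Q) (A * (δ * 2 ^ Q.1)) with hD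
  have hDm : ∀ Q, MeasurableSet (D Q) := fun Q => Metric.isClosed_closedBall.measurableSet
  have hDvol : ∀ Q, volume (D Q) = ((Real.toNNReal (2 * A) ^ m : ℝ≥0) : ℝ≥0∞) *
      volume (dyadicCube δ Q) := fun Q => by
    rw [hD, Real.volume_pi_closedBall _ (by positivity), volume_dyadicCube hδ, Fintype.card_fin,
      ENNReal.ofReal_pow (by positivity), ← mul_assoc, ENNReal.ofReal_mul (by positivity), mul_pow]
    rfl
  set S : Set (Fin m → ℝ) := (⋃ Q ∈ 𝒬, D Q)ᶜ with hS
  have hSm : MeasurableSet S := (Finset.measurableSet_biUnion 𝒬 fun Q _ => hDm Q).compl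
  have hgoodT : volume {v | τ ≤ G v} ≤ ENNReal.ofReal (t ^ (-P)) *
      ((C ^ P : ℝ≥0) * ((∫⁻ v in {v | F v ≤ τ}, F v ^ P) + (2 ^ m * τ) ^ P * W)) := by
    have h1 := hC g hg
    rw [iteratedNorm_glue_const a h0 htop (hmeas _),
      iteratedNorm_glue_const a h0 htop hg.measurable.enorm] at h1
    have h2 := ENNReal.rpow_le_rpow h1 hP.le
    rw [ENNReal.mul_rpow_of_nonneg _ _ hP.le, ← ENNReal.rpow_mul, ← ENNReal.rpow_mul,
      one_div_mul_cancel hP.ne', ENNReal.rpow_one, ENNReal.rpow_one,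
      ← ENNReal.coe_rpow_of_nonneg _ hP.le] at h2
    have h3 := mul_meas_ge_le_lintegral (μ := volume) (hGm.pow_const P) (τ ^ P)
    have h4 : {v | τ ^ P ≤ G v ^ P} = {v | τ ≤ G v} := by
      ext v
      exact ENNReal.rpow_le_rpow_iff hP
    rw [h4] at h3
    have h5 : ENNReal.ofReal (t ^ (-P)) * τ ^ P = 1 := by
      rw [hτ, ENNReal.ofReal_rpow_of_pos ht, ← ENNReal.ofReal_mul (by positivity),
        ← Real.rpow_add ht]
      simp
    calc volume {v | τ ≤ G v} = ENNReal.ofReal (t ^ (-P)) * (τ ^ P * volume {v | τ ≤ G v}) := by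
          rw [← mul_assoc, h5, one_mul]
      _ ≤ _ := mul_le_mul_right (h3.trans (h2.trans (mul_le_mul_right hgood _))) _
  have hbadT : volume (S ∩ {v | τ ≤ ∑ Q ∈ 𝒬, b Q v}) ≤ (B * (2 * 2 ^ m) : ℝ≥0) * W := by
    have h1 := mul_meas_ge_le_lintegral (μ := volume.restrict S)
      (Finset.measurable_fun_sum 𝒬 fun Q _ => hbm Q) τ
    rw [Measure.restrict_apply' hSm, Set.inter_comm] at h1
    have h2 : ∫⁻ v in S, ∑ Q ∈ 𝒬, b Q v ≤ τ * ((B * (2 * 2 ^ m) : ℝ≥0) * W) := by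
      rw [lintegral_finsetSum _ fun Q _ => hbm Q, hWdef, Finset.mul_sum, Finset.mul_sum]
      refine Finset.sum_le_sum fun Q hQ => ?_
      have hsub : S ⊆ {v | A * (δ * 2 ^ Q.1) < ‖v - dyadicCorner δ Q‖} := fun v hv => by
        by_contra hcon
        refine hv (Set.mem_biUnion hQ ?_)
        exact mem_closedBall_iff_norm.2 (not_lt.1 hcon)
      refine (lintegral_mono_set hsub).trans ((hB _ (hosc Q) (dyadicCorner δ Q) (δ * 2 ^ Q.1)
        (by positivity) (fun x hx => ?_) fun u => integral_fiberOsc hf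
          (measurableSet_dyadicCube hδ Q) (hvol0 Q) (hvolt Q) u).trans ?_)
      · exact norm_sub_dyadicCorner_le hδ (Set.mem_of_indicator_ne_zero
          (s := blockSnd ⁻¹' dyadicCube δ Q) hx)
      · refine (mul_le_mul_right (hbad Q hQ) _).trans_eq ?_
        push_cast
        ring
    exact (ENNReal.mul_le_mul_iff_right hτ0 hτt).1 (h1.trans h2)
  -- The height `2 * t` is shared: off the enlarged cubes, either the good or the bad contribution
  -- reaches `t`.
  have hcover : volume {v | ENNReal.ofReal (2 * t) < fiberNorm a (fun x => ‖T hf.toLp x‖ₑ) v} ≤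
      volume {v | τ ≤ G v} + (volume (⋃ Q ∈ 𝒬, D Q) +
        volume (S ∩ {v | τ ≤ ∑ Q ∈ 𝒬, b Q v})) := by
    refine (measure_mono_ae (t := {v | τ ≤ G v} ∪ ((⋃ Q ∈ 𝒬, D Q) ∪
      (S ∩ {v | τ ≤ ∑ Q ∈ 𝒬, b Q v}))) ?_).trans
      ((measure_union_le _ _).trans (add_le_add le_rfl (measure_union_le _ _)))
    filter_upwards [hsplit] with v hv hv2
    have hv2 : ENNReal.ofReal (2 * t) < fiberNorm a (fun x => ‖T hf.toLp x‖ₑ) v := hv2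
    by_contra hcon
    have hcon : v ∉ {v | τ ≤ G v} ∪ ((⋃ Q ∈ 𝒬, D Q) ∪ (S ∩ {v | τ ≤ ∑ Q ∈ 𝒬, b Q v})) := hcon
    rw [Set.mem_union, Set.mem_union, not_or, not_or] at hcon
    obtain ⟨c1, c2, c3⟩ := hcon
    have c3' : ¬ τ ≤ ∑ Q ∈ 𝒬, b Q v := fun hh => c3 ⟨c2, hh⟩
    have c1' : ¬ τ ≤ G v := c1
    have : G v + ∑ Q ∈ 𝒬, b Q v < ENNReal.ofReal (2 * t) := by
      rw [two_mul, ENNReal.ofReal_add ht.le ht.le]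
      exact ENNReal.add_lt_add (not_le.1 c1') (not_le.1 c3')
    exact absurd (hv2.trans_le hv) this.not_gt
  have hunion : volume (⋃ Q ∈ 𝒬, D Q) ≤ ((Real.toNNReal (2 * A) ^ m : ℝ≥0) : ℝ≥0∞) * W := by
    refine (measure_biUnion_finset_le 𝒬 D).trans ?_
    rw [hWdef, Finset.mul_sum]
    exact Finset.sum_le_sum fun Q _ => (hDvol Q).le
  refine hcover.trans ((add_le_add hgoodT (add_le_add hunion hbadT)).trans ?_)
  have h6 : ENNReal.ofReal (t ^ (-P)) * (2 ^ m * τ) ^ P = ((2 ^ m : ℝ≥0) ^ P : ℝ≥0) := by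
    rw [ENNReal.mul_rpow_of_nonneg _ _ hP.le, hτ, ENNReal.ofReal_rpow_of_pos ht, mul_left_comm,
      ← ENNReal.ofReal_mul (by positivity), ← Real.rpow_add ht, neg_add_cancel, Real.rpow_zero,
      ENNReal.ofReal_one, mul_one, ENNReal.coe_rpow_of_nonneg _ hP.le]
    simp
  calc _ = (C ^ P : ℝ≥0) * (ENNReal.ofReal (t ^ (-P)) * ∫⁻ v in {v | F v ≤ τ}, F v ^ P) +
        ((C ^ P : ℝ≥0) * (ENNReal.ofReal (t ^ (-P)) * (2 ^ m * τ) ^ P) +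
          (Real.toNNReal (2 * A) ^ m : ℝ≥0) + (B * (2 * 2 ^ m) : ℝ≥0)) * W := by ring
    _ ≤ _ := by
        rw [h6]
        refine add_le_add le_rfl ((mul_le_mul_right hW _).trans_eq ?_)
        push_cast
        ring

end weak

/-! ### From `L²` to arbitrary exponents. -/

theorem CZBounded.two {n : ℕ} : CZBounded (fun _ : Fin n => (2 : ℝ≥0∞)) := fun K T _ => by
  refine ⟨‖T‖₊, fun f hf => ?_⟩
  have h1 : ∀ g : Lp ℂ 2 (volume : Measure (Fin n → ℝ)),
      iteratedNorm n (fun _ => 2) (fun x => ‖g x‖ₑ) = ‖g‖ₑ := fun g => by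
    rw [← eLpNorm_two_eq (Lp.stronglyMeasurable g).measurable, Lp.enorm_def]
  have h2 : iteratedNorm n (fun _ => 2) (fun x => ‖f x‖ₑ) = ‖hf.toLp‖ₑ := by
    rw [← h1]
    exact iteratedNorm.congr_ae (hf.coeFn_toLp.mono fun x hx => by rw [hx])
  rw [h1, h2]
  exact T.le_opENorm _

section extrapolation

variable {j m : ℕ} {a a' : Fin j → ℝ≥0∞} {p r : ℝ≥0∞}

theorem ConjExps.exists_const (hr : 1 < r) (hr' : r < ∞) :
    ∃ r', 1 < r' ∧ r' < ∞ ∧ ConjExps (fun _ : Fin m => r) (fun _ => r') := by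
  obtain ⟨q, hq⟩ := ConjExps.exists_conj (p := fun _ : Fin 1 => r) fun _ => ⟨hr, hr'⟩
  have h1 := hq.symm.one_lt 0
  exact ⟨q 0, h1, (hq.symm.ne_top 0).lt_top, fun _ => hq 0⟩

theorem fiberNorm_lt_top {f : (Fin (m + j) → ℝ) → ℂ} (hf : IsTest f) (a : Fin j → ℝ≥0∞)
    (v : Fin m → ℝ) : fiberNorm a (fun x => ‖f x‖ₑ) v < ∞ := by
  obtain ⟨M, hM⟩ := hf.bounded
  obtain ⟨R, -, hR⟩ := hf.exists_radius
  refine iteratedNorm.lt_top_of_bounded a (M := M) (R := R) (fun u => ?_) fun u hu i => ?_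
  · exact enorm_le_coe.2 (hM _)
  · exact (norm_le_pi_norm u i).trans
      ((norm_le_norm_glue_left u v).trans (hR _ (enorm_ne_zero.1 hu)))

/-- Singular integrals extrapolate downwards in the exponent of the outer variables. -/
theorem CZBounded.of_lt (hm : 0 < m) (ha : ConjExps a a') (hr : 1 < r) (hrp : r < p)
    (htop : p < ∞) (h : CZBounded (glue a fun _ : Fin m => p)) :
    CZBounded (glue a fun _ : Fin m => r) := fun K T hT => by
  obtain ⟨p', -, -, hp⟩ := ConjExps.exists_const (m := m) (hr.trans hrp) htop
  obtain ⟨r', -, -, hr'⟩ := ConjExps.exists_const (m := m) hr (hrp.trans htop)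
  have h0 : p ≠ 0 := (zero_le.trans_lt hrp).ne'
  have hr0 : r ≠ 0 := (zero_le.trans_lt hr).ne'
  have hrtop : r ≠ ∞ := (hrp.trans htop).ne
  have hR1 : 1 < r.toReal := by
    simpa using (ENNReal.toReal_lt_toReal ENNReal.one_ne_top hrtop).2 hr
  have hR0 : 0 < r.toReal := by linarith
  have hRP : r.toReal < p.toReal := (ENNReal.toReal_lt_toReal hrtop htop.ne).2 hrp
  obtain ⟨C, hC⟩ := h K T hT
  obtain ⟨C₁, C₂, hweak⟩ := hT.weak_type hm ha h0 htop.ne hC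
  obtain ⟨D, hD⟩ := lintegral_rpow_le_of_weak (μ := (volume : Measure (Fin m → ℝ)))
    hR1 hRP C₁ C₂
  -- The weak-type bound is available for step functions only, and density extends the resulting
  -- strong bound.
  refine ⟨D ^ (1 / r.toReal), fun f hf => iteratedNorm_le_of_step (ha.glue hr') T ?_ hf⟩
  intro f hf hstep
  have hTm : Measurable fun x => ‖T hf.toLp x‖ₑ :=
    (Lp.stronglyMeasurable (T hf.toLp)).measurable.enorm
  rw [iteratedNorm_glue_const a hr0 hrtop hTm,
    iteratedNorm_glue_const a hr0 hrtop hf.measurable.enorm,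
    ENNReal.coe_rpow_of_nonneg _ (by positivity),
    ← ENNReal.mul_rpow_of_nonneg _ _ (by positivity)]
  refine ENNReal.rpow_le_rpow (hD _ _ (measurable_fiberNorm a hTm)
    (measurable_fiberNorm a hf.measurable.enorm) ?_ (fiberNorm_lt_top hf a)
    (hweak f hf hstep)) (by positivity)
  -- The known estimate at `p` shows that the fibre norm of `T f` is finite a.e., as the layer-cake
  -- formula requires.
  have h1 := (hC f hf).trans_lt (ENNReal.mul_lt_top ENNReal.coe_lt_top (hf.iteratedNorm_lt_top _))
  rw [iteratedNorm.glue_eq] at h1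
  exact iteratedNorm.ae_lt_top hp (measurable_fiberNorm a hTm) h1

/-- For `r < p` this is downward extrapolation. For `r > p` the conjugate exponents are in the
opposite order, so one dualises, extrapolates downwards and dualises back. -/
theorem CZBounded.change_outer (hm : 0 < m) (ha : ConjExps a a') (hp : 1 < p) (hp' : p < ∞)
    (hr : 1 < r) (hr' : r < ∞) (h : CZBounded (glue a fun _ : Fin m => p)) :
    CZBounded (glue a fun _ : Fin m => r) := by
  rcases lt_trichotomy r p with hlt | rfl | hlt
  · exact h.of_lt hm ha hr hlt hp'
  · exact h
  · obtain ⟨p₁, hp₁, hp₁', hpc⟩ := ConjExps.exists_const (m := m) hp hp'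
    obtain ⟨r₁, hr₁, hr₁', hrc⟩ := ConjExps.exists_const (m := m) hr hr'
    have hP := hpc ⟨0, hm⟩
    have hR := hrc ⟨0, hm⟩
    have hlt' : r₁ < p₁ := by
      rw [← ENNReal.toReal_lt_toReal hr₁'.ne hp₁'.ne]
      have h1 := (ENNReal.toReal_lt_toReal hp'.ne hr'.ne).2 hlt
      have h2 := (inv_lt_inv₀ hR.pos hP.pos).2 h1
      have h3 := hP.inv_add_inv_eq_one
      have h4 := hR.inv_add_inv_eq_one
      exact (inv_lt_inv₀ hP.symm.pos hR.symm.pos).1 (by linarith)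
    exact ((h.dual (ha.glue hpc)).of_lt hm ha.symm hr₁ hlt' hp₁').dual (ha.symm.glue hrc.symm)

end extrapolation

/-- Singular integrals satisfy all mixed norm estimates with exponents in `(1, ∞)`. -/
theorem CZBounded.of_exponents {n : ℕ} {q : Fin n → ℝ≥0∞} (hq : ∀ i, 1 < q i ∧ q i < ∞) :
    CZBounded q := by
  -- Induction on the number `j` of leading exponents that are free, all later ones being equal.
  have key : ∀ j : ℕ, ∀ q : Fin n → ℝ≥0∞, (∀ i, 1 < q i ∧ q i < ∞) →
      (∃ p, ∀ i : Fin n, j ≤ i → q i = p) → CZBounded q := by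
    intro j
    induction j with
    | zero =>
      rintro q hq ⟨p, hp⟩
      obtain rfl : q = fun _ => p := funext fun i => hp i (Nat.zero_le _)
      rcases Nat.eq_zero_or_pos n with rfl | hn
      · rw [Subsingleton.elim (fun _ : Fin 0 => p) fun _ => 2]
        exact CZBounded.two
      · have h1 := hq ⟨0, hn⟩
        have h2 : CZBounded (glue (Fin.elim0 : Fin 0 → ℝ≥0∞) fun _ : Fin n => (2 : ℝ≥0∞)) := by
          rw [glue_zero]
          exact CZBounded.two
        have h3 := h2.change_outer hn (a' := Fin.elim0) (fun i => i.elim0) (by norm_num)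
          (by norm_num) h1.1 h1.2
        rwa [glue_zero] at h3
    | succ j ih =>
      rintro q hq ⟨p, hp⟩
      rcases Nat.lt_or_ge (j + 1) n with hjn | hjn
      · obtain ⟨m, rfl⟩ : ∃ m, n = m + (j + 1) := ⟨n - (j + 1), by omega⟩
        have hm : 0 < m := by omega
        obtain ⟨a, b, rfl⟩ := exists_glue q
        have hb : b = fun _ => p := funext fun i => by
          rw [← glue_eq_right a b i]
          exact hp _ (by simp)
        subst hb
        have ha : ∀ i, 1 < a i ∧ a i < ∞ := fun i => by
          rw [← glue_eq_left a (fun _ : Fin m => p) i]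
          exact hq _
        have hp1 : 1 < p ∧ p < ∞ := by
          have := hq ⟨0 + (j + 1), by omega⟩
          rwa [glue_eq_right a (fun _ : Fin m => p) ⟨0, hm⟩] at this
        obtain ⟨a', haa⟩ := ConjExps.exists_conj ha
        have hs := ha (Fin.last j)
        -- Repeating the last entry of `a` in the outer block gives exponents that are constant from
        -- index `j` on, where the induction hypothesis applies.
        refine CZBounded.change_outer hm haa hs.1 hs.2 hp1.1 hp1.2
          (ih _ (fun i => ?_) ⟨a (Fin.last j), fun i hi => ?_⟩)
        · simp only [glue]
          split_ifs
          · exact ha _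
          · exact hs
        · simp only [glue]
          split_ifs with h
          · congr 1
            ext
            simp
            omega
          · rfl
      -- At most the single index `j` remains, so constancy from `j` on is automatic.
      · refine ih q hq ?_
        rcases Nat.lt_or_ge j n with hj | hj
        · refine ⟨q ⟨j, hj⟩, fun i hi => congrArg q (Fin.ext ?_)⟩
          simp
          omega
        · exact ⟨0, fun i hi => by omega⟩
  exact key n q hq ⟨0, fun i hi => by omega⟩

/-! ### Passage between Euclidean space and sup-norm coordinates. -/

section transfer

variable {n : ℕ}

/-- Pull an `L²` function on Euclidean space back to coordinates. -/
def toCoords (n : ℕ) : Lp ℂ 2 (volume : Measure (EuclideanSpace ℝ (Fin n))) →L[ℂ]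
    Lp ℂ 2 (volume : Measure (Fin n → ℝ)) :=
  (Lp.compMeasurePreservingₗᵢ ℂ _ (PiLp.volume_preserving_toLp (Fin n))).toContinuousLinearMap

/-- Regard an `L²` function of coordinates as a function on Euclidean space. -/
def ofCoords (n : ℕ) : Lp ℂ 2 (volume : Measure (Fin n → ℝ)) →L[ℂ]
    Lp ℂ 2 (volume : Measure (EuclideanSpace ℝ (Fin n))) :=
  (Lp.compMeasurePreservingₗᵢ ℂ _ (PiLp.volume_preserving_ofLp (Fin n))).toContinuousLinearMap

theorem coeFn_toCoords (g : Lp ℂ 2 (volume : Measure (EuclideanSpace ℝ (Fin n)))) :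
    ∀ᵐ x, toCoords n g x = g (WithLp.toLp 2 x) :=
  Lp.coeFn_compMeasurePreserving g (PiLp.volume_preserving_toLp (Fin n))

theorem coeFn_ofCoords (g : Lp ℂ 2 (volume : Measure (Fin n → ℝ))) :
    ∀ᵐ x, ofCoords n g x = g (WithLp.ofLp x) :=
  Lp.coeFn_compMeasurePreserving g (PiLp.volume_preserving_ofLp (Fin n))

theorem ae_toLp {P : EuclideanSpace ℝ (Fin n) → Prop} (h : ∀ᵐ x, P x) :
    ∀ᵐ x : Fin n → ℝ, P (WithLp.toLp 2 x) :=
  (PiLp.volume_preserving_toLp (Fin n)).quasiMeasurePreserving.ae h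

theorem ae_ofLp {P : (Fin n → ℝ) → Prop} (h : ∀ᵐ x, P x) :
    ∀ᵐ x : EuclideanSpace ℝ (Fin n), P (WithLp.ofLp x) :=
  (PiLp.volume_preserving_ofLp (Fin n)).quasiMeasurePreserving.ae h

theorem ofCoords_toCoords (g : Lp ℂ 2 (volume : Measure (EuclideanSpace ℝ (Fin n)))) :
    ofCoords n (toCoords n g) = g := by
  refine Lp.ext ?_
  filter_upwards [coeFn_ofCoords (toCoords n g), ae_ofLp (coeFn_toCoords g)] with x h1 h2
  rw [h1, h2]

theorem exists_norm_toLp_le (n : ℕ) : ∃ B ≥ (1 : ℝ), ∀ x : Fin n → ℝ,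
    ‖(WithLp.toLp 2 x : EuclideanSpace ℝ (Fin n))‖ ≤ B * ‖x‖ := by
  set L := ((EuclideanSpace.equiv (Fin n) ℝ).symm : (Fin n → ℝ) →L[ℝ] EuclideanSpace ℝ (Fin n))
  refine ⟨max 1 ‖L‖, le_max_left _ _, fun x => (L.le_opNorm x).trans ?_⟩
  gcongr
  exact le_max_right _ _

theorem norm_le_norm_toLp (x : Fin n → ℝ) :
    ‖x‖ ≤ ‖(WithLp.toLp 2 x : EuclideanSpace ℝ (Fin n))‖ :=
  (pi_norm_le_iff_of_nonneg (norm_nonneg _)).2 fun i =>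
    PiLp.norm_apply_le (WithLp.toLp 2 x : EuclideanSpace ℝ (Fin n)) i

/-- In coordinates, a singular integral operator has a regular kernel. -/
theorem IsSingularIntegralOperator.isCZ
    {k : EuclideanSpace ℝ (Fin n) → EuclideanSpace ℝ (Fin n) → ℂ}
    {T : Lp ℂ 2 (volume : Measure (EuclideanSpace ℝ (Fin n))) →L[ℂ]
      Lp ℂ 2 (volume : Measure (EuclideanSpace ℝ (Fin n)))}
    (hT : IsSingularIntegralOperator k T) :
    IsCZ (fun x y => k (WithLp.toLp 2 x) (WithLp.toLp 2 y))
      (toCoords n ∘L T ∘L ofCoords n) where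
  regularity := by
    obtain ⟨ε, hε, C, hC, h⟩ := hT.regularity
    obtain ⟨B, hB1, hB⟩ := exists_norm_toLp_le n
    have hB0 : 0 < B := by linarith
    -- The Euclidean norm lies between the sup norm and `B` times it. So `2 * B` ensures Euclidean
    -- separation, and `B ^ ε` is the cost of the numerator.
    refine ⟨ε, hε, C * B ^ ε, by positivity, 2 * B, by linarith, fun x y z hxy hle => ?_⟩
    have hsub : ∀ a b : Fin n → ℝ, (WithLp.toLp 2 a : EuclideanSpace ℝ (Fin n)) - WithLp.toLp 2 b
        = WithLp.toLp 2 (a - b) := fun a b => rfl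
    have h1 := hB (x - z)
    have h2 := norm_le_norm_toLp (x - y)
    have hpos : 0 < ‖x - y‖ := norm_pos_iff.2 (sub_ne_zero.2 hxy)
    refine (h (WithLp.toLp 2 x) (WithLp.toLp 2 y) (WithLp.toLp 2 z)
      (fun he => hxy (WithLp.toLp_injective 2 he)) ?_).trans ?_
    · rw [hsub, hsub]
      nlinarith
    · rw [hsub, hsub, mul_assoc, ← Real.mul_rpow hB0.le (norm_nonneg _)]
      gcongr
  representation := fun f g hf hfc hgf => by
    have h1 := hT.representation (fun x => f (WithLp.ofLp x)) (ofCoords n g)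
      (hf.comp_measurePreserving (PiLp.volume_preserving_ofLp (Fin n)))
      (hfc.comp_homeomorph (PiLp.homeomorph 2 (fun _ : Fin n => ℝ)))
      (by
        filter_upwards [coeFn_ofCoords g, ae_ofLp hgf] with x h1 h2
        rw [h1, h2])
    filter_upwards [ae_toLp h1, coeFn_toCoords (T (ofCoords n g))] with x h1 h2 hx
    rw [ContinuousLinearMap.comp_apply, ContinuousLinearMap.comp_apply, h2, h1]
    · exact ((PiLp.volume_preserving_toLp (Fin n)).integral_comp
        (MeasurableEquiv.toLp 2 (Fin n → ℝ)).measurableEmbedding _).symm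
    · have : tsupport (fun x : EuclideanSpace ℝ (Fin n) => f (WithLp.ofLp x)) =
          (PiLp.homeomorph 2 (fun _ : Fin n => ℝ)) ⁻¹' tsupport f :=
        tsupport_comp_eq_preimage f (PiLp.homeomorph 2 (fun _ : Fin n => ℝ))
      rw [this]
      exact hx

/-- Singular integral operators are bounded for mixed norms on `L²`. -/
theorem IsSingularIntegralOperator.exists_mixedNorm_le {q : Fin n → ℝ≥0∞}
    (hq : ∀ j, 1 < q j ∧ q j < ∞)
    {k : EuclideanSpace ℝ (Fin n) → EuclideanSpace ℝ (Fin n) → ℂ}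
    {T : Lp ℂ 2 (volume : Measure (EuclideanSpace ℝ (Fin n))) →L[ℂ]
      Lp ℂ 2 (volume : Measure (EuclideanSpace ℝ (Fin n)))}
    (hT : IsSingularIntegralOperator k T) :
    ∃ C : ℝ≥0, ∀ g : Lp ℂ 2 (volume : Measure (EuclideanSpace ℝ (Fin n))),
      mixedNorm q g < ∞ → mixedNorm q (T g) ≤ C * mixedNorm q g := by
  obtain ⟨q', hqq⟩ := ConjExps.exists_conj hq
  obtain ⟨C, hC⟩ := CZBounded.of_exponents hq _ _ hT.isCZ
  have hN : ∀ g : Lp ℂ 2 (volume : Measure (EuclideanSpace ℝ (Fin n))),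
      mixedNorm q g = iteratedNorm n q fun x => ‖toCoords n g x‖ₑ := fun g =>
    iteratedNorm.congr_ae ((coeFn_toCoords g).mono fun x hx => by rw [hx])
  refine ⟨C, fun g hg => ?_⟩
  rw [hN] at hg
  have h1 := iteratedNorm_le_of_test hqq _ hC (toCoords n g) hg
  rw [ContinuousLinearMap.comp_apply, ContinuousLinearMap.comp_apply, ofCoords_toCoords] at h1
  rwa [hN, hN]

end transfer

/-! ### The mixed Lebesgue space as a Banach space with `L²` functions dense. -/

section space

variable {n : ℕ} {p q : Fin n → ℝ≥0∞}

theorem mixedNorm_congr_ae {f g : EuclideanSpace ℝ (Fin n) → ℂ} (h : ∀ᵐ x, f x = g x) :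
    mixedNorm p f = mixedNorm p g :=
  iteratedNorm.congr_ae ((ae_toLp h).mono fun x hx => by rw [hx])

theorem measurable_comp_toLp {f : EuclideanSpace ℝ (Fin n) → ℂ} (hf : Measurable f) :
    Measurable fun x : Fin n → ℝ => f (WithLp.toLp 2 x) :=
  hf.comp (PiLp.volume_preserving_toLp (Fin n)).measurable

theorem mixedNorm_add_le (hpq : ConjExps p q) (f g : EuclideanSpace ℝ (Fin n) →ₘ[volume] ℂ) :
    mixedNorm p (f + g : EuclideanSpace ℝ (Fin n) →ₘ[volume] ℂ) ≤
      mixedNorm p f + mixedNorm p g := by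
  rw [mixedNorm_congr_ae (AEEqFun.coeFn_add f g)]
  exact (iteratedNorm.mono fun x => enorm_add_le _ _).trans
    (iteratedNorm.add_le hpq (measurable_comp_toLp f.measurable).enorm
      (measurable_comp_toLp g.measurable).enorm)

theorem mixedNorm_smul_le (c : ℂ) (f : EuclideanSpace ℝ (Fin n) →ₘ[volume] ℂ) :
    mixedNorm p (c • f : EuclideanSpace ℝ (Fin n) →ₘ[volume] ℂ) ≤ ‖c‖ₑ * mixedNorm p f := by
  rw [mixedNorm_congr_ae (AEEqFun.coeFn_smul c f)]
  simp only [mixedNorm, Pi.smul_apply, enorm_smul]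
  exact iteratedNorm.const_mul_le p ‖c‖₊ _

theorem mixedNorm_smul (c : ℂ) (f : EuclideanSpace ℝ (Fin n) →ₘ[volume] ℂ) :
    mixedNorm p (c • f : EuclideanSpace ℝ (Fin n) →ₘ[volume] ℂ) = ‖c‖ₑ * mixedNorm p f := by
  refine le_antisymm (mixedNorm_smul_le c f) ?_
  rcases eq_or_ne c 0 with rfl | hc
  · simp
  · calc ‖c‖ₑ * mixedNorm p f = ‖c‖ₑ * mixedNorm p (c⁻¹ • c • f :
          EuclideanSpace ℝ (Fin n) →ₘ[volume] ℂ) := by rw [inv_smul_smul₀ hc]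
      _ ≤ ‖c‖ₑ * (‖c⁻¹‖ₑ * mixedNorm p (c • f : EuclideanSpace ℝ (Fin n) →ₘ[volume] ℂ)) :=
          mul_le_mul_right (mixedNorm_smul_le _ _) _
      _ = mixedNorm p (c • f : EuclideanSpace ℝ (Fin n) →ₘ[volume] ℂ) := by
          rw [← mul_assoc, enorm_inv hc, ENNReal.mul_inv_cancel (by simpa using hc) (by simp),
            one_mul]

theorem mixedNorm_zero : mixedNorm p (0 : EuclideanSpace ℝ (Fin n) →ₘ[volume] ℂ) = 0 := by
  rw [mixedNorm_congr_ae AEEqFun.coeFn_zero]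
  simpa [mixedNorm] using iteratedNorm_zero n p

theorem eq_zero_of_mixedNorm_eq_zero (hpq : ConjExps p q)
    {f : EuclideanSpace ℝ (Fin n) →ₘ[volume] ℂ} (h : mixedNorm p f = 0) : f = 0 := by
  have h1 := iteratedNorm.ae_eq_zero hpq (measurable_comp_toLp f.measurable).enorm h
  refine AEEqFun.ext ?_
  filter_upwards [ae_ofLp h1, AEEqFun.coeFn_zero (α := EuclideanSpace ℝ (Fin n)) (β := ℂ)
    (μ := volume)] with x hx h0
  rw [h0]
  simpa using hx

namespace MixedLebesgue

instance (p : Fin n → ℝ≥0∞) : Norm (MixedLebesgue p) := ⟨fun f => (mixedNorm p f.1).toReal⟩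

theorem norm_def (f : MixedLebesgue p) : ‖f‖ = (mixedNorm p f.1).toReal := rfl

theorem ofReal_norm (f : MixedLebesgue p) : ENNReal.ofReal ‖f‖ = mixedNorm p f.1 :=
  ENNReal.ofReal_toReal (ne_of_lt f.2)

theorem core (hpq : ConjExps p q) : NormedSpace.Core ℂ (MixedLebesgue p) where
  norm_nonneg f := ENNReal.toReal_nonneg
  norm_smul c f := by
    rw [norm_def, norm_def, Submodule.coe_smul, mixedNorm_smul, ENNReal.toReal_mul, toReal_enorm]
  norm_triangle f g := by
    rw [norm_def, norm_def, norm_def, ← ENNReal.toReal_add (ne_of_lt f.2) (ne_of_lt g.2)]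
    exact ENNReal.toReal_mono (ENNReal.add_ne_top.2 ⟨ne_of_lt f.2, ne_of_lt g.2⟩)
      (mixedNorm_add_le hpq f.1 g.1)
  norm_eq_zero_iff f := by
    constructor
    · intro h
      rw [norm_def, ENNReal.toReal_eq_zero_iff] at h
      exact Subtype.ext (eq_zero_of_mixedNorm_eq_zero hpq (h.resolve_right (ne_of_lt f.2)))
    · rintro rfl
      rw [norm_def, Submodule.coe_zero, mixedNorm_zero, ENNReal.toReal_zero]

/-- The mixed norm makes the mixed Lebesgue space a normed group. -/
abbrev normedAddCommGroup (hpq : ConjExps p q) : NormedAddCommGroup (MixedLebesgue p) :=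
  NormedAddCommGroup.ofCore (core hpq)

/-- The mixed norm makes the mixed Lebesgue space a normed space. -/
abbrev normedSpace (hpq : ConjExps p q) :
    letI := normedAddCommGroup hpq
    NormedSpace ℂ (MixedLebesgue p) :=
  letI := normedAddCommGroup hpq
  NormedSpace.ofCore (core hpq)

theorem coeFn_finsetSum {ι : Type*} (s : Finset ι) (u : ι → MixedLebesgue p) :
    ∀ᵐ x, (∑ i ∈ s, u i).1 x = ∑ i ∈ s, (u i).1 x := by
  induction s using Finset.cons_induction with
  | empty => simp
  | cons i s hi ih =>
    filter_upwards [ih, AEEqFun.coeFn_add (u i).1 (∑ i ∈ s, u i).1] with x h1 h2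
    rw [Finset.sum_cons, Finset.sum_cons, Submodule.coe_add, h2, Pi.add_apply, h1]

/-- An absolutely convergent series in a mixed Lebesgue space converges. -/
theorem exists_tendsto_sum (hpq : ConjExps p q) (u : ℕ → MixedLebesgue p)
    (hu : ∑' i, mixedNorm p (u i).1 < ∞) : ∃ a : MixedLebesgue p,
      Filter.Tendsto (fun k => mixedNorm p (∑ i ∈ Finset.range k, u i - a).1)
        Filter.atTop (nhds 0) := by
  set w : ℕ → (Fin n → ℝ) → ℂ := fun i x => (u i).1 (WithLp.toLp 2 x) with hw
  have hwm : ∀ i, Measurable (w i) := fun i => measurable_comp_toLp (u i).1.measurable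
  -- The countable triangle inequality gives `G` finite norm. Hence the series converges absolutely
  -- a.e., and `G` dominates every tail.
  set G : (Fin n → ℝ) → ℝ≥0∞ := fun x => ∑' i, ‖w i x‖ₑ with hG
  have hGm : Measurable G := Measurable.tsum fun i => (hwm i).enorm
  have hGfin : iteratedNorm n p G < ∞ :=
    (iteratedNorm.tsum_le hpq fun i => (hwm i).enorm).trans_lt hu
  have hGae := iteratedNorm.ae_lt_top hpq hGm hGfin
  have hsum : ∀ x, G x < ∞ → Summable fun i => w i x := fun x hx =>
    Summable.of_enorm hx.ne
  set s : EuclideanSpace ℝ (Fin n) → ℂ := fun x => ∑' i, (u i).1 x with hs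
  have hsae : AEStronglyMeasurable s volume := by
    refine aestronglyMeasurable_of_tendsto_ae Filter.atTop
      (f := fun k x => ∑ i ∈ Finset.range k, (u i).1 x)
      (fun k => Finset.aestronglyMeasurable_fun_sum _ fun i _ => (u i).1.aestronglyMeasurable) ?_
    filter_upwards [ae_ofLp hGae] with x hx
    exact (hsum _ hx).hasSum.tendsto_sum_nat
  set a : EuclideanSpace ℝ (Fin n) →ₘ[volume] ℂ := AEEqFun.mk s hsae with ha
  have haw : ∀ᵐ x : Fin n → ℝ, a (WithLp.toLp 2 x) = ∑' i, w i x :=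
    ae_toLp (AEEqFun.coeFn_mk s hsae)
  have hafin : mixedNorm p a < ∞ := by
    refine (iteratedNorm.mono_ae ?_).trans_lt hGfin
    filter_upwards [haw] with x hx
    rw [hx]
    exact enorm_tsum_le_tsum_enorm
  refine ⟨⟨a, hafin⟩, ?_⟩
  have hdiff : ∀ k, mixedNorm p (∑ i ∈ Finset.range k, u i - ⟨a, hafin⟩ : MixedLebesgue p).1 =
      iteratedNorm n p fun x =>
        ‖∑ i ∈ Finset.range k, w i x - a (WithLp.toLp 2 x)‖ₑ := fun k => by
    refine iteratedNorm.congr_ae ?_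
    filter_upwards [ae_toLp (coeFn_finsetSum (Finset.range k) u),
      ae_toLp (AEEqFun.coeFn_sub (∑ i ∈ Finset.range k, u i).1 a)] with x h1 h2
    rw [Submodule.coe_sub, h2, Pi.sub_apply, h1]
  simp_rw [hdiff]
  refine iteratedNorm.tendsto_zero hpq (G := fun x => G x)
    (fun k => ((Finset.measurable_fun_sum _ fun i _ => hwm i).sub
      (measurable_comp_toLp a.measurable)).enorm) hGm hGfin (fun k => ?_) ?_
  · filter_upwards [haw, hGae] with x hx hfin
    have h1 := (hsum x hfin).sum_add_tsum_nat_add k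
    rw [hx, ← h1, sub_add_cancel_left, enorm_neg]
    refine enorm_tsum_le_tsum_enorm.trans ?_
    exact ENNReal.tsum_comp_le_tsum_of_injective (add_left_injective k) _
  · filter_upwards [haw, hGae] with x hx hfin
    have h1 := (hsum x hfin).hasSum.tendsto_sum_nat.sub_const (∑' i, w i x)
    rw [sub_self] at h1
    rw [hx]
    simpa using h1.enorm

theorem completeSpace (hpq : ConjExps p q) :
    letI := normedAddCommGroup hpq
    CompleteSpace (MixedLebesgue p) := by
  let _ := normedAddCommGroup hpq
  refine NormedAddCommGroup.completeSpace_of_summable_imp_tendsto fun u hu => ?_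
  have h1 : ∑' i, mixedNorm p (u i).1 < ∞ := by
    simp_rw [← ofReal_norm]
    exact hu.tsum_ofReal_lt_top
  obtain ⟨a, ha⟩ := exists_tendsto_sum hpq u h1
  refine ⟨a, tendsto_iff_norm_sub_tendsto_zero.2 ?_⟩
  have h2 := (ENNReal.tendsto_toReal ENNReal.zero_ne_top).comp ha
  rw [ENNReal.toReal_zero] at h2
  exact h2

/-- Square integrable functions are dense in a mixed Lebesgue space. -/
theorem exists_tendsto_Lp_two (hpq : ConjExps p q) (f : MixedLebesgue p) :
    ∃ (g : ℕ → Lp ℂ 2 (volume : Measure (EuclideanSpace ℝ (Fin n)))) (hg : ∀ k,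
      (g k).1 ∈ MixedLebesgue p), Filter.Tendsto
        (fun k => mixedNorm p ((⟨(g k).1, hg k⟩ : MixedLebesgue p) - f).1)
        Filter.atTop (nhds 0) := by
  obtain ⟨g, hg, hle, -, hlim⟩ := exists_test_approx hpq (measurable_comp_toLp f.1.measurable) f.2
  have hco : ∀ k, ∀ᵐ x, ofCoords n (hg k).toLp (WithLp.toLp 2 x) = g k x := fun k => by
    filter_upwards [ae_toLp (coeFn_ofCoords (hg k).toLp), (hg k).coeFn_toLp] with x h1 h2
    rw [h1, h2]
  have hmem : ∀ k, (ofCoords n (hg k).toLp).1 ∈ MixedLebesgue p := fun k => by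
    refine lt_of_eq_of_lt (iteratedNorm.congr_ae ?_) ((hg k).iteratedNorm_lt_top p)
    filter_upwards [hco k] with x hx
    rw [hx]
  refine ⟨fun k => ofCoords n (hg k).toLp, hmem, hlim.congr fun k => ?_⟩
  refine (iteratedNorm.congr_ae ?_).symm
  filter_upwards [hco k, ae_toLp (AEEqFun.coeFn_sub (ofCoords n (hg k).toLp).1 f.1)] with x h1 h2
  rw [Submodule.coe_sub, h2, Pi.sub_apply, h1]

end MixedLebesgue

end space

/-! ### Extension by density. -/

section extension

variable {n : ℕ} {q q' : Fin n → ℝ≥0∞}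

/-- The inclusion of `L²` into the space of classes of measurable functions. -/
def lpInclusion (n : ℕ) : Lp ℂ 2 (volume : Measure (EuclideanSpace ℝ (Fin n))) →ₗ[ℂ]
    (EuclideanSpace ℝ (Fin n) →ₘ[volume] ℂ) where
  toFun g := g.1
  map_add' _ _ := rfl
  map_smul' _ _ := rfl

/-- An operator on `L²` that is bounded for a mixed norm extends uniquely to a bounded operator
of the mixed Lebesgue space. -/
theorem existsUnique_extension (hqq : ConjExps q q')
    (T : Lp ℂ 2 (volume : Measure (EuclideanSpace ℝ (Fin n))) →L[ℂ]
      Lp ℂ 2 (volume : Measure (EuclideanSpace ℝ (Fin n)))) {C : ℝ≥0}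
    (hC : ∀ g : Lp ℂ 2 (volume : Measure (EuclideanSpace ℝ (Fin n))),
      mixedNorm q g < ∞ → mixedNorm q (T g) ≤ C * mixedNorm q g) :
    ∃! S : MixedLebesgue q →ₗ[ℂ] MixedLebesgue q,
      (∃ C : ℝ≥0, ∀ f : MixedLebesgue q,
        mixedNorm q (S f).1 ≤ C * mixedNorm q f.1) ∧
      (∀ (f : MixedLebesgue q) (g : Lp ℂ 2 (volume : Measure (EuclideanSpace ℝ (Fin n)))),
        f.1 = g.1 → (S f).1 = (T g).1) := by
  let _ := MixedLebesgue.normedAddCommGroup hqq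
  let _ := MixedLebesgue.normedSpace hqq
  have _ := MixedLebesgue.completeSpace hqq
  -- `D` is the intersection of `L²` with the mixed space; on it `e` is the inclusion and `t` is
  -- `T`, and `T` is extended along the dense map `e`.
  let D := (MixedLebesgue q).comap (lpInclusion n)
  let e : D →ₗ[ℂ] MixedLebesgue q :=
    (lpInclusion n ∘ₗ D.subtype).codRestrict (MixedLebesgue q) fun g => g.2
  let t : D →ₗ[ℂ] MixedLebesgue q :=
    (lpInclusion n ∘ₗ T.toLinearMap ∘ₗ D.subtype).codRestrict (MixedLebesgue q) fun g =>
      (hC g.1 g.2).trans_lt (ENNReal.mul_lt_top ENNReal.coe_lt_top g.2)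
  have hdense : DenseRange e := fun f => by
    obtain ⟨g, hg, hlim⟩ := MixedLebesgue.exists_tendsto_Lp_two hqq f
    refine mem_closure_of_tendsto (f := fun k => e ⟨g k, hg k⟩) (b := Filter.atTop)
      (tendsto_iff_norm_sub_tendsto_zero.2 ?_)
      (Filter.Eventually.of_forall fun k => Set.mem_range_self _)
    have h := (ENNReal.tendsto_toReal ENNReal.zero_ne_top).comp hlim
    rw [ENNReal.toReal_zero] at h
    exact h
  have hle : ∀ {f g : MixedLebesgue q} {c : ℝ≥0},
      mixedNorm q f.1 ≤ c * mixedNorm q g.1 ↔ ‖f‖ ≤ c * ‖g‖ := fun {f g c} => by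
    rw [← MixedLebesgue.ofReal_norm f, ← MixedLebesgue.ofReal_norm g, ← ENNReal.ofReal_coe_nnreal,
      ← ENNReal.ofReal_mul c.coe_nonneg, ENNReal.ofReal_le_ofReal_iff (mul_nonneg c.coe_nonneg (norm_nonneg g))]
  have hnorm : ∀ g : D, ‖t g‖ ≤ C * ‖e g‖ := fun g => hle.1 (hC g.1 g.2)
  have hext : ∀ S : MixedLebesgue q →ₗ[ℂ] MixedLebesgue q, (∀ g : D, S (e g) = t g) ↔
      ∀ (f : MixedLebesgue q) (g : Lp ℂ 2 (volume : Measure (EuclideanSpace ℝ (Fin n)))),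
        f.1 = g.1 → (S f).1 = (T g).1 := fun S => by
    constructor
    · rintro h ⟨f, hf⟩ g rfl
      exact congrArg Subtype.val (h ⟨g, hf⟩)
    · exact fun h g => Subtype.ext (h (e g) g.1 rfl)
  refine ⟨(t.extendOfNorm e).toLinearMap, ⟨⟨C, fun f => hle.2 ?_⟩, (hext _).1 fun g => ?_⟩, ?_⟩
  · exact LinearMap.norm_extendOfNorm_apply_le hdense C hnorm f
  · exact LinearMap.extendOfNorm_eq hdense ⟨C, hnorm⟩ g
  -- A competitor is bounded, hence continuous, and agrees with the extension on the dense range of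
  -- `e`.
  · rintro S ⟨⟨C', hS⟩, hST⟩
    have h := LinearMap.extendOfNorm_unique hdense C hnorm
      (S.mkContinuous C' fun f => hle.1 (hS f)) (LinearMap.ext ((hext S).2 hST))
    rw [h]
    rfl

end extension

end

theorem mainTheorem11 {n : ℕ} (hn : 1 ≤ n) (q : Fin n → ℝ≥0∞)
    (hq : ∀ j, 1 < q j ∧ q j < ∞)
    (k : EuclideanSpace ℝ (Fin n) → EuclideanSpace ℝ (Fin n) → ℂ)
    (T : Lp ℂ 2 (volume : Measure (EuclideanSpace ℝ (Fin n))) →L[ℂ]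
      Lp ℂ 2 (volume : Measure (EuclideanSpace ℝ (Fin n))))
    (hT : IsSingularIntegralOperator k T) :
    ∃! S : MixedLebesgue q →ₗ[ℂ] MixedLebesgue q,
      (∃ C : ℝ≥0, ∀ f : MixedLebesgue q,
        mixedNorm q (S f).1 ≤ C * mixedNorm q f.1) ∧
      (∀ (f : MixedLebesgue q) (g : Lp ℂ 2 (volume : Measure (EuclideanSpace ℝ (Fin n)))),
        f.1 = g.1 → (S f).1 = (T g).1) := by
  obtain ⟨q', hqq⟩ := ConjExps.exists_conj hq
  obtain ⟨C, hC⟩ := hT.exists_mixedNorm_le hq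
  exact existsUnique_extension hqq T hC
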